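/- Let $d\ge 1$, $\alpha\in(0,1]$ and $Q=(0,1)^d\subseteq\mathbb R^d$ with the Euclidean norm. For $f:Q\to\mathbb R$ put \[ \|f\|_{C^\alpha}=\sup_{x\in Q}|f(x)|+\sup_{x\ne y\in Q}\frac{|f(y)-f(x)|}{|x-y|^\alpha}, \] and for a map $F$ on $\overline Q$ put $\operatorname{Lip}F=\sup_{x\neq y\in\overline Q}|F(y)-F(x)|/|x-y|$. Let $(P_t)_{t\ge 0}$ be the heat semigroup on $Q$ with null Neumann boundary conditions, i.e. $\rho_t=P_t\rho$ is the curve with $\rho_0=\rho$, $\rho_t\in H^1(Q)$ for $t>0$, $\nabla\rho_s\in L^2((0,t)\times Q)$ for every $t>0$, and \[ \int_Q f\rho_t=\int_Q f\rho-\int_0^t\int_Q\nabla f\cdot\nabla\rho_s\,dx\,ds\qquad\text{for all } f\in H^1(Q),\ t\ge 0. \] There is a constant $C\geq 0$ depending only on $d$ and $\alpha$ such that the following holds. For every $\rho:Q\to(0,\infty)$ with $\int_Q\rho=1$ and $\|\rho-1\|_{C^\alpha}\le 1/2$ there is a bijection $T:\overline Q\to\overline Q$, with $T(Q)=Q$ and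 $T(\partial Q)=\partial Q$, such that $T_\sharp\rho=1$ (the push-forward by $T$ of the measure on $Q$ with density $\rho$ is the Lebesgue measure on $Q$) and \[ \operatorname{Lip}T\le 1+C\|\rho-1\|_{C^\alpha},\qquad \operatorname{Lip}T^{-1}\le 1+C\|\rho-1\|_{C^\alpha}. \] Moreover, $T$ can be taken as the limit of the following flow: for $t>0$ the function $\rho_t=P_t\rho$ has a strictly positive $C^1$ version on $Q$, and with $b_t=-\nabla\log\rho_t$ there is $X:[0,\infty)\times Q\to Q$ such that, for all $x\in Q$ and $t\ge 0$, $s\mapsto b_s(X(s,x))$ is integrable on $(0,t)$, \[ X(t,x)=x+\int_0^t b_s(X(s,x))\,ds \qquad\text{and}\qquad T(x)=\lim_{t\to\infty}X(t,x). \] -/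

import Mathlib

open MeasureTheory Set Filter Topology
open scoped NNReal ENNReal ContDiff

noncomputable section

/-- The open unit cube `(0,1)^d` in Euclidean space. -/
def unitCube (d : ℕ) : Set (EuclideanSpace ℝ (Fin d)) :=
  {x | ∀ i, 0 < x i ∧ x i < 1}

/-- `Lip_Ω f`, the supremum over distinct `x, y ∈ Ω` of `|f y - f x| / |x - y|`, with values in
`[0, ∞]`. -/
def lipConst {E F : Type*} [MetricSpace E] [MetricSpace F] (Ω : Set E) (f : E → F) : ℝ≥0∞ :=
  ⨆ x ∈ Ω, ⨆ y ∈ Ω, ⨆ _ : x ≠ y, edist (f y) (f x) / edist x y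

/-- The full Hölder norm `‖f‖_{C^α(Ω)}`, that is the supremum norm plus the `α`-Hölder seminorm,
with values in `[0, ∞]`. -/
def cHolderNorm {E F : Type*} [MetricSpace E] [NormedAddCommGroup F] (Ω : Set E) (α : ℝ)
    (f : E → F) : ℝ≥0∞ :=
  (⨆ x ∈ Ω, ‖f x‖ₑ) +
    ⨆ x ∈ Ω, ⨆ y ∈ Ω, ⨆ _ : x ≠ y, edist (f y) (f x) / edist x y ^ α

/-- The measure on `Ω` with density `ρ` with respect to the Lebesgue measure. -/
def densityMeasure {d : ℕ} (Ω : Set (EuclideanSpace ℝ (Fin d)))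
    (ρ : EuclideanSpace ℝ (Fin d) → ℝ) : Measure (EuclideanSpace ℝ (Fin d)) :=
  (volume.restrict Ω).withDensity (fun x => ENNReal.ofReal (ρ x))

/-- `f` belongs to the Sobolev space `H^1(Ω)` and `g` is its weak gradient: both are in `L^2(Ω)`
and `∫_Ω f ∇φ = - ∫_Ω φ g` for every smooth `φ` with compact support in `Ω`. -/
structure IsSobolevH1 {d : ℕ} (Ω : Set (EuclideanSpace ℝ (Fin d)))
    (f : EuclideanSpace ℝ (Fin d) → ℝ)
    (g : EuclideanSpace ℝ (Fin d) → EuclideanSpace ℝ (Fin d)) : Prop where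
  memLp : MemLp f 2 (volume.restrict Ω)
  memLp_grad : MemLp g 2 (volume.restrict Ω)
  weak_grad : ∀ φ : EuclideanSpace ℝ (Fin d) → ℝ, ContDiff ℝ ∞ φ → HasCompactSupport φ →
    tsupport φ ⊆ Ω → ∫ x in Ω, f x • gradient φ x = - ∫ x in Ω, φ x • g x

/-- `u t = P_t ρ` for `t ≥ 0`, where `P_t` is the heat semigroup on `Ω` with null Neumann boundary
conditions: `u 0 = ρ`, for `t > 0` the function `u t` is in `H^1(Ω)`, its gradient `G` is in
`L^2((0,t) × Ω)` for every `t`, and for every `f ∈ H^1(Ω)` and `t ≥ 0`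
`∫_Ω f u_t = ∫_Ω f ρ - ∫_0^t ∫_Ω ∇f · ∇u_s ds`.
The test functions `f` are not required to vanish on the boundary; this encodes the Neumann
condition. Each `u t` is determined up to Lebesgue-null sets. -/
def IsNeumannHeatFlow {d : ℕ} (Ω : Set (EuclideanSpace ℝ (Fin d)))
    (ρ : EuclideanSpace ℝ (Fin d) → ℝ) (u : ℝ → EuclideanSpace ℝ (Fin d) → ℝ) : Prop :=
  u 0 =ᵐ[volume.restrict Ω] ρ ∧
  ∃ G : ℝ → EuclideanSpace ℝ (Fin d) → EuclideanSpace ℝ (Fin d),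
    (∀ t : ℝ, 0 < t → IsSobolevH1 Ω (u t) (G t)) ∧
    (∀ t : ℝ, 0 < t → MemLp (fun p : ℝ × EuclideanSpace ℝ (Fin d) => G p.1 p.2) 2
      ((volume.restrict (Ioc 0 t)).prod (volume.restrict Ω))) ∧
    ∀ (f : EuclideanSpace ℝ (Fin d) → ℝ)
      (g : EuclideanSpace ℝ (Fin d) → EuclideanSpace ℝ (Fin d)), IsSobolevH1 Ω f g →
      ∀ t : ℝ, 0 ≤ t →
        ∫ x in Ω, f x * u t x =
          (∫ x in Ω, f x * ρ x) - ∫ s in (0 : ℝ)..t, ∫ x in Ω, inner ℝ (g x) (G s x)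

/-- `X` is the flow on `Ω` of the time-dependent vector field `b`, defined for positive times:
`X(t,x) ∈ Ω` and `X(t,x) = x + ∫_0^t b_s(X(s,x)) ds` for all `t ≥ 0` and `x ∈ Ω`. -/
def IsFlowOn {d : ℕ} (Ω : Set (EuclideanSpace ℝ (Fin d)))
    (b : ℝ → EuclideanSpace ℝ (Fin d) → EuclideanSpace ℝ (Fin d))
    (X : ℝ → EuclideanSpace ℝ (Fin d) → EuclideanSpace ℝ (Fin d)) : Prop :=
  ∀ x ∈ Ω, ∀ t : ℝ, 0 ≤ t →
    X t x ∈ Ω ∧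
    IntervalIntegrable (fun s => b s (X s x)) volume 0 t ∧
    X t x = x + ∫ s in (0 : ℝ)..t, b s (X s x)

end

open MeasureTheory Set Filter Topology
open scoped NNReal ENNReal ContDiff
open ProbabilityTheory

set_option linter.unusedSectionVars false

/-! ### Gaussian averages and their gradients -/

section Gaussian

variable {E : Type*} [NormedAddCommGroup E] [InnerProductSpace ℝ E] [FiniteDimensional ℝ E]
  [MeasurableSpace E] [BorelSpace E]

/-! Removing the boundary. Put `ε = ‖ρ - 1‖_{C^α}`. A Hölder extension of `ρ - 1` to the whole
space, composed with the folding `cubeFold`, gives a function `f` with the same bounds that is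
symmetric under all reflections in the hyperplanes `x i = c`, `c ∈ ℤ`
(`exists_foldInvariant_extension`). Its heat evolution on the whole space, an explicit Gaussian
convolution, has the same symmetries, so its normal derivative vanishes on the faces of the cube.
Hence `1 + heat t f`, restricted to the cube, is the Neumann heat flow of `ρ`
(`isNeumannHeatFlow_heat`).

Lipschitz bound. Hölder regularity of `f` gives `|∇ P_t f| ≲ ε t^((α-1)/2)` and `|D² P_t f| ≲ ε
t^(α/2-1)`, while the zero mean of `f` on the cube gives decay like `ε t^(-3/2)` for large times
(`exists_heatGrad_bounds`). So `b_t = -∇ log (1 + P_t f)` has a Lipschitz constant whose integral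
over `(0,∞)` is at most of order `ε`, and Gronwall's inequality, forward and backward in time,
bounds the flow and its inverse by `exp (c ε) ≤ 1 + c exp(c) ε`.

Compactifying time. The substitution `t = (τ/(1-τ))^n` with `n` large in terms of `1/α` absorbs both
the singularity at `t = 0` and the infinite horizon: the new field is bounded, uniformly Lipschitz,
and continuous when extended by zero outside `(0,1)` (`clockDeriv_mul_heatWeight_le`).
Picard–Lindelöf then gives a flow `Y a b`; the map `T` is `Y 0 1` and its inverse is `Y 1 0`. By
symmetry the flow preserves every hyperplane `x i = c`, hence the cube
(`IsODEFlow.mapsTo_unitCube`).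

Push-forward. The heat equation is the continuity equation `∂u + div (u b) = 0`. To avoid
differentiating the flow in space, one shows that `∫ φ(Y τ 1 x) r τ x dx` has zero right derivative
in `τ` for Lipschitz compactly supported `φ`: one step of the flow is replaced by the Euler map `x +
h V(τ, x)`, for which the change of variables is exact, and the error is `o(h)`
(`hasDerivWithinAt_transported`). The value at `τ = 0` is the integral of `φ ∘ T` against the
initial density, the value at `τ = 1` that of `φ` against Lebesgue measure. -/

theorem integrable_rexp_neg_mul_sq_norm {b : ℝ} (hb : 0 < b) :
    Integrable (fun v : E => Real.exp (-b * ‖v‖ ^ 2)) := by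
  by_contra h
  have h1 := GaussianFourier.integral_rexp_neg_mul_sq_norm (V := E) hb
  rw [integral_undef h] at h1
  have : (0 : ℝ) < (Real.pi / b) ^ (Module.finrank ℝ E / 2 : ℝ) := by positivity
  linarith

/-- The density of the standard Gaussian measure with respect to the Lebesgue measure. -/
noncomputable def gaussDensity (z : E) : ℝ :=
  (2 * Real.pi) ^ (-(Module.finrank ℝ E / 2 : ℝ)) * Real.exp (-(1 / 2) * ‖z‖ ^ 2)

theorem gaussDensity_pos (z : E) : 0 < gaussDensity z := by
  unfold gaussDensity; positivity

theorem continuous_gaussDensity : Continuous (gaussDensity (E := E)) := by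
  unfold gaussDensity; fun_prop

theorem integrable_gaussDensity : Integrable (gaussDensity (E := E)) :=
  (integrable_rexp_neg_mul_sq_norm (by norm_num)).const_mul _

theorem integral_gaussDensity_withDensity {F : Type*} [NormedAddCommGroup F] [NormedSpace ℝ F]
    (g : E → F) :
    ∫ z, g z ∂(volume.withDensity fun z : E => ENNReal.ofReal (gaussDensity z)) =
      ∫ z, gaussDensity z • g z := by
  rw [integral_withDensity_eq_integral_toReal_smul]
  · simp [ENNReal.toReal_ofReal, (gaussDensity_pos _).le]
  · exact continuous_gaussDensity.measurable.ennreal_ofReal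
  · simp

/-- Comparison of characteristic functions. The density makes it possible to let derivatives fall on
the kernel rather than on `f`, which is only continuous. -/
theorem stdGaussian_eq_withDensity :
    stdGaussian E = volume.withDensity fun z : E => ENNReal.ofReal (gaussDensity z) := by
  have hf : IsFiniteMeasure (volume.withDensity fun z : E => ENNReal.ofReal (gaussDensity z)) := by
    apply isFiniteMeasure_withDensity_ofReal
    exact integrable_gaussDensity.2
  apply Measure.ext_of_charFun
  ext t
  rw [charFun_stdGaussian, charFun_apply, integral_gaussDensity_withDensity]
  have h := GaussianFourier.integral_cexp_neg_mul_sq_norm_add (V := E) (b := 1 / 2)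
    (by norm_num) Complex.I t
  have h2 : ∀ z : E, gaussDensity z • Complex.exp (inner ℝ z t * Complex.I) =
      ((2 * Real.pi : ℝ) ^ (-(Module.finrank ℝ E / 2 : ℝ)) : ℝ) *
        Complex.exp (-(1 / 2) * ‖z‖ ^ 2 + Complex.I * inner ℝ t z) := by
    intro z
    rw [Complex.exp_add, gaussDensity, real_inner_comm, Complex.real_smul]
    push_cast
    rw [mul_comm Complex.I]
    ring
  simp_rw [h2]
  rw [integral_const_mul, h, ← mul_assoc, Complex.ofReal_cpow (by positivity)]
  have h3 : ((2 * Real.pi : ℝ) : ℂ) ≠ 0 := by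
    rw [Ne, Complex.ofReal_eq_zero]; positivity
  have h4 : (Real.pi : ℂ) / (1 / 2) = ((2 * Real.pi : ℝ) : ℂ) := by
    push_cast; field_simp
  rw [h4]
  push_cast at h3 ⊢
  rw [← Complex.cpow_add _ _ h3]
  simp only [neg_add_cancel, Complex.cpow_zero, one_mul, Complex.I_sq]
  congr 1
  ring

theorem integral_stdGaussian {F : Type*} [NormedAddCommGroup F] [NormedSpace ℝ F] (g : E → F) :
    ∫ z, g z ∂(stdGaussian E) = ∫ z, gaussDensity z • g z := by
  rw [stdGaussian_eq_withDensity, integral_gaussDensity_withDensity]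

theorem integrable_norm_stdGaussian : Integrable (fun z : E => ‖z‖) (stdGaussian E) :=
  IsGaussian.integrable_id.norm

theorem integrable_sq_norm_stdGaussian : Integrable (fun z : E => ‖z‖ ^ 2) (stdGaussian E) :=
  (IsGaussian.memLp_id (stdGaussian E) 2 (by simp)).integrable_norm_pow (by simp)

/-- The average of `f (x + s z)` over a standard Gaussian variable `z`. -/
noncomputable def gaussAvg (s : ℝ) (f : E → ℝ) (x : E) : ℝ := ∫ z, f (x + s • z) ∂(stdGaussian E)

/-- The vector `s⁻¹ ∫ f (x + s z) z`, which is the gradient of `gaussAvg s f`. -/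
noncomputable def gaussGrad (s : ℝ) (f : E → ℝ) (x : E) : E :=
  s⁻¹ • ∫ z, f (x + s • z) • z ∂(stdGaussian E)

/-- Continuous functions bounded by `B`. -/
structure BddCont (f : E → ℝ) (B : ℝ) : Prop where
  cont : Continuous f
  bound : ∀ x, |f x| ≤ B

theorem BddCont.nonneg {f : E → ℝ} {B : ℝ} (h : BddCont f B) : 0 ≤ B :=
  (abs_nonneg _).trans (h.bound 0)

theorem BddCont.integrable_avg {f : E → ℝ} {B : ℝ} (h : BddCont f B) (s : ℝ) (x : E) :
    Integrable (fun z => f (x + s • z)) (stdGaussian E) := by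
  have := h.cont
  refine Integrable.of_bound (C := B) (by fun_prop) (Eventually.of_forall fun z => h.bound _)

theorem BddCont.integrable_smul {f : E → ℝ} {B : ℝ} (h : BddCont f B) (s : ℝ) (x : E) :
    Integrable (fun z => f (x + s • z) • z) (stdGaussian E) := by
  have := h.cont
  refine (integrable_norm_stdGaussian.const_mul B).mono' (by fun_prop) (Eventually.of_forall ?_)
  intro z
  rw [norm_smul]
  exact mul_le_mul_of_nonneg_right (h.bound _) (norm_nonneg _)

theorem gaussAvg_bddCont {f : E → ℝ} {B : ℝ} (h : BddCont f B) (s : ℝ) :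
    BddCont (gaussAvg s f) B := by
  have := h.cont
  constructor
  · refine continuous_of_dominated (bound := fun _ => B) (fun x => ?_) (fun x => ?_)
      (integrable_const _) ?_
    · fun_prop
    · exact Eventually.of_forall fun z => h.bound _
    · exact Eventually.of_forall fun z => by fun_prop
  · intro x
    have := norm_integral_le_of_norm_le_const (μ := stdGaussian E) (f := fun z => f (x + s • z))
      (Eventually.of_forall fun z => h.bound (x + s • z))
    simpa [gaussAvg] using this

theorem continuous_gaussAvg_uncurry {f : E → ℝ} {B : ℝ} (h : BddCont f B) :
    Continuous (fun p : ℝ × E => gaussAvg p.1 f p.2) := by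
  have := h.cont
  refine continuous_of_dominated (bound := fun _ => B) (fun x => ?_) (fun x => ?_)
      (integrable_const _) ?_
  · fun_prop
  · exact Eventually.of_forall fun z => h.bound _
  · exact Eventually.of_forall fun z => by fun_prop

theorem continuousOn_gaussGrad_uncurry {f : E → ℝ} {B : ℝ} (h : BddCont f B) :
    ContinuousOn (fun p : ℝ × E => gaussGrad p.1 f p.2) (Ioi 0 ×ˢ univ) := by
  have := h.cont
  refine ContinuousOn.smul ?_ (Continuous.continuousOn ?_)
  · exact ContinuousOn.inv₀ (by fun_prop) (fun p hp => (ne_of_gt hp.1))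
  · refine continuous_of_dominated (bound := fun z => B * ‖z‖) (fun x => ?_) (fun x => ?_)
      (integrable_norm_stdGaussian.const_mul B) ?_
    · fun_prop
    · exact Eventually.of_forall fun z => by
        rw [norm_smul]
        exact mul_le_mul_of_nonneg_right (h.bound _) (norm_nonneg _)
    · exact Eventually.of_forall fun z => by fun_prop

theorem gaussAvg_zero (f : E → ℝ) : gaussAvg 0 f = f := by
  ext x; simp [gaussAvg]

theorem gaussAvg_one_eq (f : E → ℝ) (x : E) :
    gaussAvg 1 f x = ∫ y, gaussDensity (y - x) * f y := by
  rw [gaussAvg, integral_stdGaussian, ← integral_sub_right_eq_self _ x]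
  simp

theorem mul_exp_neg_half_sq_le (r : ℝ) :
    r * Real.exp (-(1 / 2) * r ^ 2) ≤ Real.exp (-(1 / 4) * r ^ 2) := by
  have h : r ≤ Real.exp (r ^ 2 / 4) := by
    have := Real.add_one_le_exp (r ^ 2 / 4)
    nlinarith [sq_nonneg (r - 2)]
  calc r * Real.exp (-(1 / 2) * r ^ 2) ≤ Real.exp (r ^ 2 / 4) * Real.exp (-(1 / 2) * r ^ 2) := by
        gcongr
    _ = _ := by rw [← Real.exp_add]; congr 1; ring

theorem hasFDerivAt_gaussDensity (y x : E) :
    HasFDerivAt (fun x => gaussDensity (y - x))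
      (gaussDensity (y - x) • innerSL ℝ (y - x)) x := by
  unfold gaussDensity
  have h1 : HasFDerivAt (fun x : E => y - x) (-ContinuousLinearMap.id ℝ E) x :=
    (hasFDerivAt_id x).const_sub y
  have h2 := (((h1.norm_sq.const_mul (-(1 / 2) : ℝ)).exp).const_mul
    ((2 * Real.pi) ^ (-(Module.finrank ℝ E / 2 : ℝ))))
  refine h2.congr_fderiv ?_
  ext v
  simp
  ring

theorem hasFDerivAt_gaussAvg_one {f : E → ℝ} {B : ℝ} (h : BddCont f B) (x : E) :
    HasFDerivAt (gaussAvg 1 f) (innerSL ℝ (gaussGrad 1 f x)) x := by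
  have hc := h.cont
  have hgc : Continuous (gaussDensity (E := E)) := continuous_gaussDensity
  set c : ℝ := (2 * Real.pi) ^ (-(Module.finrank ℝ E / 2 : ℝ)) with hcdef
  have hc0 : 0 < c := by positivity
  have key : HasFDerivAt (fun x => ∫ y, gaussDensity (y - x) * f y)
      (∫ y, f y • (gaussDensity (y - x) • innerSL ℝ (y - x))) x := by
    refine hasFDerivAt_integral_of_dominated_of_fderiv_le (μ := volume)
      (F := fun x y => gaussDensity (y - x) * f y)
      (F' := fun x y => f y • (gaussDensity (y - x) • innerSL ℝ (y - x)))
      (bound := fun y => B * c * Real.exp (1 / 4) * Real.exp (-(1 / 8) * ‖y - x‖ ^ 2))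
      (Metric.ball_mem_nhds x one_pos) ?_ ?_ ?_ ?_ ?_ ?_
    · exact Eventually.of_forall fun x' => by fun_prop
    · refine ((integrable_gaussDensity.comp_sub_right x).mul_const B).mono' (by fun_prop)
        (Eventually.of_forall fun y => ?_)
      rw [norm_mul, Real.norm_eq_abs, Real.norm_eq_abs, abs_of_pos (gaussDensity_pos _)]
      exact mul_le_mul_of_nonneg_left (h.bound y) (gaussDensity_pos _).le
    · fun_prop
    · refine Eventually.of_forall fun y x' hx' => ?_
      rw [Metric.mem_ball, dist_eq_norm] at hx'
      rw [norm_smul, norm_smul, innerSL_apply_norm]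
      have h1 : ‖f y‖ ≤ B := h.bound y
      -- On the unit ball around `x` one has `‖y - x‖ ≤ ‖y - x'‖ + 1`, hence `‖y - x‖² ≤ 2 ‖y - x'‖²
      -- + 2`; this turns the exponent `-‖y - x'‖²/4` into `1/4 - ‖y - x‖²/8`, which no longer
      -- depends on `x'`.
      have h2 : ‖gaussDensity (y - x')‖ * ‖y - x'‖ ≤
          c * (Real.exp (1 / 4) * Real.exp (-(1 / 8) * ‖y - x‖ ^ 2)) := by
        rw [Real.norm_eq_abs, abs_of_pos (gaussDensity_pos _), gaussDensity, ← hcdef, mul_assoc]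
        refine mul_le_mul_of_nonneg_left ?_ hc0.le
        rw [mul_comm]
        refine (mul_exp_neg_half_sq_le _).trans ?_
        rw [← Real.exp_add]
        refine Real.exp_le_exp.2 ?_
        have h3 : ‖y - x‖ ≤ ‖y - x'‖ + ‖x' - x‖ := norm_sub_le_norm_sub_add_norm_sub _ _ _
        have h4 : 0 ≤ ‖y - x‖ := norm_nonneg _
        have h5 : 0 ≤ ‖x' - x‖ := norm_nonneg _
        have h6 : ‖y - x‖ ≤ ‖y - x'‖ + 1 := by linarith
        nlinarith [sq_nonneg (‖y - x'‖ - 1), norm_nonneg (y - x')]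
      calc ‖f y‖ * (‖gaussDensity (y - x')‖ * ‖y - x'‖)
          ≤ B * (c * (Real.exp (1 / 4) * Real.exp (-(1 / 8) * ‖y - x‖ ^ 2))) := by
            gcongr
            exact h.nonneg
        _ = _ := by ring
    · exact ((integrable_rexp_neg_mul_sq_norm (by norm_num)).comp_sub_right x).const_mul _
    · refine Eventually.of_forall fun y x' _ => ?_
      have := (hasFDerivAt_gaussDensity y x').mul_const (f y)
      exact this
  have h1 : gaussAvg 1 f = fun x => ∫ y, gaussDensity (y - x) * f y := by
    ext x; exact gaussAvg_one_eq f x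
  rw [h1]
  refine key.congr_fderiv ?_
  have h0 : ∀ (a b : ℝ) (w : E), innerSL ℝ (a • b • w) = a • b • innerSL ℝ w := by
    intro a b w
    ext v
    simp
  have h2 : gaussGrad 1 f x = ∫ y, f y • (gaussDensity (y - x) • (y - x)) := by
    rw [gaussGrad, integral_stdGaussian, ← integral_sub_right_eq_self _ x]
    simp only [inv_one, one_smul, add_sub_cancel]
    congr 1
    ext y
    rw [smul_comm]
  rw [h2, ← ContinuousLinearMap.integral_comp_comm]
  · simp_rw [h0]
  · have := h.integrable_smul 1 x
    rw [stdGaussian_eq_withDensity] at this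
    rw [integrable_withDensity_iff_integrable_smul'] at this
    · have h3 := this.comp_sub_right x
      simp [ENNReal.toReal_ofReal, (gaussDensity_pos _).le] at h3
      refine h3.congr (Eventually.of_forall fun y => ?_)
      simp only
      rw [smul_comm]
    · exact continuous_gaussDensity.measurable.ennreal_ofReal
    · simp

theorem hasFDerivAt_gaussAvg {f : E → ℝ} {B s : ℝ} (h : BddCont f B) (hs : 0 < s) (x : E) :
    HasFDerivAt (gaussAvg s f) (innerSL ℝ (gaussGrad s f x)) x := by
  have hc := h.cont
  have hg : BddCont (fun x => f (s • x)) B := ⟨by fun_prop, fun x => h.bound _⟩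
  have h1 : gaussAvg s f = fun x => gaussAvg 1 (fun x => f (s • x)) (s⁻¹ • x) := by
    ext x
    simp [gaussAvg, smul_add, smul_smul, hs.ne']
  rw [h1]
  have h2 : HasFDerivAt (fun x : E => s⁻¹ • x) (s⁻¹ • ContinuousLinearMap.id ℝ E) x :=
    (hasFDerivAt_id x).const_smul s⁻¹
  refine ((hasFDerivAt_gaussAvg_one hg (s⁻¹ • x)).comp x h2).congr_fderiv ?_
  ext v
  simp [gaussGrad, smul_add, smul_smul, hs.ne']

end Gaussian

/-! ### Semigroup law and derivative estimates for Gaussian averages -/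

section Semigroup

variable {E : Type*} [NormedAddCommGroup E] [InnerProductSpace ℝ E] [FiniteDimensional ℝ E]
  [MeasurableSpace E] [BorelSpace E]

/-- Characteristic functions multiply and variances add. With `s = √(2t)` this is the semigroup law
of the heat flow. -/
theorem stdGaussian_map_smul_conv {s r q : ℝ} (hq : q ^ 2 = s ^ 2 + r ^ 2) :
    ((stdGaussian E).map (fun z => s • z)) ∗ ((stdGaussian E).map (fun z => r • z)) =
      (stdGaussian E).map (fun z => q • z) := by
  have i1 : ∀ a : ℝ, IsProbabilityMeasure ((stdGaussian E).map (fun z => a • z)) := fun a =>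
    Measure.isProbabilityMeasure_map (by fun_prop)
  have := i1 s
  have := i1 r
  have := i1 q
  apply Measure.ext_of_charFun
  ext t
  rw [charFun_conv, charFun_map_smul, charFun_map_smul, charFun_map_smul, charFun_stdGaussian,
    charFun_stdGaussian, charFun_stdGaussian, ← Complex.exp_add]
  congr 1
  simp only [norm_smul, Real.norm_eq_abs]
  rw [← add_div, ← neg_add]
  congr 2
  norm_cast
  rw [mul_pow, mul_pow, mul_pow, sq_abs, sq_abs, sq_abs, hq]
  ring

theorem gaussAvg_eq_integral_map {f : E → ℝ} (hf : Continuous f) (s : ℝ) (x : E) :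
    gaussAvg s f x = ∫ w, f (x + w) ∂((stdGaussian E).map (fun z => s • z)) := by
  rw [integral_map (by fun_prop) (by fun_prop)]
  rfl

theorem gaussAvg_gaussAvg {f : E → ℝ} {B : ℝ} (h : BddCont f B) {s r q : ℝ}
    (hq : q ^ 2 = s ^ 2 + r ^ 2) : gaussAvg s (gaussAvg r f) = gaussAvg q f := by
  have hc := h.cont
  ext x
  have i1 : ∀ a : ℝ, IsProbabilityMeasure ((stdGaussian E).map (fun z => a • z)) := fun a =>
    Measure.isProbabilityMeasure_map (by fun_prop)
  have := i1 s
  have := i1 r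
  rw [gaussAvg_eq_integral_map (gaussAvg_bddCont h r).cont, gaussAvg_eq_integral_map hc,
    ← stdGaussian_map_smul_conv hq, integral_conv]
  · congr 1
    ext w
    rw [gaussAvg_eq_integral_map hc]
    simp only [add_assoc]
  · exact Integrable.of_bound (C := B) (by fun_prop) (Eventually.of_forall fun z => h.bound _)

/-- Linear isometries preserve the standard Gaussian; this transfers the reflection symmetries of
`f` to its heat evolution. -/
theorem gaussAvg_isometry (f : E → ℝ) (s : ℝ) (e : E ≃ₗᵢ[ℝ] E) (v x : E) :
    gaussAvg s f (e x + v) = gaussAvg s (fun y => f (e y + v)) x := by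
  have h := (e.toHomeomorph.measurableEmbedding).integral_map (μ := stdGaussian E)
    (fun z => f (e x + v + s • z))
  rw [show (stdGaussian E).map e.toHomeomorph = stdGaussian E from stdGaussian_map e] at h
  rw [gaussAvg, gaussAvg, h]
  congr 1
  ext z
  simp only [LinearIsometryEquiv.coe_toHomeomorph, map_add, map_smul]
  congr 1
  abel

/-- `h'` is a continuous and bounded gradient of `h`. -/
structure HasBddGrad (h : E → ℝ) (h' : E → E) (B : ℝ) : Prop where
  deriv : ∀ x, HasFDerivAt h (innerSL ℝ (h' x)) x
  cont : Continuous h'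
  bound : ∀ x, ‖h' x‖ ≤ B

theorem HasBddGrad.inner_bddCont {h : E → ℝ} {h' : E → E} {B : ℝ} (H : HasBddGrad h h' B) (v : E) :
    BddCont (fun y => inner ℝ (h' y) v) (B * ‖v‖) := by
  have := H.cont
  exact ⟨by fun_prop, fun y => (abs_real_inner_le_norm _ _).trans
    (mul_le_mul_of_nonneg_right (H.bound y) (norm_nonneg _))⟩

theorem HasBddGrad.integrable_avg {h : E → ℝ} {h' : E → E} {B : ℝ} (H : HasBddGrad h h' B)
    (s : ℝ) (x : E) : Integrable (fun z => h' (x + s • z)) (stdGaussian E) := by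
  have := H.cont
  exact Integrable.of_bound (C := B) (by fun_prop) (Eventually.of_forall fun z => H.bound _)

theorem HasBddGrad.hasFDerivAt_gaussAvg {h : E → ℝ} {h' : E → E} {A B : ℝ} (hA : BddCont h A)
    (H : HasBddGrad h h' B) (s : ℝ) (x : E) :
    HasFDerivAt (gaussAvg s h) (innerSL ℝ (∫ z, h' (x + s • z) ∂(stdGaussian E))) x := by
  have hc := hA.cont
  have hc' := H.cont
  rw [← ContinuousLinearMap.integral_comp_comm _ (H.integrable_avg s x)]
  refine hasFDerivAt_integral_of_dominated_of_fderiv_le (μ := stdGaussian E)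
      (F := fun x z => h (x + s • z))
      (F' := fun x z => innerSL ℝ (h' (x + s • z)))
      (bound := fun y => B) univ_mem ?_ ?_ ?_ ?_ ?_ ?_
  · exact Eventually.of_forall fun x' => by fun_prop
  · exact hA.integrable_avg s x
  · fun_prop
  · refine Eventually.of_forall fun y x' _ => ?_
    rw [innerSL_apply_norm]
    exact H.bound _
  · exact integrable_const _
  · refine Eventually.of_forall fun y x' _ => ?_
    exact (H.deriv (x' + s • y)).comp x' ((hasFDerivAt_id x').add_const _)

/-- The derivative of the average is computed twice, once on the kernel and once on `h`, and the two
results must agree. -/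
theorem HasBddGrad.inner_gaussGrad {h : E → ℝ} {h' : E → E} {A B : ℝ} (hA : BddCont h A)
    (H : HasBddGrad h h' B) {s : ℝ} (hs : 0 < s) (x v : E) :
    inner ℝ (gaussGrad s h x) v = gaussAvg s (fun y => inner ℝ (h' y) v) x := by
  have h1 := (H.hasFDerivAt_gaussAvg hA s x).unique (_root_.hasFDerivAt_gaussAvg hA hs x)
  have h2 := congrArg (fun L => L v) h1
  simp only [innerSL_apply_apply] at h2
  rw [← h2, gaussAvg, real_inner_comm, ← integral_inner (H.integrable_avg s x)]
  simp_rw [real_inner_comm]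

theorem HasBddGrad.hasDerivAt_gaussAvg {h : E → ℝ} {h' : E → E} {A B : ℝ} (hA : BddCont h A)
    (H : HasBddGrad h h' B) (s : ℝ) (x : E) :
    HasDerivAt (fun s => gaussAvg s h x) (∫ z, inner ℝ (h' (x + s • z)) z ∂(stdGaussian E)) s := by
  have hc := hA.cont
  have hc' := H.cont
  refine (hasDerivAt_integral_of_dominated_loc_of_deriv_le (μ := stdGaussian E)
      (F := fun s z => h (x + s • z))
      (F' := fun s z => inner ℝ (h' (x + s • z)) z)
      (bound := fun z => B * ‖z‖) univ_mem ?_ ?_ ?_ ?_ ?_ ?_).2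
  · exact Eventually.of_forall fun x' => by fun_prop
  · exact hA.integrable_avg s x
  · fun_prop
  · refine Eventually.of_forall fun y x' _ => ?_
    exact (norm_inner_le_norm _ _).trans
      (mul_le_mul_of_nonneg_right (H.bound _) (norm_nonneg _))
  · exact integrable_norm_stdGaussian.const_mul B
  · refine Eventually.of_forall fun z s' _ => ?_
    have h1 : HasDerivAt (fun s : ℝ => x + s • z) z s' := by
      simpa using ((hasDerivAt_id s').smul_const z).const_add x
    have := (H.deriv (x + s' • z)).comp_hasDerivAt s' h1
    exact this

/-- The sum of the first two absolute moments of the standard Gaussian. -/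
noncomputable def gaussMoment (E : Type*) [NormedAddCommGroup E] [InnerProductSpace ℝ E]
    [FiniteDimensional ℝ E] [MeasurableSpace E] [BorelSpace E] : ℝ :=
  ∫ z : E, ‖z‖ + ‖z‖ ^ 2 ∂(stdGaussian E)

theorem gaussMoment_nonneg : 0 ≤ gaussMoment E :=
  integral_nonneg fun z => by positivity

theorem norm_gaussGrad_le {f : E → ℝ} {B s : ℝ} (h : BddCont f B) (hs : 0 < s) (x : E) :
    ‖gaussGrad s f x‖ ≤ gaussMoment E / s * B := by
  have hc := h.cont
  rw [gaussGrad, norm_smul, norm_inv, Real.norm_of_nonneg hs.le, div_eq_inv_mul, mul_assoc]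
  refine mul_le_mul_of_nonneg_left ?_ (by positivity)
  rw [gaussMoment, ← integral_mul_const]
  refine norm_integral_le_of_norm_le
    ((integrable_norm_stdGaussian.add integrable_sq_norm_stdGaussian).mul_const B)
    (Eventually.of_forall fun z => ?_)
  rw [norm_smul, mul_comm]
  have h1 : ‖f (x + s • z)‖ ≤ B := h.bound _
  have h2 := h.nonneg
  gcongr
  nlinarith [sq_nonneg ‖z‖]

/-- The Gaussian is centred, so `f x` may be subtracted from `f (x + s z)` inside the integral, and
the Hölder bound gains a factor `s^α`. The estimate `‖z‖^α ‖z‖ ≤ ‖z‖ + ‖z‖²` is the reason why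
`gaussMoment` contains two moments. -/
theorem norm_gaussGrad_le_of_holder {f : E → ℝ} {B s H α : ℝ} (h : BddCont f B) (hs : 0 < s)
    (hα0 : 0 < α) (hα1 : α ≤ 1) (hH : 0 ≤ H) (hf : ∀ x y, |f x - f y| ≤ H * ‖x - y‖ ^ α) (x : E) :
    ‖gaussGrad s f x‖ ≤ gaussMoment E * H * s ^ (α - 1) := by
  have hc := h.cont
  have h0 : ∫ z, f (x + s • z) • z ∂(stdGaussian E) =
      ∫ z, (f (x + s • z) - f x) • z ∂(stdGaussian E) := by
    simp_rw [sub_smul]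
    have hi : Integrable (fun z : E => f x • z) (stdGaussian E) :=
      IsGaussian.integrable_id.smul (f x)
    rw [integral_sub (h.integrable_smul s x) hi, integral_smul]
    have : ∫ z : E, z ∂(stdGaussian E) = 0 := integral_id_stdGaussian
    rw [this]
    simp
  rw [gaussGrad, norm_smul, norm_inv, Real.norm_of_nonneg hs.le, h0, Real.rpow_sub_one hs.ne']
  have h3 : ‖∫ z, (f (x + s • z) - f x) • z ∂(stdGaussian E)‖ ≤ gaussMoment E * (H * s ^ α) := by
    rw [gaussMoment, ← integral_mul_const]
    refine norm_integral_le_of_norm_le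
      ((integrable_norm_stdGaussian.add integrable_sq_norm_stdGaussian).mul_const _)
      (Eventually.of_forall fun z => ?_)
    rw [norm_smul]
    have h1 := hf (x + s • z) x
    rw [add_sub_cancel_left, norm_smul, Real.norm_of_nonneg hs.le,
      Real.mul_rpow hs.le (norm_nonneg _)] at h1
    have h4 : ‖z‖ ^ α ≤ 1 + ‖z‖ := by
      rcases le_total ‖z‖ 1 with hz | hz
      · have := Real.rpow_le_one (norm_nonneg z) hz hα0.le
        linarith [norm_nonneg z]
      · have := Real.rpow_le_rpow_of_exponent_le hz hα1
        rw [Real.rpow_one] at this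
        linarith
    have h5 : 0 ≤ H * s ^ α := by positivity
    calc ‖f (x + s • z) - f x‖ * ‖z‖ ≤ (H * (s ^ α * ‖z‖ ^ α)) * ‖z‖ := by
          gcongr
          exact h1
      _ ≤ (H * (s ^ α * (1 + ‖z‖))) * ‖z‖ := by gcongr
      _ = _ := by ring
  calc s⁻¹ * ‖∫ z, (f (x + s • z) - f x) • z ∂(stdGaussian E)‖
      ≤ s⁻¹ * (gaussMoment E * (H * s ^ α)) := by gcongr
    _ = _ := by field_simp

theorem hasBddGrad_gaussAvg {f : E → ℝ} {B s : ℝ} (h : BddCont f B) (hs : 0 < s) :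
    HasBddGrad (gaussAvg s f) (gaussGrad s f) (gaussMoment E / s * B) := by
  refine ⟨hasFDerivAt_gaussAvg h hs, ?_, norm_gaussGrad_le h hs⟩
  have := (continuousOn_gaussGrad_uncurry h).comp_continuous (f := fun x : E => (s, x))
    (by fun_prop) (fun x => ⟨hs, mem_univ _⟩)
  exact this

theorem inner_gaussGrad_eq_gaussAvg {f : E → ℝ} {B s r q : ℝ} (h : BddCont f B) (hs : 0 < s)
    (hr : 0 < r) (hq0 : 0 < q) (hq : q ^ 2 = s ^ 2 + r ^ 2) (x v : E) :
    inner ℝ (gaussGrad q f x) v = gaussAvg s (fun y => inner ℝ (gaussGrad r f y) v) x := by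
  have h1 := (hasBddGrad_gaussAvg h hr).inner_gaussGrad (gaussAvg_bddCont h r) hs x v
  rw [← h1]
  have h2 := hasFDerivAt_gaussAvg (gaussAvg_bddCont h r) hs x
  rw [gaussAvg_gaussAvg h hq] at h2
  have h3 := congrArg (fun L => L v) (h2.unique (hasFDerivAt_gaussAvg h hq0 x))
  simp only [innerSL_apply_apply] at h3
  exact h3.symm

theorem norm_gaussAvg_sub_le {f : E → ℝ} {B s : ℝ} (h : BddCont f B) (hs : 0 < s) (x y : E) :
    |gaussAvg s f x - gaussAvg s f y| ≤ gaussMoment E / s * B * ‖x - y‖ := by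
  have := Convex.norm_image_sub_le_of_norm_hasFDerivWithin_le (f := gaussAvg s f) (s := univ)
    (fun z _ => (hasFDerivAt_gaussAvg h hs z).hasFDerivWithinAt)
    (fun z _ => by rw [innerSL_apply_norm]; exact norm_gaussGrad_le h hs z)
    convex_univ (mem_univ y) (mem_univ x)
  exact this

/-- A second-order bound from first-order ones: when variances are split as `q² = s² + r²`, each
component of the gradient at scale `q` is the average at scale `s` of the component at scale `r`,
and averaging at scale `s` is Lipschitz. -/
theorem norm_gaussGrad_sub_le {f : E → ℝ} {B s r q G : ℝ} (h : BddCont f B) (hs : 0 < s)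
    (hr : 0 < r) (hq0 : 0 < q) (hq : q ^ 2 = s ^ 2 + r ^ 2)
    (hG : ∀ x, ‖gaussGrad r f x‖ ≤ G) (x y : E) :
    ‖gaussGrad q f x - gaussGrad q f y‖ ≤ gaussMoment E / s * G * ‖x - y‖ := by
  have hG0 : 0 ≤ G := (norm_nonneg _).trans (hG 0)
  have hM := gaussMoment_nonneg (E := E)
  rw [← innerSL_apply_norm (𝕜 := ℝ)]
  refine ContinuousLinearMap.opNorm_le_bound _ (by positivity) fun v => ?_
  rw [innerSL_apply_apply, inner_sub_left, inner_gaussGrad_eq_gaussAvg h hs hr hq0 hq,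
    inner_gaussGrad_eq_gaussAvg h hs hr hq0 hq]
  have h1 : HasBddGrad (gaussAvg r f) (gaussGrad r f) G :=
    ⟨(hasBddGrad_gaussAvg h hr).deriv, (hasBddGrad_gaussAvg h hr).cont, hG⟩
  refine (norm_gaussAvg_sub_le (h1.inner_bddCont v) hs x y).trans (le_of_eq ?_)
  ring

/-- Induction on the order: a directional derivative at scale `s` is the average, at scale `s/√2`,
of another bounded continuous function. -/
theorem contDiff_gaussAvg {f : E → ℝ} {B s : ℝ} (h : BddCont f B) (hs : 0 < s) :
    ContDiff ℝ ∞ (gaussAvg s f) := by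
  rw [contDiff_infty]
  intro n
  induction n generalizing f B s with
  | zero => exact contDiff_zero.2 (gaussAvg_bddCont h s).cont
  | succ n ih =>
    push_cast
    rw [contDiff_succ_iff_fderiv_apply]
    refine ⟨fun x => (hasFDerivAt_gaussAvg h hs x).differentiableAt, by simp, fun v => ?_⟩
    have hr : 0 < s / √2 := by positivity
    have hq : s ^ 2 = (s / √2) ^ 2 + (s / √2) ^ 2 := by
      rw [div_pow, Real.sq_sqrt (by norm_num)]; ring
    have : (fun x => fderiv ℝ (gaussAvg s f) x v) =
        gaussAvg (s / √2) (fun y => inner ℝ (gaussGrad (s / √2) f y) v) := by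
      ext x
      rw [(hasFDerivAt_gaussAvg h hs x).fderiv, innerSL_apply_apply]
      exact inner_gaussGrad_eq_gaussAvg h hr hr hs hq x v
    rw [this]
    exact ih ((hasBddGrad_gaussAvg h hr).inner_bddCont v) hr

/-- Gaussian integration by parts. The left side is the derivative of the average in `s`; the right
side is `s` times its Laplacian. -/
theorem integral_inner_eq_sum_gaussGrad {ι : Type*} [Fintype ι] (b : OrthonormalBasis ι ℝ E)
    {h : E → ℝ} {h' : E → E} {B : ℝ} (H : HasBddGrad h h' B) {s : ℝ} (hs : 0 < s) (x : E) :
    ∫ z, inner ℝ (h' (x + s • z)) z ∂(stdGaussian E) =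
      s * ∑ i, inner ℝ (gaussGrad s (fun y => inner ℝ (h' y) (b i)) x) (b i) := by
  have h1 : ∀ z, inner ℝ (h' (x + s • z)) z =
      ∑ i, inner ℝ (b i) (inner ℝ (h' (x + s • z)) (b i) • z) := by
    intro z
    rw [← b.sum_inner_mul_inner]
    simp_rw [inner_smul_right]
  simp_rw [h1]
  have hi : ∀ i, Integrable (fun z => inner ℝ (h' (x + s • z)) (b i) • z) (stdGaussian E) :=
    fun i => (H.inner_bddCont (b i)).integrable_smul s x
  rw [integral_finsetSum _ (fun i _ => (hi i).const_inner _), Finset.mul_sum]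
  refine Finset.sum_congr rfl fun i _ => ?_
  rw [integral_inner (hi i), gaussGrad, real_inner_smul_left, ← mul_assoc, mul_inv_cancel₀ hs.ne',
    one_mul, real_inner_comm]

end Semigroup

/-! ### The heat semigroup on the whole space -/

section Heat

variable {E : Type*} [NormedAddCommGroup E] [InnerProductSpace ℝ E] [FiniteDimensional ℝ E]
  [MeasurableSpace E] [BorelSpace E]

/-- The heat semigroup on the whole space. -/
noncomputable def heat (t : ℝ) (f : E → ℝ) : E → ℝ := gaussAvg (√(2 * t)) f

/-- The gradient of `heat t f`. -/
noncomputable def heatGrad (t : ℝ) (f : E → ℝ) : E → E := gaussGrad (√(2 * t)) f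

/-- The Laplacian of `heat t f`, computed in the orthonormal basis `b`. -/
noncomputable def heatLap {ι : Type*} [Fintype ι] (b : OrthonormalBasis ι ℝ E) (t : ℝ) (f : E → ℝ)
    (x : E) : ℝ :=
  ∑ i, fderiv ℝ (fun y => inner ℝ (heatGrad t f y) (b i)) x (b i)

theorem sqrt_two_mul_pos {t : ℝ} (ht : 0 < t) : 0 < √(2 * t) := by positivity

theorem sqrt_two_mul_add {s r : ℝ} (hs : 0 ≤ s) (hr : 0 ≤ r) :
    √(2 * (s + r)) ^ 2 = √(2 * s) ^ 2 + √(2 * r) ^ 2 := by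
  rw [Real.sq_sqrt (by positivity), Real.sq_sqrt (by positivity), Real.sq_sqrt (by positivity)]
  ring

theorem heat_of_nonpos {t : ℝ} (ht : t ≤ 0) (f : E → ℝ) : heat t f = f := by
  rw [heat, Real.sqrt_eq_zero_of_nonpos (by linarith), gaussAvg_zero]

variable {f : E → ℝ} {B : ℝ}

theorem heat_bddCont (h : BddCont f B) (t : ℝ) : BddCont (heat t f) B := gaussAvg_bddCont h _

theorem continuous_heat_uncurry (h : BddCont f B) :
    Continuous (fun p : ℝ × E => heat p.1 f p.2) :=
  (continuous_gaussAvg_uncurry h).comp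
    (f := fun p : ℝ × E => (√(2 * p.1), p.2)) (by fun_prop)

theorem continuousOn_heatGrad_uncurry (h : BddCont f B) :
    ContinuousOn (fun p : ℝ × E => heatGrad p.1 f p.2) (Ioi 0 ×ˢ univ) :=
  (continuousOn_gaussGrad_uncurry h).comp
    (f := fun p : ℝ × E => (√(2 * p.1), p.2)) (by fun_prop)
    (fun p hp => ⟨sqrt_two_mul_pos hp.1, mem_univ _⟩)

theorem hasFDerivAt_heat (h : BddCont f B) {t : ℝ} (ht : 0 < t) (x : E) :
    HasFDerivAt (heat t f) (innerSL ℝ (heatGrad t f x)) x :=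
  hasFDerivAt_gaussAvg h (sqrt_two_mul_pos ht) x

theorem heat_heat (h : BddCont f B) {s r : ℝ} (hs : 0 ≤ s) (hr : 0 ≤ r) :
    heat s (heat r f) = heat (s + r) f :=
  gaussAvg_gaussAvg h (sqrt_two_mul_add hs hr)

theorem hasBddGrad_heat (h : BddCont f B) {t : ℝ} (ht : 0 < t) :
    HasBddGrad (heat t f) (heatGrad t f) (gaussMoment E / √(2 * t) * B) :=
  hasBddGrad_gaussAvg h (sqrt_two_mul_pos ht)

theorem inner_heatGrad_bddCont (h : BddCont f B) {t : ℝ} (ht : 0 < t) (v : E) :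
    BddCont (fun y => inner ℝ (heatGrad t f y) v) (gaussMoment E / √(2 * t) * B * ‖v‖) :=
  (hasBddGrad_heat h ht).inner_bddCont v

theorem inner_heatGrad_add (h : BddCont f B) {s r : ℝ} (hs : 0 < s) (hr : 0 < r) (x v : E) :
    inner ℝ (heatGrad (s + r) f x) v = heat s (fun y => inner ℝ (heatGrad r f y) v) x :=
  inner_gaussGrad_eq_gaussAvg h (sqrt_two_mul_pos hs) (sqrt_two_mul_pos hr)
    (sqrt_two_mul_pos (by positivity)) (sqrt_two_mul_add hs.le hr.le) x v

theorem contDiff_heat (h : BddCont f B) {t : ℝ} (ht : 0 < t) : ContDiff ℝ ∞ (heat t f) :=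
  contDiff_gaussAvg h (sqrt_two_mul_pos ht)

theorem contDiff_inner_heatGrad (h : BddCont f B) {t : ℝ} (ht : 0 < t) (v : E) :
    ContDiff ℝ ∞ (fun y => inner ℝ (heatGrad t f y) v) := by
  have h1 : (fun y => inner ℝ (heatGrad t f y) v) =
      heat (t / 2) (fun y => inner ℝ (heatGrad (t / 2) f y) v) := by
    ext y
    rw [← inner_heatGrad_add h (by positivity) (by positivity), add_halves]
  rw [h1]
  exact contDiff_heat (inner_heatGrad_bddCont h (by positivity) v) (by positivity)

theorem contDiff_heatGrad (h : BddCont f B) {t : ℝ} (ht : 0 < t) :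
    ContDiff ℝ ∞ (heatGrad t f) := by
  have h1 : heatGrad t f = fun y =>
      ∑ i, inner ℝ (heatGrad t f y) (stdOrthonormalBasis ℝ E i) • stdOrthonormalBasis ℝ E i := by
    ext y
    refine ((stdOrthonormalBasis ℝ E).sum_repr' _).symm.trans ?_
    exact Finset.sum_congr rfl fun i _ => by rw [real_inner_comm]
  rw [h1]
  exact ContDiff.sum fun i _ => (contDiff_inner_heatGrad h ht _).smul contDiff_const

section Laplacian

variable {ι : Type*} [Fintype ι] (b : OrthonormalBasis ι ℝ E)

theorem fderiv_inner_heatGrad (h : BddCont f B) {s r : ℝ} (hs : 0 < s) (hr : 0 < r) (x v w : E) :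
    fderiv ℝ (fun y => inner ℝ (heatGrad (s + r) f y) v) x w =
      inner ℝ (heatGrad s (fun y => inner ℝ (heatGrad r f y) v) x) w := by
  have h1 : (fun y => inner ℝ (heatGrad (s + r) f y) v) =
      heat s (fun y => inner ℝ (heatGrad r f y) v) := by
    ext y
    exact inner_heatGrad_add h hs hr y v
  rw [h1, (hasFDerivAt_heat (inner_heatGrad_bddCont h hr v) hs x).fderiv, innerSL_apply_apply]

theorem heatLap_add (h : BddCont f B) {s r : ℝ} (hs : 0 < s) (hr : 0 < r) (x : E) :
    heatLap b (s + r) f x =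
      ∑ i, inner ℝ (heatGrad s (fun y => inner ℝ (heatGrad r f y) (b i)) x) (b i) :=
  Finset.sum_congr rfl fun i _ => fderiv_inner_heatGrad h hs hr x (b i) (b i)

/-- The evolution is restarted at time `t/2`, where the function already has a bounded gradient. The
derivative of `√(2 (t' - t/2))` is the inverse of the same square root and cancels the factor `s` of
`integral_inner_eq_sum_gaussGrad`. -/
theorem hasDerivAt_heat (h : BddCont f B) {t : ℝ} (ht : 0 < t) (x : E) :
    HasDerivAt (fun t => heat t f x) (heatLap b t f x) t := by
  have ht2 : 0 < t / 2 := by positivity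
  have hg := hasBddGrad_heat h ht2
  have h1 := hg.hasDerivAt_gaussAvg (heat_bddCont h _) (√(2 * (t - t / 2))) x
  rw [integral_inner_eq_sum_gaussGrad b hg (sqrt_two_mul_pos (by linarith))] at h1
  have h2 : HasDerivAt (fun t' : ℝ => √(2 * (t' - t / 2))) (1 / √(2 * (t - t / 2))) t := by
    have h3 : HasDerivAt (fun t' : ℝ => 2 * (t' - t / 2)) 2 t := by
      simpa using ((hasDerivAt_id t).sub_const (t / 2)).const_mul (2 : ℝ)
    refine (h3.sqrt (by linarith)).congr_deriv ?_
    field_simp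
  have h4 := h1.comp t h2
  have h5 : (fun t => heat t f x) =ᶠ[𝓝 t]
      (fun s => gaussAvg s (heat (t / 2) f) x) ∘ fun t' => √(2 * (t' - t / 2)) := by
    filter_upwards [lt_mem_nhds (show t / 2 < t by linarith)] with t' ht'
    have := heat_heat h (show 0 ≤ t' - t / 2 by linarith) ht2.le
    rw [sub_add_cancel] at this
    rw [← this]
    rfl
  refine (h4.congr_of_eventuallyEq h5).congr_deriv ?_
  have h6 : heatLap b t f x = heatLap b (t - t / 2 + t / 2) f x := by rw [sub_add_cancel]
  have h7 : √(2 * (t - t / 2)) ≠ 0 := (sqrt_two_mul_pos (by linarith)).ne'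
  rw [h6, heatLap_add b h (by linarith) ht2, mul_one_div, mul_div_cancel_left₀ _ h7]
  rfl

theorem continuousOn_heatLap_uncurry (h : BddCont f B) :
    ContinuousOn (fun p : ℝ × E => heatLap b p.1 f p.2) (Ioi 0 ×ˢ univ) := by
  intro p hp
  have hp0 : (0 : ℝ) < p.1 := hp.1
  refine ContinuousAt.continuousWithinAt ?_
  set r := p.1 / 2 with hr
  have hr0 : 0 < r := by positivity
  have h5 : (fun p : ℝ × E => heatLap b p.1 f p.2) =ᶠ[𝓝 p] fun p =>
      ∑ i, inner ℝ (heatGrad (p.1 - r) (fun y => inner ℝ (heatGrad r f y) (b i)) p.2) (b i) := by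
    filter_upwards [continuous_fst.continuousAt.eventually
      (lt_mem_nhds (show r < p.1 by rw [hr]; linarith))] with p' hp'
    have := heatLap_add b h (show 0 < p'.1 - r by linarith) hr0 p'.2
    rw [sub_add_cancel] at this
    exact this
  refine ContinuousAt.congr ?_ h5.symm
  refine tendsto_finsetSum _ fun i _ => ?_
  refine Filter.Tendsto.inner ?_ tendsto_const_nhds
  have h1 := (continuousOn_heatGrad_uncurry (inner_heatGrad_bddCont h hr0 (b i))).continuousAt
    (x := (p.1 - r, p.2)) ((isOpen_Ioi.prod isOpen_univ).mem_nhds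
      ⟨show (0 : ℝ) < p.1 - r by rw [hr]; linarith, mem_univ _⟩)
  have h2 : ContinuousAt (fun p : ℝ × E => (p.1 - r, p.2)) p := by fun_prop
  exact ContinuousAt.comp (f := fun p : ℝ × E => (p.1 - r, p.2))
    (g := fun p : ℝ × E => heatGrad p.1 (fun y => inner ℝ (heatGrad r f y) (b i)) p.2) h1 h2

/-- The time is split as `(t - t₀/2) + t₀/2`, both parts being at least `t₀/2`, with one gradient
bound for each. Uniformity over `t ≥ t₀` serves differentiation under integrals in time. -/
theorem abs_heatLap_le (h : BddCont f B) {t₀ t : ℝ} (ht₀ : 0 < t₀) (ht : t₀ ≤ t) (x : E) :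
    |heatLap b t f x| ≤ Fintype.card ι * (gaussMoment E / √t₀ * (gaussMoment E / √t₀ * B)) := by
  have hM := gaussMoment_nonneg (E := E)
  have hB := h.nonneg
  have h1 := heatLap_add b h (show 0 < t - t₀ / 2 by linarith) (show 0 < t₀ / 2 by linarith) x
  rw [sub_add_cancel] at h1
  rw [h1]
  refine (Finset.abs_sum_le_sum_abs _ _).trans ?_
  rw [← nsmul_eq_mul]
  refine Finset.sum_le_card_nsmul _ _ _ fun i _ => ?_
  refine (abs_real_inner_le_norm _ _).trans ?_
  rw [b.norm_eq_one, mul_one]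
  refine (norm_gaussGrad_le (inner_heatGrad_bddCont h (show 0 < t₀ / 2 by linarith) (b i))
    (sqrt_two_mul_pos (by linarith)) x).trans ?_
  rw [b.norm_eq_one, mul_one, mul_div_cancel₀ t₀ two_ne_zero]
  gcongr
  linarith

end Laplacian

theorem heat_isometry (f : E → ℝ) (t : ℝ) (e : E ≃ₗᵢ[ℝ] E) (v x : E) :
    heat t f (e x + v) = heat t (fun y => f (e y + v)) x :=
  gaussAvg_isometry f _ e v x

theorem norm_heatGrad_le (h : BddCont f B) {t : ℝ} (ht : 0 < t) (x : E) :
    ‖heatGrad t f x‖ ≤ gaussMoment E * B * t ^ (-(1 / 2) : ℝ) := by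
  have hM := gaussMoment_nonneg (E := E)
  have hB := h.nonneg
  refine (norm_gaussGrad_le h (sqrt_two_mul_pos ht) x).trans ?_
  have h1 : t ^ (-(1 / 2) : ℝ) = (√t)⁻¹ := by
    rw [Real.rpow_neg ht.le, Real.sqrt_eq_rpow]
  rw [h1, div_eq_mul_inv, mul_right_comm]
  gcongr
  linarith

theorem norm_heatGrad_le_of_holder {H α : ℝ} (h : BddCont f B) {t : ℝ} (ht : 0 < t)
    (hα0 : 0 < α) (hα1 : α ≤ 1) (hH : 0 ≤ H) (hf : ∀ x y, |f x - f y| ≤ H * ‖x - y‖ ^ α) (x : E) :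
    ‖heatGrad t f x‖ ≤ gaussMoment E * H * t ^ ((α - 1) / 2) := by
  have hM := gaussMoment_nonneg (E := E)
  refine (norm_gaussGrad_le_of_holder h (sqrt_two_mul_pos ht) hα0 hα1 hH hf x).trans ?_
  rw [Real.sqrt_eq_rpow, ← Real.rpow_mul (by positivity), one_div_mul_eq_div]
  have := Real.rpow_le_rpow_of_nonpos ht (show t ≤ 2 * t by linarith)
    (show (α - 1) / 2 ≤ 0 by linarith)
  gcongr

theorem norm_heatGrad_sub_le (h : BddCont f B) {t G : ℝ} (ht : 0 < t)
    (hG : ∀ x, ‖heatGrad (t / 2) f x‖ ≤ G) (x y : E) :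
    ‖heatGrad t f x - heatGrad t f y‖ ≤ gaussMoment E * G * t ^ (-(1 / 2) : ℝ) * ‖x - y‖ := by
  have hq := sqrt_two_mul_add (show 0 ≤ t / 2 by positivity) (show 0 ≤ t / 2 by positivity)
  rw [add_halves] at hq
  refine (norm_gaussGrad_sub_le h (sqrt_two_mul_pos (show 0 < t / 2 by positivity))
    (sqrt_two_mul_pos (show 0 < t / 2 by positivity)) (sqrt_two_mul_pos ht) hq hG x y).trans
    (le_of_eq ?_)
  have h1 : t ^ (-(1 / 2) : ℝ) = (√t)⁻¹ := by
    rw [Real.rpow_neg ht.le, Real.sqrt_eq_rpow]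
  rw [h1, mul_div_cancel₀ t two_ne_zero]
  ring

theorem abs_heat_sub_le (h : BddCont f B) {t : ℝ} (ht : 0 < t) (x y : E) :
    |heat t f x - heat t f y| ≤ gaussMoment E * B * t ^ (-(1 / 2) : ℝ) * ‖x - y‖ := by
  have := Convex.norm_image_sub_le_of_norm_hasFDerivWithin_le (f := heat t f) (s := univ)
    (fun z _ => (hasFDerivAt_heat h ht z).hasFDerivWithinAt)
    (fun z _ => by rw [innerSL_apply_norm]; exact norm_heatGrad_le h ht z)
    convex_univ (mem_univ y) (mem_univ x)
  exact this

end Heat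

/-! ### Measure and diameter of the unit cube -/

section Cube

variable {d : ℕ}

theorem unitCube_eq_preimage (d : ℕ) :
    unitCube d = (MeasurableEquiv.toLp 2 (Fin d → ℝ)).symm ⁻¹'
      (Set.pi univ fun _ => Ioo (0 : ℝ) 1) := by
  ext x
  simp [unitCube]

theorem isOpen_unitCube (d : ℕ) : IsOpen (unitCube d) := by
  have : unitCube d = ⋂ i, {x | 0 < x i ∧ x i < 1} := by
    ext x; simp [unitCube]
  rw [this]
  refine isOpen_iInter_of_finite fun i => ?_
  have h0 : IsOpen {x : EuclideanSpace ℝ (Fin d) | 0 < x i} := isOpen_lt (by fun_prop) (by fun_prop)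
  have h1 : IsOpen {x : EuclideanSpace ℝ (Fin d) | x i < 1} := isOpen_lt (by fun_prop) (by fun_prop)
  exact h0.inter h1

theorem measurableSet_unitCube (d : ℕ) : MeasurableSet (unitCube d) :=
  (isOpen_unitCube d).measurableSet

theorem volume_unitCube (d : ℕ) : volume (unitCube d) = 1 := by
  rw [unitCube_eq_preimage, (EuclideanSpace.volume_preserving_symm_measurableEquiv_toLp
    (Fin d)).measure_preimage, volume_pi_pi]
  · simp
  · exact (MeasurableSet.univ_pi fun _ => measurableSet_Ioo).nullMeasurableSet

instance isProbabilityMeasure_restrict_unitCube :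
    IsProbabilityMeasure (volume.restrict (unitCube d)) :=
  ⟨by rw [Measure.restrict_apply_univ, volume_unitCube]⟩

theorem norm_sub_le_of_mem_Icc {x y : EuclideanSpace ℝ (Fin d)} (hx : ∀ i, x i ∈ Icc (0 : ℝ) 1)
    (hy : ∀ i, y i ∈ Icc (0 : ℝ) 1) : ‖x - y‖ ≤ √d := by
  rw [EuclideanSpace.norm_eq]
  refine Real.sqrt_le_sqrt ?_
  calc ∑ i, ‖(x - y) i‖ ^ 2 ≤ ∑ _i : Fin d, (1 : ℝ) := by
        refine Finset.sum_le_sum fun i _ => ?_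
        rw [PiLp.sub_apply, Real.norm_eq_abs, sq_abs]
        have h1 := hx i
        have h2 := hy i
        nlinarith [h1.1, h1.2, h2.1, h2.2]
    _ = d := by simp

theorem unitCube_mem_Icc {x : EuclideanSpace ℝ (Fin d)} (hx : x ∈ unitCube d) (i : Fin d) :
    x i ∈ Icc (0 : ℝ) 1 := ⟨(hx i).1.le, (hx i).2.le⟩

end Cube

/-! ### Cutoff functions on the cube -/

section Cutoff

theorem exists_deriv_smoothTransition_bound :
    ∃ C : ℝ, 0 ≤ C ∧ ∀ y, |deriv Real.smoothTransition y| ≤ C ∧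
      (1 < y → deriv Real.smoothTransition y = 0) := by
  have hc : Continuous (deriv Real.smoothTransition) :=
    (Real.smoothTransition.contDiff (n := 1)).continuous_deriv (by simp)
  obtain ⟨C, hC⟩ := (isCompact_Icc (a := (0 : ℝ)) (b := 1)).exists_bound_of_continuousOn
    hc.continuousOn
  have h1 : ∀ y, 1 < y → deriv Real.smoothTransition y = 0 := by
    intro y hy
    have : Real.smoothTransition =ᶠ[𝓝 y] fun _ => 1 := by
      filter_upwards [lt_mem_nhds hy] with z hz
      exact Real.smoothTransition.one_of_one_le hz.le
    rw [this.deriv_eq, deriv_const]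
  have h0 : ∀ y, y < 0 → deriv Real.smoothTransition y = 0 := by
    intro y hy
    have : Real.smoothTransition =ᶠ[𝓝 y] fun _ => 0 := by
      filter_upwards [gt_mem_nhds hy] with z hz
      exact Real.smoothTransition.zero_of_nonpos hz.le
    rw [this.deriv_eq, deriv_const]
  have hC0 : 0 ≤ C := (norm_nonneg _).trans (hC 0 (by simp))
  refine ⟨C, hC0, fun y => ⟨?_, h1 y⟩⟩
  rcases lt_or_ge y 0 with hy | hy
  · rw [h0 y hy]; simpa
  rcases lt_or_ge 1 y with hy1 | hy1
  · rw [h1 y hy1]; simpa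
  · exact hC y ⟨hy, hy1⟩

/-- A smooth cutoff on `(0,1)`, equal to one at distance `2/n` from the endpoints. -/
noncomputable def unitCutoff (n : ℕ) (r : ℝ) : ℝ :=
  Real.smoothTransition (n * r - 1) * Real.smoothTransition (n * (1 - r) - 1)

theorem contDiff_unitCutoff (n : ℕ) : ContDiff ℝ ∞ (unitCutoff n) := by
  unfold unitCutoff
  exact (Real.smoothTransition.contDiff.comp (by fun_prop)).mul
    (Real.smoothTransition.contDiff.comp (by fun_prop))

theorem unitCutoff_nonneg (n : ℕ) (r : ℝ) : 0 ≤ unitCutoff n r :=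
  mul_nonneg (Real.smoothTransition.nonneg _) (Real.smoothTransition.nonneg _)

theorem unitCutoff_le_one (n : ℕ) (r : ℝ) : unitCutoff n r ≤ 1 :=
  mul_le_one₀ (Real.smoothTransition.le_one _) (Real.smoothTransition.nonneg _)
    (Real.smoothTransition.le_one _)

theorem mem_of_unitCutoff_ne_zero {n : ℕ} {r : ℝ} (h : unitCutoff n r ≠ 0) :
    1 ≤ n * r ∧ 1 ≤ n * (1 - r) := by
  rw [unitCutoff, mul_ne_zero_iff] at h
  constructor
  · by_contra hr
    exact h.1 (Real.smoothTransition.zero_of_nonpos (by linarith))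
  · by_contra hr
    exact h.2 (Real.smoothTransition.zero_of_nonpos (by linarith))

theorem eventually_unitCutoff_eq_one {r : ℝ} (h0 : 0 < r) (h1 : r < 1) :
    ∀ᶠ n : ℕ in atTop, unitCutoff n =ᶠ[𝓝 r] fun _ => 1 := by
  have h2 : ∀ᶠ n : ℕ in atTop, 2 < n * r :=
    (tendsto_natCast_atTop_atTop.atTop_mul_const h0).eventually_gt_atTop 2
  have h3 : ∀ᶠ n : ℕ in atTop, 2 < n * (1 - r) :=
    (tendsto_natCast_atTop_atTop.atTop_mul_const (sub_pos.2 h1)).eventually_gt_atTop 2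
  filter_upwards [h2, h3] with n hn hn'
  have c1 : ContinuousAt (fun r : ℝ => n * r) r := by fun_prop
  have c2 : ContinuousAt (fun r : ℝ => n * (1 - r)) r := by fun_prop
  filter_upwards [c1.eventually (lt_mem_nhds hn), c2.eventually (lt_mem_nhds hn')] with y hy hy'
  rw [unitCutoff, Real.smoothTransition.one_of_one_le (by linarith),
    Real.smoothTransition.one_of_one_le (by linarith), one_mul]

/-- The derivative of the cutoff is of order `n`, but lives within `2/n` of the endpoints, where a
quantity vanishing linearly with slope `L` is at most `2L/n`. The product is therefore bounded
independently of `n`. -/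
theorem exists_deriv_unitCutoff_mul_le :
    ∃ C : ℝ, 0 ≤ C ∧ ∀ (n : ℕ) (r a L : ℝ), 0 < r → r < 1 → |a| ≤ L * r → |a| ≤ L * (1 - r) →
      |a * deriv (unitCutoff n) r| ≤ C * L := by
  obtain ⟨C, hC0, hC⟩ := exists_deriv_smoothTransition_bound
  refine ⟨4 * C, by positivity, fun n r a L hr0 hr1 ha ha' => ?_⟩
  have hL : 0 ≤ L := by
    by_contra hL
    have : L * r < 0 := mul_neg_of_neg_of_pos (by linarith) hr0
    linarith [abs_nonneg a]
  have hd : ∀ y, HasDerivAt Real.smoothTransition (deriv Real.smoothTransition y) y := fun y =>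
    ((Real.smoothTransition.contDiff (n := 1)).differentiable (by simp) y).hasDerivAt
  have e1 : HasDerivAt (fun r : ℝ => n * r - 1) n r := by
    simpa using ((hasDerivAt_id r).const_mul (n : ℝ)).sub_const 1
  have e2 : HasDerivAt (fun r : ℝ => n * (1 - r) - 1) (-n) r := by
    simpa using (((hasDerivAt_id r).const_sub 1).const_mul (n : ℝ)).sub_const 1
  have h1 := ((hd _).comp r e1).mul ((hd _).comp r e2)
  have h2 : deriv (unitCutoff n) r = _ := h1.deriv
  rw [h2]
  have key : ∀ s : ℝ, 0 < s → |a| ≤ L * s →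
      |a| * (|deriv Real.smoothTransition (n * s - 1)| * n) ≤ 2 * C * L := by
    intro s hs has
    by_cases hy : 1 < n * s - 1
    · rw [(hC _).2 hy]; simp; positivity
    · have h3 := (hC (n * s - 1)).1
      have h4 : (n : ℝ) * s ≤ 2 := by linarith
      calc |a| * (|deriv Real.smoothTransition (n * s - 1)| * n) ≤ (L * s) * (C * n) := by gcongr
        _ = L * C * (n * s) := by ring
        _ ≤ L * C * 2 := by gcongr
        _ = _ := by ring
  have k1 := key r hr0 ha
  have k2 := key (1 - r) (by linarith) ha'
  set A := deriv Real.smoothTransition (n * r - 1)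
  set A' := deriv Real.smoothTransition (n * (1 - r) - 1)
  have b1 := Real.smoothTransition.nonneg (n * r - 1)
  have b2 := Real.smoothTransition.le_one (n * r - 1)
  have b3 := Real.smoothTransition.nonneg (n * (1 - r) - 1)
  have b4 := Real.smoothTransition.le_one (n * (1 - r) - 1)
  simp only [Function.comp_apply]
  set S := Real.smoothTransition (n * r - 1)
  set S' := Real.smoothTransition (n * (1 - r) - 1)
  calc |a * (A * n * S' + S * (A' * -n))|
      = |(a * (A * n)) * S' - S * (a * (A' * n))| := by congr 1; ring
    _ ≤ |(a * (A * n)) * S'| + |S * (a * (A' * n))| := abs_sub _ _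
    _ = (|a| * (|A| * n)) * S' + S * (|a| * (|A'| * n)) := by
        simp only [abs_mul, Nat.abs_cast, abs_of_nonneg b1, abs_of_nonneg b3]
    _ ≤ 2 * C * L * 1 + 1 * (2 * C * L) := by gcongr
    _ = _ := by ring

variable {d : ℕ}

/-- The product cutoff on the unit cube. -/
noncomputable def cubeCutoff (n : ℕ) (x : EuclideanSpace ℝ (Fin d)) : ℝ :=
  ∏ j, unitCutoff n (x j)

theorem contDiff_cubeCutoff (n : ℕ) : ContDiff ℝ ∞ (cubeCutoff (d := d) n) := by
  unfold cubeCutoff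
  refine contDiff_prod fun j _ => (contDiff_unitCutoff n).comp ?_
  fun_prop

theorem cubeCutoff_nonneg (n : ℕ) (x : EuclideanSpace ℝ (Fin d)) : 0 ≤ cubeCutoff n x :=
  Finset.prod_nonneg fun _ _ => unitCutoff_nonneg _ _

theorem cubeCutoff_le_one (n : ℕ) (x : EuclideanSpace ℝ (Fin d)) : cubeCutoff n x ≤ 1 :=
  Finset.prod_le_one (fun _ _ => unitCutoff_nonneg _ _) fun _ _ => unitCutoff_le_one _ _

theorem fderiv_cubeCutoff_single (n : ℕ) (x : EuclideanSpace ℝ (Fin d)) (i : Fin d) :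
    fderiv ℝ (cubeCutoff n) x (EuclideanSpace.single i 1) =
      deriv (unitCutoff n) (x i) * ∏ j ∈ Finset.univ.erase i, unitCutoff n (x j) := by
  have h1 : HasFDerivAt (cubeCutoff n) (fderiv ℝ (cubeCutoff n) x) x :=
    ((contDiff_cubeCutoff n).differentiable (by simp) x).hasFDerivAt
  have h2 : HasDerivAt (fun t : ℝ => x + t • EuclideanSpace.single i (1 : ℝ))
      (EuclideanSpace.single i (1 : ℝ)) 0 := by
    simpa using ((hasDerivAt_id (0 : ℝ)).smul_const (EuclideanSpace.single i (1 : ℝ))).const_add x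
  have h1' : HasFDerivAt (cubeCutoff n) (fderiv ℝ (cubeCutoff n) x)
      (x + (0 : ℝ) • EuclideanSpace.single i (1 : ℝ)) := by simpa using h1
  have h3 := h1'.comp_hasDerivAt (0 : ℝ) h2
  have h4 : (cubeCutoff n ∘ fun t : ℝ => x + t • EuclideanSpace.single i (1 : ℝ)) =
      fun t => unitCutoff n (x i + t) * ∏ j ∈ Finset.univ.erase i, unitCutoff n (x j) := by
    ext t
    simp only [Function.comp_apply, cubeCutoff]
    rw [← Finset.mul_prod_erase _ _ (Finset.mem_univ i)]
    congr 1
    · simp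
    · refine Finset.prod_congr rfl fun j hj => ?_
      simp [Finset.ne_of_mem_erase hj]
  rw [h4] at h3
  have h5 : HasDerivAt (fun t => unitCutoff n (x i + t)) (deriv (unitCutoff n) (x i)) 0 := by
    have := ((contDiff_unitCutoff n).differentiable (by simp) (x i)).hasDerivAt
    have h6 : HasDerivAt (unitCutoff n) (deriv (unitCutoff n) (x i)) (x i + 0) := by simpa using this
    exact h6.comp_const_add (x i) 0
  exact h3.unique (h5.mul_const _)

theorem eventually_cubeCutoff_eq_one {x : EuclideanSpace ℝ (Fin d)} (hx : x ∈ unitCube d) :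
    ∀ᶠ n : ℕ in atTop, cubeCutoff n x = 1 := by
  have : ∀ᶠ n : ℕ in atTop, ∀ j, unitCutoff n (x j) = 1 :=
    eventually_all.2 fun j => (eventually_unitCutoff_eq_one (hx j).1 (hx j).2).mono
      fun n hn => hn.eq_of_nhds
  filter_upwards [this] with n hn
  exact Finset.prod_eq_one fun j _ => hn j

theorem eventually_fderiv_cubeCutoff_eq_zero {x : EuclideanSpace ℝ (Fin d)} (hx : x ∈ unitCube d)
    (i : Fin d) :
    ∀ᶠ n : ℕ in atTop, fderiv ℝ (cubeCutoff n) x (EuclideanSpace.single i 1) = 0 := by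
  filter_upwards [eventually_unitCutoff_eq_one (hx i).1 (hx i).2] with n hn
  rw [fderiv_cubeCutoff_single, hn.deriv_eq, deriv_const, zero_mul]

theorem exists_compact_cubeCutoff {n : ℕ} (hn : 0 < n) :
    ∃ K : Set (EuclideanSpace ℝ (Fin d)), IsCompact K ∧ K ⊆ unitCube d ∧
      ∀ x ∉ K, cubeCutoff n x = 0 := by
  have hn' : (0 : ℝ) < n := by exact_mod_cast hn
  refine ⟨⋂ j, {x | 1 ≤ n * x j ∧ 1 ≤ n * (1 - x j)}, ?_, ?_, ?_⟩
  · refine Metric.isCompact_of_isClosed_isBounded (isClosed_iInter fun j => ?_) ?_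
    · have h0 : IsClosed {x : EuclideanSpace ℝ (Fin d) | 1 ≤ n * x j} :=
        isClosed_le (by fun_prop) (by fun_prop)
      have h1 : IsClosed {x : EuclideanSpace ℝ (Fin d) | 1 ≤ n * (1 - x j)} :=
        isClosed_le (by fun_prop) (by fun_prop)
      exact h0.inter h1
    · refine Metric.isBounded_iff.2 ⟨√d, fun x hx y hy => ?_⟩
      simp only [mem_iInter, mem_ofPred_eq] at hx hy
      rw [dist_eq_norm]
      refine norm_sub_le_of_mem_Icc (fun i => ⟨?_, ?_⟩) (fun i => ⟨?_, ?_⟩)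
      · have := (hx i).1; by_contra h; nlinarith
      · have := (hx i).2; by_contra h; nlinarith
      · have := (hy i).1; by_contra h; nlinarith
      · have := (hy i).2; by_contra h; nlinarith
  · intro x hx i
    simp only [mem_iInter, mem_ofPred_eq] at hx
    constructor
    · have := (hx i).1; by_contra h; nlinarith
    · have := (hx i).2; by_contra h; nlinarith
  · intro x hx
    simp only [mem_iInter, mem_ofPred_eq] at hx
    push Not at hx
    obtain ⟨j, hj⟩ := hx
    refine Finset.prod_eq_zero (Finset.mem_univ j) ?_
    by_contra h
    have := mem_of_unitCutoff_ne_zero h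
    linarith [hj this.1]

end Cutoff

/-! ### Integration by parts up to the boundary of the cube -/

section NeumannIBP

variable {d : ℕ}

theorem gradient_apply_eq_fderiv {φ : EuclideanSpace ℝ (Fin d) → ℝ}
    (x : EuclideanSpace ℝ (Fin d)) (i : Fin d) :
    gradient φ x i = fderiv ℝ φ x (EuclideanSpace.single i 1) := by
  have h : inner ℝ (gradient φ x) (EuclideanSpace.single i 1) =
      fderiv ℝ φ x (EuclideanSpace.single i 1) := by
    simp [gradient]
  rw [← h, EuclideanSpace.inner_single_right]
  simp

theorem continuous_gradient {φ : EuclideanSpace ℝ (Fin d) → ℝ} (h : ContDiff ℝ ∞ φ) :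
    Continuous (gradient φ) := by
  unfold gradient
  exact (LinearIsometryEquiv.continuous _).comp (h.continuous_fderiv (by simp))

/-- Integration by parts on the unit cube, for an `H¹` function against a smooth function with
vanishing trace on the faces orthogonal to the `i`-th direction. -/
theorem IsSobolevH1.integral_mul_fderiv_single {f : EuclideanSpace ℝ (Fin d) → ℝ}
    {g : EuclideanSpace ℝ (Fin d) → EuclideanSpace ℝ (Fin d)} (hfg : IsSobolevH1 (unitCube d) f g)
    {v : EuclideanSpace ℝ (Fin d) → ℝ} (hv : ContDiff ℝ ∞ v) {i : Fin d} {L C : ℝ}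
    (hL : ∀ x ∈ unitCube d, |v x| ≤ L * x i ∧ |v x| ≤ L * (1 - x i)) (hC : ∀ x, |v x| ≤ C)
    (hL' : ∀ x, |fderiv ℝ v x (EuclideanSpace.single i 1)| ≤ L) :
    ∫ x in unitCube d, f x * fderiv ℝ v x (EuclideanSpace.single i 1) =
      -∫ x in unitCube d, v x * g x i := by
  obtain ⟨D, hD0, hD⟩ := exists_deriv_unitCutoff_mul_le
  have hf1 : Integrable f (volume.restrict (unitCube d)) := hfg.memLp.integrable (by norm_num)
  have hg1 : Integrable g (volume.restrict (unitCube d)) := hfg.memLp_grad.integrable (by norm_num)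
  have hgi : Integrable (fun x => g x i) (volume.restrict (unitCube d)) :=
    (EuclideanSpace.proj i : EuclideanSpace ℝ (Fin d) →L[ℝ] ℝ).integrable_comp hg1
  have hvc := hv.continuous
  have hv'c : Continuous (fun x => fderiv ℝ v x (EuclideanSpace.single i 1)) :=
    (hv.continuous_fderiv (by simp)).clm_apply continuous_const
  have hφ : ∀ n, ContDiff ℝ ∞ (fun x => v x * cubeCutoff n x) := fun n =>
    hv.mul (contDiff_cubeCutoff n)
  have hφ' : ∀ n x, fderiv ℝ (fun x => v x * cubeCutoff n x) x (EuclideanSpace.single i 1) =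
      cubeCutoff n x * fderiv ℝ v x (EuclideanSpace.single i 1) +
        v x * fderiv ℝ (cubeCutoff n) x (EuclideanSpace.single i 1) := by
    intro n x
    rw [fderiv_fun_mul (hv.differentiable (by simp) x)
      ((contDiff_cubeCutoff n).differentiable (by simp) x)]
    simp
    ring
  -- This bound does not depend on `n`, because `v` vanishes linearly at the faces orthogonal to the
  -- direction `i`. It allows the cutoff to be removed by dominated convergence with no boundary
  -- term left.
  have hb : ∀ n, ∀ x ∈ unitCube d,
      |fderiv ℝ (fun x => v x * cubeCutoff n x) x (EuclideanSpace.single i 1)| ≤ L + D * L := by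
    intro n x hx
    rw [hφ', fderiv_cubeCutoff_single]
    have hd := hD n (x i) (v x) L (hx i).1 (hx i).2 (hL x hx).1 (hL x hx).2
    have hp0 : 0 ≤ ∏ j ∈ Finset.univ.erase i, unitCutoff n (x j) :=
      Finset.prod_nonneg fun _ _ => unitCutoff_nonneg _ _
    have hp1 : ∏ j ∈ Finset.univ.erase i, unitCutoff n (x j) ≤ 1 :=
      Finset.prod_le_one (fun _ _ => unitCutoff_nonneg _ _) fun _ _ => unitCutoff_le_one _ _
    refine (abs_add_le _ _).trans (add_le_add ?_ ?_)
    · rw [abs_mul, abs_of_nonneg (cubeCutoff_nonneg _ _)]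
      calc _ ≤ 1 * |fderiv ℝ v x (EuclideanSpace.single i 1)| := by
            gcongr
            exact cubeCutoff_le_one _ _
        _ ≤ L := by rw [one_mul]; exact hL' x
    · rw [← mul_assoc, abs_mul, abs_of_nonneg hp0]
      calc _ ≤ |v x * deriv (unitCutoff n) (x i)| * 1 := by gcongr
        _ ≤ _ := by rw [mul_one]; exact hd
  have hcd : ∀ n, Continuous
      (fun x => fderiv ℝ (fun x => v x * cubeCutoff n x) x (EuclideanSpace.single i 1)) :=
    fun n => ((hφ n).continuous_fderiv (by simp)).clm_apply continuous_const
  have heq : ∀ᶠ n : ℕ in atTop,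
      ∫ x in unitCube d, f x * fderiv ℝ (fun x => v x * cubeCutoff n x) x
        (EuclideanSpace.single i 1) =
      -∫ x in unitCube d, (v x * cubeCutoff n x) * g x i := by
    filter_upwards [eventually_gt_atTop 0] with n hn
    obtain ⟨K, hK, hKQ, hK0⟩ := exists_compact_cubeCutoff (d := d) hn
    have hz : ∀ x ∉ K, v x * cubeCutoff n x = 0 := fun x hx => by rw [hK0 x hx, mul_zero]
    have hcs : HasCompactSupport (fun x => v x * cubeCutoff n x) := HasCompactSupport.intro hK hz
    have hts : tsupport (fun x => v x * cubeCutoff n x) ⊆ unitCube d :=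
      (closure_minimal (fun x hx => by by_contra h; exact hx (hz x h)) hK.isClosed).trans hKQ
    have h := hfg.weak_grad _ (hφ n) hcs hts
    have h2 := congrArg (EuclideanSpace.proj i : EuclideanSpace ℝ (Fin d) →L[ℝ] ℝ) h
    have hgc := continuous_gradient (hφ n)
    obtain ⟨A, hA⟩ := (hcs.fderiv ℝ).exists_bound_of_continuous
      ((hφ n).continuous_fderiv (by simp))
    rw [map_neg, ← ContinuousLinearMap.integral_comp_comm,
      ← ContinuousLinearMap.integral_comp_comm] at h2
    · simpa only [map_smul, PiLp.proj_apply, gradient_apply_eq_fderiv, smul_eq_mul] using h2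
    · refine hg1.bdd_smul C (hφ n).continuous.aestronglyMeasurable (Eventually.of_forall fun x => ?_)
      rw [Real.norm_eq_abs, abs_mul, abs_of_nonneg (cubeCutoff_nonneg _ _)]
      calc |v x| * cubeCutoff n x ≤ |v x| * 1 := by
            gcongr
            exact cubeCutoff_le_one _ _
        _ ≤ C := by rw [mul_one]; exact hC x
    · refine hf1.smul_bdd A hgc.aestronglyMeasurable (Eventually.of_forall fun x => ?_)
      simpa [gradient] using hA x
  have hlim1 : Tendsto (fun n : ℕ => ∫ x in unitCube d, f x *
      fderiv ℝ (fun x => v x * cubeCutoff n x) x (EuclideanSpace.single i 1)) atTop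
      (𝓝 (∫ x in unitCube d, f x * fderiv ℝ v x (EuclideanSpace.single i 1))) := by
    refine tendsto_integral_of_dominated_convergence (fun x => ‖f x‖ * (L + D * L))
      (fun n => ?_) (hf1.norm.mul_const _) (fun n => ?_) ?_
    · exact hf1.aestronglyMeasurable.mul (hcd n).aestronglyMeasurable
    · refine ae_restrict_of_forall_mem (measurableSet_unitCube d) fun x hx => ?_
      rw [norm_mul]
      exact mul_le_mul_of_nonneg_left (hb n x hx) (norm_nonneg _)
    · refine ae_restrict_of_forall_mem (measurableSet_unitCube d) fun x hx => ?_
      refine tendsto_const_nhds.congr' ?_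
      filter_upwards [eventually_cubeCutoff_eq_one hx, eventually_fderiv_cubeCutoff_eq_zero hx i]
        with n h1 h2
      rw [hφ', h1, h2]
      ring
  have hlim2 : Tendsto (fun n : ℕ => -∫ x in unitCube d, (v x * cubeCutoff n x) * g x i) atTop
      (𝓝 (-∫ x in unitCube d, v x * g x i)) := by
    refine (tendsto_integral_of_dominated_convergence (fun x => C * ‖g x i‖)
      (fun n => ?_) (hgi.norm.const_mul _) (fun n => ?_) ?_).neg
    · exact (hφ n).continuous.aestronglyMeasurable.mul hgi.aestronglyMeasurable
    · refine ae_restrict_of_forall_mem (measurableSet_unitCube d) fun x hx => ?_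
      rw [norm_mul]
      refine mul_le_mul_of_nonneg_right ?_ (norm_nonneg _)
      rw [Real.norm_eq_abs, abs_mul, abs_of_nonneg (cubeCutoff_nonneg _ _)]
      calc |v x| * cubeCutoff n x ≤ |v x| * 1 := by
            gcongr
            exact cubeCutoff_le_one _ _
        _ ≤ C := by rw [mul_one]; exact hC x
    · refine ae_restrict_of_forall_mem (measurableSet_unitCube d) fun x hx => ?_
      refine tendsto_const_nhds.congr' ?_
      filter_upwards [eventually_cubeCutoff_eq_one hx] with n h1
      rw [h1, mul_one]
  exact tendsto_nhds_unique_of_eventuallyEq hlim1 hlim2 heq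

/-- Mean value inequality along the line through `x` in the direction `i`, which meets the
hyperplane where `v` vanishes. -/
theorem abs_le_mul_of_fderiv_single_le {v : EuclideanSpace ℝ (Fin d) → ℝ}
    (hv : Differentiable ℝ v) {i : Fin d} {L c : ℝ} (h0 : ∀ x, x i = c → v x = 0)
    (hL : ∀ x, |fderiv ℝ v x (EuclideanSpace.single i 1)| ≤ L) (x : EuclideanSpace ℝ (Fin d)) :
    |v x| ≤ L * |x i - c| := by
  have hd : ∀ t : ℝ, HasDerivAt (fun t : ℝ => v (x + t • EuclideanSpace.single i (1 : ℝ)))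
      (fderiv ℝ v (x + t • EuclideanSpace.single i (1 : ℝ)) (EuclideanSpace.single i 1)) t := by
    intro t
    have h2 : HasDerivAt (fun t : ℝ => x + t • EuclideanSpace.single i (1 : ℝ))
        (EuclideanSpace.single i (1 : ℝ)) t := by
      simpa using ((hasDerivAt_id t).smul_const (EuclideanSpace.single i (1 : ℝ))).const_add x
    exact (hv _).hasFDerivAt.comp_hasDerivAt t h2
  have := Convex.norm_image_sub_le_of_norm_hasDerivWithin_le (s := univ)
    (fun t _ => (hd t).hasDerivWithinAt) (fun t _ => hL _) convex_univ (mem_univ (c - x i))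
    (mem_univ (0 : ℝ))
  rw [h0 (x + (c - x i) • EuclideanSpace.single i (1 : ℝ)) (by simp)] at this
  simpa using this

end NeumannIBP

/-! ### Folding the space onto the cube by reflections -/

section Fold

variable {d : ℕ}

/-- The folding of the space onto the closed unit cube, by reflections across the faces. -/
noncomputable def cubeFold (x : EuclideanSpace ℝ (Fin d)) : EuclideanSpace ℝ (Fin d) :=
  WithLp.toLp 2 fun i => ‖((x i : ℝ) : AddCircle (2 : ℝ))‖

/-- Change the sign of the coordinates in `s`. -/
noncomputable def signFlip (s : Fin d → Bool) :
    EuclideanSpace ℝ (Fin d) ≃ₗᵢ[ℝ] EuclideanSpace ℝ (Fin d) :=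
  LinearIsometryEquiv.piLpCongrRight 2 fun i =>
    if s i then LinearIsometryEquiv.neg ℝ else LinearIsometryEquiv.refl ℝ ℝ

theorem signFlip_apply (s : Fin d → Bool) (x : EuclideanSpace ℝ (Fin d)) (i : Fin d) :
    signFlip s x i = if s i then -x i else x i := by
  unfold signFlip
  rw [LinearIsometryEquiv.piLpCongrRight_apply]
  simp only
  split_ifs <;> simp

theorem cubeFold_mem_Icc (x : EuclideanSpace ℝ (Fin d)) (i : Fin d) :
    cubeFold x i ∈ Icc (0 : ℝ) 1 := by
  refine ⟨norm_nonneg _, ?_⟩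
  have := AddCircle.norm_le_half_period (2 : ℝ) two_ne_zero (x := ((x i : ℝ) : AddCircle (2 : ℝ)))
  simpa [cubeFold] using this

theorem cubeFold_of_mem_Icc {x : EuclideanSpace ℝ (Fin d)} (hx : ∀ i, x i ∈ Icc (0 : ℝ) 1) :
    cubeFold x = x := by
  ext i
  have h := hx i
  have h2 : |x i| ≤ |(2 : ℝ)| / 2 := by
    rw [abs_of_nonneg h.1, abs_two]
    linarith [h.2]
  show ‖((x i : ℝ) : AddCircle (2 : ℝ))‖ = x i
  rw [(AddCircle.norm_coe_eq_abs_iff (2 : ℝ) two_ne_zero).2 h2, abs_of_nonneg h.1]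

theorem norm_cubeFold_sub_le (x y : EuclideanSpace ℝ (Fin d)) :
    ‖cubeFold x - cubeFold y‖ ≤ ‖x - y‖ := by
  rw [EuclideanSpace.norm_eq, EuclideanSpace.norm_eq]
  refine Real.sqrt_le_sqrt (Finset.sum_le_sum fun i _ => ?_)
  have h1 : ‖(cubeFold x - cubeFold y) i‖ ≤ ‖(x - y) i‖ := by
    simp only [PiLp.sub_apply, cubeFold]
    refine (abs_norm_sub_norm_le _ _).trans ?_
    rw [← AddCircle.coe_sub]
    exact QuotientAddGroup.norm_mk_le_norm
  gcongr

theorem continuous_cubeFold : Continuous (cubeFold (d := d)) :=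
  (LipschitzWith.of_dist_le_mul (K := 1) fun x y => by
    rw [dist_eq_norm, dist_eq_norm]
    simpa using norm_cubeFold_sub_le x y).continuous

theorem cubeFold_signFlip_add (s : Fin d → Bool) (k : Fin d → ℤ) (x : EuclideanSpace ℝ (Fin d)) :
    cubeFold (signFlip s x + WithLp.toLp 2 fun i => (k i : ℝ) * 2) = cubeFold x := by
  ext i
  show ‖(((signFlip s x + WithLp.toLp 2 fun i => (k i : ℝ) * 2) i : ℝ) : AddCircle (2 : ℝ))‖ =
    ‖((x i : ℝ) : AddCircle (2 : ℝ))‖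
  rw [PiLp.add_apply, signFlip_apply]
  have h : (((k i : ℝ) * 2 : ℝ) : AddCircle (2 : ℝ)) = 0 := by
    rw [AddCircle.coe_eq_zero_iff]
    exact ⟨k i, by simp⟩
  simp only
  rw [AddCircle.coe_add, h, add_zero]
  split_ifs
  · rw [AddCircle.coe_neg, norm_neg]
  · rfl

theorem exists_signFlip_cubeFold (x : EuclideanSpace ℝ (Fin d)) :
    ∃ (s : Fin d → Bool) (k : Fin d → ℤ),
      x = signFlip s (cubeFold x) + WithLp.toLp 2 fun i => (k i : ℝ) * 2 := by
  have : ∀ i, ∃ (s : Bool) (k : ℤ), x i =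
      (if s then -(‖((x i : ℝ) : AddCircle (2 : ℝ))‖) else ‖((x i : ℝ) : AddCircle (2 : ℝ))‖)
        + (k : ℝ) * 2 := by
    intro i
    rw [AddCircle.norm_eq]
    rcases abs_choice (x i - round ((2 : ℝ)⁻¹ * x i) * 2) with h | h
    · exact ⟨false, round ((2 : ℝ)⁻¹ * x i), by rw [h]; simp⟩
    · exact ⟨true, round ((2 : ℝ)⁻¹ * x i), by rw [h]; simp⟩
  choose s k h using this
  refine ⟨s, k, ?_⟩
  ext i
  rw [PiLp.add_apply, signFlip_apply]
  exact h i

/-- Functions which are invariant under the reflections across the faces of the unit cube. -/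
def FoldInvariant (f : EuclideanSpace ℝ (Fin d) → ℝ) : Prop := ∀ x, f (cubeFold x) = f x

theorem FoldInvariant.apply_signFlip_add {f : EuclideanSpace ℝ (Fin d) → ℝ} (hf : FoldInvariant f)
    (s : Fin d → Bool) (k : Fin d → ℤ) (x : EuclideanSpace ℝ (Fin d)) :
    f (signFlip s x + WithLp.toLp 2 fun i => (k i : ℝ) * 2) = f x := by
  rw [← hf, cubeFold_signFlip_add, hf]

/-- The folding is not an isometry, but every point is the image of its folded point under a sign
change of coordinates followed by a translation in `2ℤ^d`. For each such map the isometry invariance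
of the heat flow applies. -/
theorem FoldInvariant.heat {f : EuclideanSpace ℝ (Fin d) → ℝ} (hf : FoldInvariant f) (t : ℝ) :
    FoldInvariant (heat t f) := by
  have h : ∀ (s : Fin d → Bool) (k : Fin d → ℤ) (x : EuclideanSpace ℝ (Fin d)),
      _root_.heat t f (signFlip s x + WithLp.toLp 2 fun i => (k i : ℝ) * 2) =
        _root_.heat t f x := by
    intro s k x
    rw [heat_isometry]
    simp_rw [hf.apply_signFlip_add]
  intro x
  obtain ⟨s, k, hx⟩ := exists_signFlip_cubeFold x
  conv_rhs => rw [hx]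
  rw [h]

end Fold

/-! ### Reflected heat flow as Neumann heat flow -/

section NeumannHeat

variable {d : ℕ} {f : EuclideanSpace ℝ (Fin d) → ℝ} {B : ℝ}

/-- The affine reflection across the hyperplane `x i = c`. -/
theorem signFlip_single_apply_of_eq (i : Fin d) (c : ℤ) {x : EuclideanSpace ℝ (Fin d)}
    (hx : x i = c) :
    signFlip (fun j => decide (j = i)) x +
      (WithLp.toLp 2 fun j => (((if j = i then c else 0 : ℤ) : ℝ) * 2)) = x := by
  ext j
  rw [PiLp.add_apply, signFlip_apply]
  by_cases hj : j = i
  · subst hj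
    simp [hx]
    ring
  · simp [hj]

theorem signFlip_single_single (i : Fin d) :
    signFlip (fun j => decide (j = i)) (EuclideanSpace.single i (1 : ℝ)) =
      -EuclideanSpace.single i 1 := by
  ext j
  rw [signFlip_apply]
  by_cases hj : j = i
  · subst hj; simp
  · simp [hj]

/-- The point `x` is fixed by the reflection in its hyperplane, which leaves `w` unchanged and
reverses the normal vector, so the normal derivative equals its own opposite. -/
theorem FoldInvariant.fderiv_single_eq_zero {w : EuclideanSpace ℝ (Fin d) → ℝ}
    (hw : FoldInvariant w) (hd : Differentiable ℝ w) (i : Fin d) (c : ℤ)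
    {x : EuclideanSpace ℝ (Fin d)} (hx : x i = c) :
    fderiv ℝ w x (EuclideanSpace.single i 1) = 0 := by
  set R := signFlip (fun j => decide (j = i)) with hR
  set a : EuclideanSpace ℝ (Fin d) :=
    WithLp.toLp 2 fun j => (((if j = i then c else 0 : ℤ) : ℝ) * 2) with ha
  have hRx : R x + a = x := signFlip_single_apply_of_eq i c hx
  have h1 : w = fun y => w (R y + a) := by
    ext y
    exact (hw.apply_signFlip_add _ (fun j => if j = i then c else 0) y).symm
  have h2 : HasFDerivAt (fun y => R y + a)
      (R.toContinuousLinearEquiv : EuclideanSpace ℝ (Fin d) →L[ℝ] EuclideanSpace ℝ (Fin d)) x :=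
    (R.toContinuousLinearEquiv.hasFDerivAt (x := x)).add_const a
  have h3 : HasFDerivAt w (fderiv ℝ w x) (R x + a) := by
    rw [hRx]; exact (hd x).hasFDerivAt
  have h4 := h3.comp x h2
  have h5 : fderiv ℝ w x = (fderiv ℝ w x).comp
      (R.toContinuousLinearEquiv : EuclideanSpace ℝ (Fin d) →L[ℝ] EuclideanSpace ℝ (Fin d)) := by
    refine HasFDerivAt.unique (hd x).hasFDerivAt ?_
    have h6 : (w ∘ fun y => R y + a) = w := by
      rw [Function.comp_def]; exact h1.symm
    rw [h6] at h4
    exact h4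
  have h6 := congrArg (fun L => L (EuclideanSpace.single i 1)) h5
  simp only [ContinuousLinearMap.comp_apply, ContinuousLinearEquiv.coe_coe,
    LinearIsometryEquiv.coe_toContinuousLinearEquiv] at h6
  rw [hR, signFlip_single_single, map_neg] at h6
  linarith

theorem gradient_heat (h : BddCont f B) {t : ℝ} (ht : 0 < t) (x : EuclideanSpace ℝ (Fin d)) :
    gradient (heat t f) x = heatGrad t f x := by
  rw [gradient, (hasFDerivAt_heat h ht x).fderiv]
  exact (InnerProductSpace.toDual ℝ _).symm_apply_apply _

theorem inner_heatGrad_eq_zero (h : BddCont f B) (hf : FoldInvariant f) {t : ℝ} (ht : 0 < t)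
    (i : Fin d) (c : ℤ) {x : EuclideanSpace ℝ (Fin d)} (hx : x i = c) :
    inner ℝ (heatGrad t f x) (EuclideanSpace.single i 1) = 0 := by
  have := (hf.heat t).fderiv_single_eq_zero ((contDiff_heat h ht).differentiable (by simp)) i c hx
  rwa [(hasFDerivAt_heat h ht x).fderiv, innerSL_apply_apply] at this

/-- Green's formula, direction by direction. The `i`-th partial derivative of `heat t f` vanishes on
the faces orthogonal to direction `i`, and its bounded slope makes it vanish linearly there, so no
boundary term appears even though `φ` is arbitrary at the boundary. -/
theorem IsSobolevH1.integral_mul_heatLap {φ : EuclideanSpace ℝ (Fin d) → ℝ}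
    {g : EuclideanSpace ℝ (Fin d) → EuclideanSpace ℝ (Fin d)} (hφ : IsSobolevH1 (unitCube d) φ g)
    (h : BddCont f B) (hf : FoldInvariant f) {t : ℝ} (ht : 0 < t) :
    ∫ x in unitCube d, φ x * heatLap (EuclideanSpace.basisFun (Fin d) ℝ) t f x =
      -∫ x in unitCube d, inner ℝ (g x) (heatGrad t f x) := by
  have hφ1 : Integrable φ (volume.restrict (unitCube d)) := hφ.memLp.integrable (by norm_num)
  have hg1 : Integrable g (volume.restrict (unitCube d)) := hφ.memLp_grad.integrable (by norm_num)
  have ht2 : 0 < t / 2 := by positivity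
  have hder : ∀ (i : Fin d), ∃ L, ∀ x,
      |fderiv ℝ (fun y => inner ℝ (heatGrad t f y) (EuclideanSpace.single i (1 : ℝ))) x
        (EuclideanSpace.single i 1)| ≤ L := by
    intro i
    set e : EuclideanSpace ℝ (Fin d) := EuclideanSpace.single i 1
    set M := gaussMoment (EuclideanSpace ℝ (Fin d)) / √(2 * (t / 2))
    refine ⟨M * (M * B * ‖e‖) * ‖e‖, fun x => ?_⟩
    have h1 := fderiv_inner_heatGrad h ht2 ht2 x (EuclideanSpace.single i (1 : ℝ))
      (EuclideanSpace.single i (1 : ℝ))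
    rw [add_halves] at h1
    rw [h1]
    exact (inner_heatGrad_bddCont (inner_heatGrad_bddCont h ht2 _) ht2 _).bound x
  have hc : ∀ i : Fin d, ContDiff ℝ ∞
      (fun y => inner ℝ (heatGrad t f y) (EuclideanSpace.single i (1 : ℝ))) := fun i =>
    contDiff_inner_heatGrad h ht _
  have key : ∀ i : Fin d, ∫ x in unitCube d, φ x *
      fderiv ℝ (fun y => inner ℝ (heatGrad t f y) (EuclideanSpace.single i (1 : ℝ))) x
        (EuclideanSpace.single i 1) =
      -∫ x in unitCube d, inner ℝ (heatGrad t f x) (EuclideanSpace.single i (1 : ℝ)) * g x i := by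
    intro i
    obtain ⟨L, hL⟩ := hder i
    refine hφ.integral_mul_fderiv_single (hc i) (L := L)
      (C := gaussMoment (EuclideanSpace ℝ (Fin d)) / √(2 * t) * B *
        ‖(EuclideanSpace.single i (1 : ℝ) : EuclideanSpace ℝ (Fin d))‖) (fun x hx => ?_)
      (inner_heatGrad_bddCont h ht _).bound hL
    have a0 := abs_le_mul_of_fderiv_single_le (c := 0) ((hc i).differentiable (by simp))
      (fun x hx => inner_heatGrad_eq_zero h hf ht i 0 (by simpa using hx)) hL x
    have a1 := abs_le_mul_of_fderiv_single_le (c := 1) ((hc i).differentiable (by simp))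
      (fun x hx => inner_heatGrad_eq_zero h hf ht i 1 (by simpa using hx)) hL x
    rw [sub_zero, abs_of_pos (hx i).1] at a0
    rw [abs_sub_comm, abs_of_pos (sub_pos.2 (hx i).2)] at a1
    exact ⟨a0, a1⟩
  simp_rw [heatLap, Finset.mul_sum, EuclideanSpace.basisFun_apply]
  rw [integral_finsetSum]
  · simp_rw [key]
    rw [Finset.sum_neg_distrib, ← integral_finsetSum]
    · congr 2
      ext x
      simp_rw [EuclideanSpace.inner_single_right, PiLp.inner_apply]
      simp
    · intro i _
      have hgi : Integrable (fun x => g x i) (volume.restrict (unitCube d)) :=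
        (EuclideanSpace.proj i : EuclideanSpace ℝ (Fin d) →L[ℝ] ℝ).integrable_comp hg1
      exact hgi.bdd_smul _ (hc i).continuous.aestronglyMeasurable
        (Eventually.of_forall (inner_heatGrad_bddCont h ht _).bound)
  · intro i _
    obtain ⟨L, hL⟩ := hder i
    exact hφ1.smul_bdd L
      (((hc i).continuous_fderiv (by simp)).clm_apply continuous_const).aestronglyMeasurable
        (Eventually.of_forall hL)

theorem isSobolevH1_heat (h : BddCont f B) {t : ℝ} (ht : 0 < t) :
    IsSobolevH1 (unitCube d) (heat t f) (heatGrad t f) := by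
  have hu := heat_bddCont h t
  have hg := hasBddGrad_heat h ht
  have hgc := hg.cont
  have huc := hu.cont
  refine ⟨?_, ?_, ?_⟩
  · exact MemLp.of_bound huc.aestronglyMeasurable _ (Eventually.of_forall hu.bound)
  · exact MemLp.of_bound hgc.aestronglyMeasurable _ (Eventually.of_forall hg.bound)
  · intro φ hφ hcs hts
    have hφ0 : ∀ x, x ∉ unitCube d → φ x = 0 := fun x hx =>
      image_eq_zero_of_notMem_tsupport fun hx' => hx (hts hx')
    have hφ1 : ∀ x, x ∉ unitCube d → gradient φ x = 0 := fun x hx => by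
      rw [gradient, image_eq_zero_of_notMem_tsupport (f := fderiv ℝ φ)
        fun hx' => hx (hts (tsupport_fderiv_subset ℝ hx')), map_zero]
    rw [setIntegral_eq_integral_of_forall_compl_eq_zero (fun x hx => by rw [hφ1 x hx, smul_zero]),
      setIntegral_eq_integral_of_forall_compl_eq_zero (fun x hx => by rw [hφ0 x hx, zero_smul])]
    have hgφ := continuous_gradient hφ
    have hcg : HasCompactSupport (gradient φ) := by
      unfold gradient
      exact (hcs.fderiv ℝ).comp_left (map_zero _)
    have i1 : Integrable (fun x => heat t f x • gradient φ x) :=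
      (huc.smul hgφ).integrable_of_hasCompactSupport hcg.smul_left
    have i2 : Integrable (fun x => φ x • heatGrad t f x) :=
      (hφ.continuous.smul hgc).integrable_of_hasCompactSupport hcs.smul_right
    refine PiLp.ext fun i => ?_
    have e : ∀ F : EuclideanSpace ℝ (Fin d), F i =
      (EuclideanSpace.proj i : EuclideanSpace ℝ (Fin d) →L[ℝ] ℝ) F := fun _ => rfl
    rw [e, e, map_neg, ← ContinuousLinearMap.integral_comp_comm _ i1,
      ← ContinuousLinearMap.integral_comp_comm _ i2]
    have hd : Differentiable ℝ (heat t f) := (contDiff_heat h ht).differentiable (by simp)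
    have hfd : ∀ x, fderiv ℝ (heat t f) x (EuclideanSpace.single i 1) = heatGrad t f x i := by
      intro x
      rw [← gradient_apply_eq_fderiv, gradient_heat h ht]
    have hcgi : HasCompactSupport (fun x => gradient φ x i) :=
      hcg.comp_left (g := fun v : EuclideanSpace ℝ (Fin d) => v i) (by simp)
    have := integral_mul_fderiv_eq_neg_fderiv_mul_of_integrable (μ := volume) (f := heat t f)
      (g := φ) (v := EuclideanSpace.single i (1 : ℝ)) ?_ ?_ ?_ (fun x _ => hd x)
      (fun x _ => hφ.differentiable (by simp) x)
    · simp_rw [hfd, ← gradient_apply_eq_fderiv] at this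
      simp_rw [map_smul, PiLp.proj_apply, smul_eq_mul]
      rw [this]
      simp_rw [mul_comm]
    · simp_rw [hfd]
      exact Continuous.integrable_of_hasCompactSupport (by have := hφ.continuous; fun_prop)
        hcs.mul_left
    · simp_rw [← gradient_apply_eq_fderiv]
      exact Continuous.integrable_of_hasCompactSupport (by fun_prop) hcgi.mul_left
    · exact Continuous.integrable_of_hasCompactSupport (by have := hφ.continuous; fun_prop)
        hcs.mul_left

/-- For `t > 0` the weak equation is the heat equation combined with Green's formula; it is then
integrated from `0`. Hölder regularity controls the initial time: the squared gradient is of order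
`t^(α-1)`, which is integrable at `0` since `α > 0`. -/
theorem isNeumannHeatFlow_heat {ρ : EuclideanSpace ℝ (Fin d) → ℝ} {H α : ℝ} (h : BddCont f B)
    (hf : FoldInvariant f) (hα0 : 0 < α) (hα1 : α ≤ 1) (hH : 0 ≤ H)
    (hol : ∀ x y, |f x - f y| ≤ H * ‖x - y‖ ^ α) (hρ : ∀ x ∈ unitCube d, f x = ρ x) :
    IsNeumannHeatFlow (unitCube d) ρ (fun t => heat t f) := by
  have hQ := measurableSet_unitCube d
  have hM := gaussMoment_nonneg (E := EuclideanSpace ℝ (Fin d))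
  refine ⟨?_, fun t => heatGrad t f, fun t ht => isSobolevH1_heat h ht, fun t ht => ?_, ?_⟩
  · simp only [heat_of_nonpos le_rfl]
    exact ae_restrict_of_forall_mem hQ hρ
  · have hmeas : AEStronglyMeasurable
        (fun p : ℝ × EuclideanSpace ℝ (Fin d) => heatGrad p.1 f p.2)
        ((volume.restrict (Ioc 0 t)).prod (volume.restrict (unitCube d))) := by
      rw [Measure.prod_restrict]
      refine ((continuousOn_heatGrad_uncurry h).mono ?_).aestronglyMeasurable
        (measurableSet_Ioc.prod hQ)
      exact prod_mono Ioc_subset_Ioi_self (subset_univ _)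
    rw [memLp_two_iff_integrable_sq_norm hmeas]
    have hi : IntegrableOn (fun s : ℝ => s ^ (α - 1)) (Ioc 0 t) :=
      (intervalIntegrable_iff_integrableOn_Ioc_of_le ht.le).1
        (intervalIntegral.intervalIntegrable_rpow' (by linarith))
    have hi2 := (Integrable.comp_fst (ν := volume.restrict (unitCube d)) hi).const_mul
      ((gaussMoment (EuclideanSpace ℝ (Fin d)) * H) ^ 2)
    refine hi2.mono' (hmeas.norm.pow 2) ?_
    rw [Measure.prod_restrict]
    refine ae_restrict_of_forall_mem (measurableSet_Ioc.prod hQ) fun p hp => ?_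
    have hp0 : 0 < p.1 := hp.1.1
    have h1 := norm_heatGrad_le_of_holder h hp0 hα0 hα1 hH hol p.2
    rw [norm_pow, norm_norm]
    refine (pow_le_pow_left₀ (norm_nonneg _) h1 2).trans (le_of_eq ?_)
    rw [mul_pow, ← Real.rpow_natCast (p.1 ^ ((α - 1) / 2)), ← Real.rpow_mul hp0.le]
    norm_num
  · intro φ g hφ t ht
    have hφ1 : Integrable φ (volume.restrict (unitCube d)) := hφ.memLp.integrable (by norm_num)
    have hg1 : Integrable g (volume.restrict (unitCube d)) :=
      hφ.memLp_grad.integrable (by norm_num)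
    have hcont : Continuous fun t => ∫ x in unitCube d, φ x * heat t f x := by
      refine continuous_of_dominated (bound := fun x => ‖φ x‖ * B) (fun s => ?_) (fun s => ?_)
        (hφ1.norm.mul_const B) (Eventually.of_forall fun x => ?_)
      · exact hφ1.aestronglyMeasurable.mul (heat_bddCont h s).cont.aestronglyMeasurable
      · refine Eventually.of_forall fun x => ?_
        rw [norm_mul]
        exact mul_le_mul_of_nonneg_left ((heat_bddCont h s).bound x) (norm_nonneg _)
      · exact continuous_const.mul ((continuous_heat_uncurry h).comp
          (f := fun s : ℝ => (s, x)) (by fun_prop))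
    have hder : ∀ s, 0 < s → HasDerivAt (fun t => ∫ x in unitCube d, φ x * heat t f x)
        (-∫ x in unitCube d, inner ℝ (g x) (heatGrad s f x)) s := by
      intro s hs
      rw [← hφ.integral_mul_heatLap h hf hs]
      have hs2 : s / 2 < s := by linarith
      have hmem : ∀ r, ContinuousOn
          (heatLap (EuclideanSpace.basisFun (Fin d) ℝ) r f) univ ∨ r ≤ 0 := fun r => by
        rcases le_or_gt r 0 with hr | hr
        · exact Or.inr hr
        · exact Or.inl ((continuousOn_heatLap_uncurry (EuclideanSpace.basisFun (Fin d) ℝ) h).comp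
            (f := fun x => (r, x)) (by fun_prop) fun x _ => ⟨hr, mem_univ _⟩)
      refine (hasDerivAt_integral_of_dominated_loc_of_deriv_le
        (F := fun t x => φ x * heat t f x)
        (F' := fun t x => φ x * heatLap (EuclideanSpace.basisFun (Fin d) ℝ) t f x)
        (Ioi_mem_nhds hs2) (Eventually.of_forall fun r => ?_) ?_ ?_
        (Eventually.of_forall fun x r hr => ?_) (hφ1.norm.mul_const (Fintype.card (Fin d) *
          (gaussMoment (EuclideanSpace ℝ (Fin d)) / √(s / 2) *
            (gaussMoment (EuclideanSpace ℝ (Fin d)) / √(s / 2) * B))))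
        (Eventually.of_forall fun x r hr => ?_)).2
      · exact hφ1.aestronglyMeasurable.mul (heat_bddCont h r).cont.aestronglyMeasurable
      · exact hφ1.smul_bdd B (heat_bddCont h s).cont.aestronglyMeasurable
          (Eventually.of_forall (heat_bddCont h s).bound)
      · rcases hmem s with h1 | h1
        · exact hφ1.aestronglyMeasurable.mul (continuousOn_univ.1 h1).aestronglyMeasurable
        · linarith
      · rw [norm_mul]
        exact mul_le_mul_of_nonneg_left (abs_heatLap_le _ h (by linarith) (le_of_lt hr) x)
          (norm_nonneg _)
      · have hr0 : 0 < r := lt_trans (by linarith) hr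
        exact (hasDerivAt_heat (EuclideanSpace.basisFun (Fin d) ℝ) h hr0 x).const_mul (φ x)
    have hint : IntervalIntegrable
        (fun s => -∫ x in unitCube d, inner ℝ (g x) (heatGrad s f x)) volume 0 t := by
      have hi : IntervalIntegrable (fun s : ℝ => s ^ ((α - 1) / 2)) volume 0 t :=
        intervalIntegral.intervalIntegrable_rpow' (by linarith)
      have hi2 := hi.const_mul ((∫ x in unitCube d, ‖g x‖) *
        (gaussMoment (EuclideanSpace ℝ (Fin d)) * H))
      refine hi2.mono_fun' ?_ ?_
      · rw [uIoc_of_le ht]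
        -- Measurability in time comes for free, since on `(0,t]` the integrand is the derivative of
        -- a function of time.
        refine (measurable_deriv
          (fun t => ∫ x in unitCube d, φ x * heat t f x)).aestronglyMeasurable.congr ?_
        exact ae_restrict_of_forall_mem measurableSet_Ioc fun s hs => (hder s hs.1).deriv
      · rw [uIoc_of_le ht]
        refine ae_restrict_of_forall_mem measurableSet_Ioc fun s hs => ?_
        simp only [norm_neg]
        rw [mul_assoc, ← integral_mul_const]
        refine norm_integral_le_of_norm_le (hg1.norm.mul_const _) (Eventually.of_forall fun x => ?_)
        refine (norm_inner_le_norm _ _).trans ?_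
        exact mul_le_mul_of_nonneg_left
          (norm_heatGrad_le_of_holder h hs.1 hα0 hα1 hH hol x) (norm_nonneg _)
    have hFTC := intervalIntegral.integral_eq_sub_of_hasDerivAt_of_le ht hcont.continuousOn
      (fun s hs => hder s hs.1) hint
    rw [intervalIntegral.integral_neg] at hFTC
    have h0 : ∫ x in unitCube d, φ x * heat 0 f x = ∫ x in unitCube d, φ x * ρ x := by
      rw [heat_of_nonpos le_rfl]
      exact setIntegral_congr_fun hQ fun x hx => by simp only [hρ x hx]
    rw [h0] at hFTC
    linarith

end NeumannHeat

/-! ### Decay in time and bounds for the velocity field -/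

section Decay

variable {d : ℕ} {f : EuclideanSpace ℝ (Fin d) → ℝ} {B : ℝ}

theorem heat_const_add (h : BddCont f B) (c t : ℝ) (x : EuclideanSpace ℝ (Fin d)) :
    heat t (fun y => c + f y) x = c + heat t f x := by
  rw [heat, gaussAvg, integral_add (integrable_const _) (h.integrable_avg _ _)]
  simp [heat, gaussAvg]

theorem heatGrad_const_add (h : BddCont f B) (c t : ℝ) (x : EuclideanSpace ℝ (Fin d)) :
    heatGrad t (fun y => c + f y) x = heatGrad t f x := by
  have hi : Integrable (fun z : EuclideanSpace ℝ (Fin d) => c • z)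
      (stdGaussian (EuclideanSpace ℝ (Fin d))) := IsGaussian.integrable_id.smul c
  have h0 : ∫ z : EuclideanSpace ℝ (Fin d), z ∂(stdGaussian (EuclideanSpace ℝ (Fin d))) = 0 :=
    integral_id_stdGaussian
  rw [heatGrad, heatGrad, gaussGrad, gaussGrad]
  simp_rw [add_smul]
  rw [integral_add hi (h.integrable_smul _ _), integral_smul, h0, smul_zero, zero_add]

/-- The constant is its own heat evolution, so this is a case of `isSobolevH1_heat`; the form `1 +
0` is chosen to fit `heatGrad_const_add`. -/
theorem isSobolevH1_one : IsSobolevH1 (unitCube d) (fun _ => 1) (fun _ => 0) := by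
  have h0 : BddCont (fun _ : EuclideanSpace ℝ (Fin d) => (0 : ℝ)) 1 :=
    ⟨continuous_const, fun x => by simp⟩
  have h1 : BddCont (fun _ : EuclideanSpace ℝ (Fin d) => (1 : ℝ) + 0) 1 :=
    ⟨continuous_const, fun x => by simp⟩
  have h2 := isSobolevH1_heat h1 one_pos
  have h3 : heat 1 (fun _ : EuclideanSpace ℝ (Fin d) => (1 : ℝ) + 0) = fun _ => 1 := by
    ext x
    simp [heat, gaussAvg]
  have h4 : heatGrad 1 (fun _ : EuclideanSpace ℝ (Fin d) => (1 : ℝ) + 0) = fun _ => 0 := by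
    ext1 x
    rw [heatGrad_const_add h0]
    simp [heatGrad, gaussGrad]
  rwa [h3, h4] at h2

theorem integral_heat_eq {H α : ℝ} (h : BddCont f B)
    (hf : FoldInvariant f) (hα0 : 0 < α) (hα1 : α ≤ 1) (hH : 0 ≤ H)
    (hol : ∀ x y, |f x - f y| ≤ H * ‖x - y‖ ^ α) {t : ℝ} (ht : 0 ≤ t) :
    ∫ x in unitCube d, heat t f x = ∫ x in unitCube d, f x := by
  obtain ⟨-, G, -, -, hG⟩ := isNeumannHeatFlow_heat h hf hα0 hα1 hH hol (fun x _ => rfl)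
  have := hG _ _ isSobolevH1_one t ht
  simpa using this

/-- A function with zero mean is bounded by its oscillation over the closed cube, that is by its
Lipschitz constant times the diameter `√d`. The folding brings an arbitrary point into the cube. -/
theorem abs_heat_le_of_integral_eq_zero (h : BddCont f B) (hf : FoldInvariant f) {t : ℝ}
    (ht : 0 < t) (h0 : ∫ x in unitCube d, heat t f x = 0) (x : EuclideanSpace ℝ (Fin d)) :
    |heat t f x| ≤ gaussMoment (EuclideanSpace ℝ (Fin d)) * √d * B * t ^ (-(1 / 2) : ℝ) := by
  have hM := gaussMoment_nonneg (E := EuclideanSpace ℝ (Fin d))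
  have hB := h.nonneg
  rw [← hf.heat t x]
  set y := cubeFold x
  have hu := heat_bddCont h t
  have hi : Integrable (heat t f) (volume.restrict (unitCube d)) :=
    Integrable.of_bound hu.cont.aestronglyMeasurable B (Eventually.of_forall hu.bound)
  have h1 : heat t f y = ∫ z in unitCube d, (heat t f y - heat t f z) := by
    rw [integral_sub (integrable_const _) hi, h0]
    simp
  rw [h1]
  have h2 := norm_setIntegral_le_of_norm_le_const (μ := volume) (s := unitCube d)
    (f := fun z => heat t f y - heat t f z)
    (C := gaussMoment (EuclideanSpace ℝ (Fin d)) * √d * B * t ^ (-(1 / 2) : ℝ))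
    (by rw [volume_unitCube]; simp) (fun z hz => ?_)
  · simpa [Measure.real, volume_unitCube] using h2
  · refine (abs_heat_sub_le h ht y z).trans ?_
    have h3 := norm_sub_le_of_mem_Icc (cubeFold_mem_Icc x) (unitCube_mem_Icc hz)
    calc _ ≤ gaussMoment (EuclideanSpace ℝ (Fin d)) * B * t ^ (-(1 / 2) : ℝ) * √d := by
          gcongr
      _ = _ := by ring

variable {H α : ℝ}

theorem rpow_half_le {t p : ℝ} (ht : 0 < t) (hp : -2 ≤ p) :
    (t / 2) ^ p ≤ 4 * t ^ p := by
  rw [Real.div_rpow ht.le (by norm_num), div_eq_mul_inv, ← Real.rpow_neg (by norm_num), mul_comm]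
  have h1 : (2 : ℝ) ^ (-p) ≤ 2 ^ (2 : ℝ) :=
    Real.rpow_le_rpow_of_exponent_le (by norm_num) (by linarith)
  norm_num at h1
  gcongr

/-- The preceding estimate is applied on two successive half steps, since the mean stays zero; each
contributes `t^(-1/2)` and, through `rpow_half_le`, a factor `4`. -/
theorem abs_heat_decay (h : BddCont f B) (hf : FoldInvariant f) (hα0 : 0 < α) (hα1 : α ≤ 1)
    (hH : 0 ≤ H) (hol : ∀ x y, |f x - f y| ≤ H * ‖x - y‖ ^ α)
    (h0 : ∫ x in unitCube d, f x = 0) {t : ℝ} (ht : 0 < t) (x : EuclideanSpace ℝ (Fin d)) :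
    |heat t f x| ≤
      16 * (gaussMoment (EuclideanSpace ℝ (Fin d)) * √d) ^ 2 * B * t ^ (-1 : ℝ) := by
  have hM := gaussMoment_nonneg (E := EuclideanSpace ℝ (Fin d))
  have hB := h.nonneg
  have ht2 : 0 < t / 2 := by positivity
  have hz : ∀ s, 0 ≤ s → ∫ x in unitCube d, heat s f x = 0 := fun s hs => by
    rw [integral_heat_eq h hf hα0 hα1 hH hol hs, h0]
  have h1 : BddCont (heat (t / 2) f) (gaussMoment (EuclideanSpace ℝ (Fin d)) * √d * B *
      (t / 2) ^ (-(1 / 2) : ℝ)) :=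
    ⟨(heat_bddCont h _).cont, abs_heat_le_of_integral_eq_zero h hf ht2 (hz _ ht2.le)⟩
  have h2 := heat_heat h ht2.le ht2.le
  rw [add_halves] at h2
  have h3 := abs_heat_le_of_integral_eq_zero h1 (hf.heat _) ht2 (by rw [h2]; exact hz t ht.le) x
  rw [h2] at h3
  refine h3.trans ?_
  have h4 := rpow_half_le ht (show -2 ≤ (-(1 / 2) : ℝ) by norm_num)
  have h5 : t ^ (-1 : ℝ) = t ^ (-(1 / 2) : ℝ) * t ^ (-(1 / 2) : ℝ) := by
    rw [← Real.rpow_add ht]; norm_num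
  set M := gaussMoment (EuclideanSpace ℝ (Fin d)) * √d
  have hM' : 0 ≤ M := by positivity
  rw [h5]
  calc M * (M * B * (t / 2) ^ (-(1 / 2) : ℝ)) * (t / 2) ^ (-(1 / 2) : ℝ)
      ≤ M * (M * B * (4 * t ^ (-(1 / 2) : ℝ))) * (4 * t ^ (-(1 / 2) : ℝ)) := by gcongr
    _ = _ := by ring

theorem heatGrad_add (h : BddCont f B) {s r : ℝ} (hs : 0 < s) (hr : 0 ≤ r)
    (x : EuclideanSpace ℝ (Fin d)) : heatGrad (s + r) f x = heatGrad s (heat r f) x := by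
  rw [← gradient_heat h (by positivity), ← gradient_heat (heat_bddCont h r) hs, heat_heat h hs.le hr]

/-- The gradient bound on one more half step adds another `t^(-1/2)`. The exponent `-3/2` is
integrable at infinity, which is enough: no spectral gap is needed. -/
theorem norm_heatGrad_decay (h : BddCont f B) (hf : FoldInvariant f) (hα0 : 0 < α) (hα1 : α ≤ 1)
    (hH : 0 ≤ H) (hol : ∀ x y, |f x - f y| ≤ H * ‖x - y‖ ^ α)
    (h0 : ∫ x in unitCube d, f x = 0) {t : ℝ} (ht : 0 < t) (x : EuclideanSpace ℝ (Fin d)) :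
    ‖heatGrad t f x‖ ≤ 256 * gaussMoment (EuclideanSpace ℝ (Fin d)) *
      (gaussMoment (EuclideanSpace ℝ (Fin d)) * √d) ^ 2 * B * t ^ (-(3 / 2) : ℝ) := by
  have hM := gaussMoment_nonneg (E := EuclideanSpace ℝ (Fin d))
  have hB := h.nonneg
  have ht2 : 0 < t / 2 := by positivity
  have h1 : BddCont (heat (t / 2) f) _ :=
    ⟨(heat_bddCont h _).cont, abs_heat_decay h hf hα0 hα1 hH hol h0 ht2⟩
  have h2 := norm_heatGrad_le h1 ht2 x
  rw [← heatGrad_add h ht2 ht2.le, add_halves] at h2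
  refine h2.trans ?_
  have h4 := rpow_half_le ht (show -2 ≤ (-(1 / 2) : ℝ) by norm_num)
  have h4' := rpow_half_le ht (show -2 ≤ (-1 : ℝ) by norm_num)
  have h5 : t ^ (-(3 / 2) : ℝ) = t ^ (-1 : ℝ) * t ^ (-(1 / 2) : ℝ) := by
    rw [← Real.rpow_add ht]; norm_num
  rw [h5]
  set M := gaussMoment (EuclideanSpace ℝ (Fin d))
  calc M * (16 * (M * √d) ^ 2 * B * (t / 2) ^ (-1 : ℝ)) * (t / 2) ^ (-(1 / 2) : ℝ)
      ≤ M * (16 * (M * √d) ^ 2 * B * (4 * t ^ (-1 : ℝ))) * (4 * t ^ (-(1 / 2) : ℝ)) := by gcongr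
    _ = _ := by ring

/-- The time weight `t ^ (α / 2 - 1)` for small times and `t ^ (-3 / 2)` for large times. -/
noncomputable def heatWeight (α t : ℝ) : ℝ :=
  if t ≤ 1 then t ^ (α / 2 - 1) else t ^ (-(3 / 2) : ℝ)

theorem heatWeight_nonneg (α : ℝ) {t : ℝ} (ht : 0 < t) : 0 ≤ heatWeight α t := by
  unfold heatWeight; split_ifs <;> positivity

/-- All three quantities share the weight of the second derivatives, the most singular one at small
times. The product of two gradients is included because it appears when `∇u / u` is differentiated;
it is quadratic in `ε`, and `ε ≤ 1` makes it linear. -/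
theorem exists_heatGrad_bounds (d : ℕ) (hα0 : 0 < α) (hα1 : α ≤ 1) :
    ∃ C : ℝ, 0 ≤ C ∧ ∀ (f : EuclideanSpace ℝ (Fin d) → ℝ) (ε : ℝ), BddCont f ε → ε ≤ 1 →
      FoldInvariant f → (∀ x y, |f x - f y| ≤ ε * ‖x - y‖ ^ α) → ∫ x in unitCube d, f x = 0 →
      ∀ t, 0 < t → ∀ x y, ‖heatGrad t f x‖ ≤ C * ε * heatWeight α t ∧
        ‖heatGrad t f x‖ * ‖heatGrad t f y‖ ≤ C * ε * heatWeight α t ∧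
        ‖heatGrad t f x - heatGrad t f y‖ ≤ C * ε * heatWeight α t * ‖x - y‖ := by
  set M := gaussMoment (EuclideanSpace ℝ (Fin d)) with hMdef
  have hM : 0 ≤ M := gaussMoment_nonneg (E := EuclideanSpace ℝ (Fin d))
  set D := 256 * M * (M * √d) ^ 2 with hD
  have hD0 : 0 ≤ D := by positivity
  -- The sum of the constants of the six cases: `M`, `M²`, `4M²` for `t ≤ 1` and `D`, `D²`, `4MD`
  -- for `t > 1`.
  refine ⟨M + M ^ 2 + 4 * M ^ 2 + D + D ^ 2 + 4 * M * D, by positivity, ?_⟩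
  intro f ε h hε1 hf hol h0 t ht x y
  have hε := h.nonneg
  set C := M + M ^ 2 + 4 * M ^ 2 + D + D ^ 2 + 4 * M * D with hC
  have ht2 : 0 < t / 2 := by positivity
  rw [heatWeight]
  split_ifs with ht1
  · have b1 : ∀ x, ‖heatGrad t f x‖ ≤ M * ε * t ^ ((α - 1) / 2) :=
      norm_heatGrad_le_of_holder h ht hα0 hα1 hε hol
    have b2 : ∀ x, ‖heatGrad (t / 2) f x‖ ≤ M * ε * (4 * t ^ ((α - 1) / 2)) := fun x =>
      (norm_heatGrad_le_of_holder h ht2 hα0 hα1 hε hol x).trans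
        (mul_le_mul_of_nonneg_left (rpow_half_le ht (by linarith)) (by positivity))
    have e1 : t ^ ((α - 1) / 2) ≤ t ^ (α / 2 - 1) :=
      Real.rpow_le_rpow_of_exponent_ge ht ht1 (by linarith)
    have e2 : t ^ ((α - 1) / 2) * t ^ ((α - 1) / 2) ≤ t ^ (α / 2 - 1) := by
      rw [← Real.rpow_add ht]
      exact Real.rpow_le_rpow_of_exponent_ge ht ht1 (by linarith)
    have e3 : t ^ ((α - 1) / 2) * t ^ (-(1 / 2) : ℝ) = t ^ (α / 2 - 1) := by
      rw [← Real.rpow_add ht]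
      congr 1
      ring
    have hw : 0 ≤ t ^ (α / 2 - 1) := by positivity
    refine ⟨?_, ?_, ?_⟩
    · calc ‖heatGrad t f x‖ ≤ M * ε * t ^ (α / 2 - 1) := (b1 x).trans (by gcongr)
        _ ≤ C * ε * t ^ (α / 2 - 1) := by
          gcongr
          rw [hC]
          nlinarith [sq_nonneg M, sq_nonneg D, mul_nonneg hM hD0]
    · calc ‖heatGrad t f x‖ * ‖heatGrad t f y‖
          ≤ (M * ε * t ^ ((α - 1) / 2)) * (M * ε * t ^ ((α - 1) / 2)) :=
            mul_le_mul (b1 x) (b1 y) (norm_nonneg _) (by positivity)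
        _ = M ^ 2 * (ε * ε) * (t ^ ((α - 1) / 2) * t ^ ((α - 1) / 2)) := by ring
        _ ≤ M ^ 2 * (ε * 1) * t ^ (α / 2 - 1) := by gcongr
        _ ≤ C * ε * t ^ (α / 2 - 1) := by
          rw [mul_one]
          gcongr
          rw [hC]
          nlinarith [sq_nonneg M, sq_nonneg D, mul_nonneg hM hD0]
    · refine (norm_heatGrad_sub_le h ht b2 x y).trans ?_
      refine mul_le_mul_of_nonneg_right ?_ (norm_nonneg _)
      calc M * (M * ε * (4 * t ^ ((α - 1) / 2))) * t ^ (-(1 / 2) : ℝ)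
          = 4 * M ^ 2 * ε * (t ^ ((α - 1) / 2) * t ^ (-(1 / 2) : ℝ)) := by ring
        _ ≤ C * ε * t ^ (α / 2 - 1) := by
          rw [e3]
          gcongr
          rw [hC]
          nlinarith [sq_nonneg M, sq_nonneg D, mul_nonneg hM hD0]
  · have ht1' : 1 ≤ t := by linarith
    have b1 : ∀ x, ‖heatGrad t f x‖ ≤ D * ε * t ^ (-(3 / 2) : ℝ) :=
      norm_heatGrad_decay h hf hα0 hα1 hε hol h0 ht
    have b2 : ∀ x, ‖heatGrad (t / 2) f x‖ ≤ D * ε * (4 * t ^ (-(3 / 2) : ℝ)) := fun x =>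
      (norm_heatGrad_decay h hf hα0 hα1 hε hol h0 ht2 x).trans
        (mul_le_mul_of_nonneg_left (rpow_half_le ht (by norm_num)) (by positivity))
    have e1 : ∀ p : ℝ, p ≤ 0 → t ^ p ≤ 1 := fun p hp => Real.rpow_le_one_of_one_le_of_nonpos ht1' hp
    have hw : 0 ≤ t ^ (-(3 / 2) : ℝ) := by positivity
    refine ⟨?_, ?_, ?_⟩
    · calc ‖heatGrad t f x‖ ≤ D * ε * t ^ (-(3 / 2) : ℝ) := b1 x
        _ ≤ C * ε * t ^ (-(3 / 2) : ℝ) := by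
          gcongr
          rw [hC]
          nlinarith [sq_nonneg M, sq_nonneg D, mul_nonneg hM hD0]
    · calc ‖heatGrad t f x‖ * ‖heatGrad t f y‖
          ≤ (D * ε * t ^ (-(3 / 2) : ℝ)) * (D * ε * t ^ (-(3 / 2) : ℝ)) :=
            mul_le_mul (b1 x) (b1 y) (norm_nonneg _) (by positivity)
        _ = D ^ 2 * (ε * ε) * (t ^ (-(3 / 2) : ℝ) * t ^ (-(3 / 2) : ℝ)) := by ring
        _ ≤ D ^ 2 * (ε * 1) * (t ^ (-(3 / 2) : ℝ) * 1) := by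
          gcongr
          exact e1 _ (by norm_num)
        _ = D ^ 2 * ε * t ^ (-(3 / 2) : ℝ) := by ring
        _ ≤ C * ε * t ^ (-(3 / 2) : ℝ) := by
          gcongr
          rw [hC]
          nlinarith [sq_nonneg M, sq_nonneg D, mul_nonneg hM hD0]
    · refine (norm_heatGrad_sub_le h ht b2 x y).trans ?_
      refine mul_le_mul_of_nonneg_right ?_ (norm_nonneg _)
      calc M * (D * ε * (4 * t ^ (-(3 / 2) : ℝ))) * t ^ (-(1 / 2) : ℝ)
          ≤ M * (D * ε * (4 * t ^ (-(3 / 2) : ℝ))) * 1 := by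
            gcongr
            exact e1 _ (by norm_num)
        _ = 4 * M * D * ε * t ^ (-(3 / 2) : ℝ) := by ring
        _ ≤ C * ε * t ^ (-(3 / 2) : ℝ) := by
          gcongr
          rw [hC]
          nlinarith [sq_nonneg M, sq_nonneg D, mul_nonneg hM hD0]

/-- The velocity field `-∇ log (1 + P_t f)`. -/
noncomputable def heatVelocity (f : EuclideanSpace ℝ (Fin d) → ℝ) (t : ℝ)
    (x : EuclideanSpace ℝ (Fin d)) : EuclideanSpace ℝ (Fin d) :=
  -((1 + heat t f x)⁻¹ • heatGrad t f x)

theorem half_le_one_add_heat (h : BddCont f B) (hB : B ≤ 1 / 2) (t : ℝ)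
    (x : EuclideanSpace ℝ (Fin d)) : 1 / 2 ≤ 1 + heat t f x := by
  have := (abs_le.1 ((heat_bddCont h t).bound x)).1
  linarith

theorem norm_heatVelocity_sub_le (h : BddCont f B) (hB : B ≤ 1 / 2) {t G L : ℝ} (ht : 0 < t)
    (hG : ∀ x y, ‖heatGrad t f x‖ * ‖heatGrad t f y‖ ≤ G)
    (hL : ∀ x y, ‖heatGrad t f x - heatGrad t f y‖ ≤ L * ‖x - y‖)
    (x y : EuclideanSpace ℝ (Fin d)) :
    ‖heatVelocity f t x - heatVelocity f t y‖ ≤ (2 * L + 4 * G) * ‖x - y‖ := by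
  have hG0 : 0 ≤ G := (mul_nonneg (norm_nonneg _) (norm_nonneg _)).trans (hG 0 0)
  have hu := half_le_one_add_heat h hB t
  set u := fun x => 1 + heat t f x with hudef
  have hux : ∀ x, 0 < u x := fun x => lt_of_lt_of_le (by norm_num) (hu x)
  have hi : ∀ x, (u x)⁻¹ ≤ 2 := fun x => by
    rw [inv_le_comm₀ (hux x) (by norm_num)]
    have := hu x
    norm_num at this ⊢
    exact this
  -- The norm of the gradient at `y` is kept as a constant factor inside the mean value inequality,
  -- so that the bound `G` on products is what controls the slope.
  have hus : ‖heatGrad t f y‖ * |heat t f x - heat t f y| ≤ G * ‖x - y‖ := by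
    have := Convex.norm_image_sub_le_of_norm_hasFDerivWithin_le
      (f := fun x => ‖heatGrad t f y‖ * heat t f x) (s := univ) (C := G)
      (fun z _ => ((hasFDerivAt_heat h ht z).const_mul _).hasFDerivWithinAt)
      (fun z _ => by
        rw [norm_smul, innerSL_apply_norm, norm_norm]; exact hG y z)
      convex_univ (mem_univ y) (mem_univ x)
    rw [← mul_sub, norm_mul, norm_norm] at this
    exact this
  have e : heatVelocity f t x - heatVelocity f t y =
      -((u x)⁻¹ • (heatGrad t f x - heatGrad t f y) +
        ((u x)⁻¹ - (u y)⁻¹) • heatGrad t f y) := by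
    simp only [heatVelocity, hudef, smul_sub, sub_smul]
    abel
  have e2 : (u x)⁻¹ - (u y)⁻¹ = (u x)⁻¹ * (u y)⁻¹ * -(heat t f x - heat t f y) := by
    have hx := (hux x).ne'
    have hy := (hux y).ne'
    rw [inv_sub_inv hx hy, div_eq_mul_inv, mul_inv]
    simp only [hudef]
    ring
  rw [e, norm_neg]
  refine (norm_add_le _ _).trans ?_
  rw [norm_smul, norm_smul, e2, norm_mul, norm_mul, norm_neg, norm_inv, norm_inv,
    Real.norm_of_nonneg (hux x).le, Real.norm_of_nonneg (hux y).le]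
  have i1 := inv_nonneg.2 (hux x).le
  have i2 := inv_nonneg.2 (hux y).le
  calc (u x)⁻¹ * ‖heatGrad t f x - heatGrad t f y‖ +
        (u x)⁻¹ * (u y)⁻¹ * ‖heat t f x - heat t f y‖ * ‖heatGrad t f y‖
      ≤ 2 * (L * ‖x - y‖) + 2 * 2 * (‖heatGrad t f y‖ * |heat t f x - heat t f y|) := by
        rw [mul_assoc _ ‖heat t f x - heat t f y‖, mul_comm ‖heat t f x - heat t f y‖]
        refine add_le_add (mul_le_mul (hi x) (hL x y) (norm_nonneg _) (by norm_num)) ?_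
        refine mul_le_mul_of_nonneg_right ?_ (by positivity)
        exact mul_le_mul (hi x) (hi y) i2 (by norm_num)
    _ ≤ 2 * (L * ‖x - y‖) + 2 * 2 * (G * ‖x - y‖) := by gcongr
    _ = _ := by ring

theorem exists_heatVelocity_bounds (d : ℕ) (hα0 : 0 < α) (hα1 : α ≤ 1) :
    ∃ C : ℝ, 0 ≤ C ∧ ∀ (f : EuclideanSpace ℝ (Fin d) → ℝ) (ε : ℝ), BddCont f ε → ε ≤ 1 / 2 →
      FoldInvariant f → (∀ x y, |f x - f y| ≤ ε * ‖x - y‖ ^ α) → ∫ x in unitCube d, f x = 0 →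
      ∀ t, 0 < t → ∀ x y, ‖heatVelocity f t x‖ ≤ C * ε * heatWeight α t ∧
        ‖heatVelocity f t x - heatVelocity f t y‖ ≤ C * ε * heatWeight α t * ‖x - y‖ := by
  obtain ⟨C, hC0, hC⟩ := exists_heatGrad_bounds d hα0 hα1
  -- The constant is `2 + 4`, from `norm_heatVelocity_sub_le` with `L` and `G` both equal to the
  -- common bound.
  refine ⟨6 * C, by positivity, ?_⟩
  intro f ε h hε hf hol h0 t ht x y
  have key := hC f ε h (by linarith) hf hol h0 t ht
  have hε0 := h.nonneg
  have hw := heatWeight_nonneg α ht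
  constructor
  · have hu := half_le_one_add_heat h hε t x
    have hux : 0 < 1 + heat t f x := by linarith
    have hi : (1 + heat t f x)⁻¹ ≤ 2 := by
      rw [inv_le_comm₀ hux (by norm_num)]
      norm_num at hu ⊢
      exact hu
    rw [heatVelocity, norm_neg, norm_smul, norm_inv, Real.norm_of_nonneg hux.le]
    calc _ ≤ 2 * (C * ε * heatWeight α t) :=
          mul_le_mul hi (key x y).1 (norm_nonneg _) (by norm_num)
      _ ≤ _ := by
        have : 0 ≤ C * ε * heatWeight α t := by positivity
        nlinarith
  · refine (norm_heatVelocity_sub_le h hε ht (fun x y => (key x y).2.1)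
      (fun x y => (key x y).2.2) x y).trans (le_of_eq ?_)
    ring

end Decay

/-! ### Flows of bounded Lipschitz fields -/

section Flow

variable {E : Type*} [NormedAddCommGroup E] [NormedSpace ℝ E]

/-- `Y a b x` is the position at time `b` of the solution of `y' = V(τ, y)` with `y(a) = x`, for
initial times `a ∈ [0,1]`. -/
structure IsODEFlow (V : ℝ → E → E) (Y : ℝ → ℝ → E → E) : Prop where
  init : ∀ a ∈ Icc (0 : ℝ) 1, ∀ x, Y a a x = x
  deriv : ∀ a ∈ Icc (0 : ℝ) 1, ∀ x, ∀ b ∈ Ioo (-1 : ℝ) 2,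
    HasDerivAt (fun b => Y a b x) (V b (Y a b x)) b

theorem exists_isODEFlow [CompleteSpace E] {V : ℝ → E → E} {K M : ℝ≥0}
    (hL : ∀ τ, LipschitzWith K (V τ)) (hc : ∀ x, Continuous fun τ => V τ x)
    (hM : ∀ τ x, ‖V τ x‖ ≤ M) : ∃ Y, IsODEFlow V Y := by
  have key : ∀ (a : ℝ) (x : E), ∃ y : ℝ → E, a ∈ Icc (0 : ℝ) 1 → y a = x ∧
      ∀ b ∈ Ioo (-1 : ℝ) 2, HasDerivAt y (V b (y b)) b := by
    intro a x
    by_cases ha : a ∈ Icc (0 : ℝ) 1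
    · have ha' : a ∈ Icc (-1 : ℝ) 2 := ⟨by linarith [ha.1], by linarith [ha.2]⟩
      -- The interval `[-1,2]` leaves room around `[0,1]`, so that derivatives at `0` and `1` are
      -- two-sided. No endpoint is further than `2` from `a`, whence the radius `2M`.
      have hP : IsPicardLindelof V (⟨a, ha'⟩ : Icc (-1 : ℝ) 2) x (M * 2) 0 M K := by
        refine ⟨fun t _ => (hL t).lipschitzOnWith, fun x _ => (hc x).continuousOn,
          fun t _ x _ => hM t x, ?_⟩
        simp only [NNReal.coe_mul, NNReal.coe_zero, sub_zero, NNReal.coe_ofNat]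
        refine mul_le_mul_of_nonneg_left (max_le ?_ ?_) M.2
        · linarith [ha.1]
        · linarith [ha.2]
      obtain ⟨y, hy0, hy⟩ := hP.exists_eq_forall_mem_Icc_hasDerivWithinAt
        (x := x) (by simp)
      exact ⟨y, fun _ => ⟨hy0, fun b hb => (hy b ⟨hb.1.le, hb.2.le⟩).hasDerivAt
        (Icc_mem_nhds hb.1 hb.2)⟩⟩
    · exact ⟨fun _ => x, fun h => absurd h ha⟩
  choose Y hY using key
  exact ⟨fun a b x => Y a x b, fun a ha x => (hY a x ha).1, fun a ha x => (hY a x ha).2⟩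

namespace IsODEFlow

variable {V : ℝ → E → E} {Y : ℝ → ℝ → E → E} {K : ℝ≥0} {a b c : ℝ}

theorem Icc_subset_Ioo_time : Icc (0 : ℝ) 1 ⊆ Ioo (-1 : ℝ) 2 := fun b hb =>
  ⟨by linarith [hb.1], by linarith [hb.2]⟩

theorem eq_of_hasDerivAt (hY : IsODEFlow V Y) (hL : ∀ τ, LipschitzWith K (V τ))
    (ha : a ∈ Icc (0 : ℝ) 1) {g : ℝ → E}
    (hg : ∀ b ∈ Ioo (-1 : ℝ) 2, HasDerivAt g (V b (g b)) b) (hb : b ∈ Icc (0 : ℝ) 1) :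
    g b = Y a b (g a) := by
  have hs : ∀ {t}, t ∈ Icc (-1 / 2 : ℝ) (3 / 2) → t ∈ Ioo (-1 : ℝ) 2 := fun ht =>
    ⟨by linarith [ht.1], by linarith [ht.2]⟩
  have := ODE_solution_unique_of_mem_Icc (v := V) (s := fun _ => univ) (K := K)
    (a := -1 / 2) (b := 3 / 2) (t₀ := a) (f := g) (g := fun b => Y a b (g a))
    (fun t _ => (hL t).lipschitzOnWith) ⟨by linarith [ha.1], by linarith [ha.2]⟩
    (fun t ht => (hg t (hs ht)).continuousAt.continuousWithinAt)
    (fun t ht => hg t (hs (Ioo_subset_Icc_self ht))) (fun _ _ => mem_univ _)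
    (fun t ht => (hY.deriv a ha _ t (hs ht)).continuousAt.continuousWithinAt)
    (fun t ht => hY.deriv a ha _ t (hs (Ioo_subset_Icc_self ht))) (fun _ _ => mem_univ _)
    (hY.init a ha _).symm
  exact this ⟨by linarith [hb.1], by linarith [hb.2]⟩

theorem comp (hY : IsODEFlow V Y) (hL : ∀ τ, LipschitzWith K (V τ)) (ha : a ∈ Icc (0 : ℝ) 1)
    (hb : b ∈ Icc (0 : ℝ) 1) (hc : c ∈ Icc (0 : ℝ) 1) (x : E) :
    Y b c (Y a b x) = Y a c x :=
  (hY.eq_of_hasDerivAt hL hb (hY.deriv a ha x) hc).symm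

theorem dist_le_of_le (hY : IsODEFlow V Y) (hL : ∀ τ, LipschitzWith K (V τ))
    (ha : a ∈ Icc (0 : ℝ) 1) (hb : b ∈ Icc (0 : ℝ) 1) (hab : a ≤ b) (x y : E) :
    dist (Y a b x) (Y a b y) ≤ dist x y * Real.exp (K * (b - a)) := by
  have hI : Icc a b ⊆ Ioo (-1 : ℝ) 2 := fun t ht =>
    Icc_subset_Ioo_time ⟨ha.1.trans ht.1, ht.2.trans hb.2⟩
  refine dist_le_of_trajectories_ODE (v := V) (f := fun b => Y a b x) (g := fun b => Y a b y) hL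
    (fun t ht => (hY.deriv a ha x t (hI ht)).continuousAt.continuousWithinAt)
    (fun t ht => (hY.deriv a ha x t (hI (Ico_subset_Icc_self ht))).hasDerivWithinAt)
    (fun t ht => (hY.deriv a ha y t (hI ht)).continuousAt.continuousWithinAt)
    (fun t ht => (hY.deriv a ha y t (hI (Ico_subset_Icc_self ht))).hasDerivWithinAt)
    ?_ b ⟨hab, le_rfl⟩
  rw [hY.init a ha, hY.init a ha]

/-- Gronwall's inequality after time reversal. This is what bounds the inverse of the transport map.
-/
theorem dist_le_of_ge (hY : IsODEFlow V Y) (hL : ∀ τ, LipschitzWith K (V τ))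
    (ha : a ∈ Icc (0 : ℝ) 1) (hb : b ∈ Icc (0 : ℝ) 1) (hab : b ≤ a) (x y : E) :
    dist (Y a b x) (Y a b y) ≤ dist x y * Real.exp (K * (a - b)) := by
  have hI : ∀ t ∈ Icc (-a) (-b), -t ∈ Ioo (-1 : ℝ) 2 := fun t ht =>
    Icc_subset_Ioo_time ⟨by linarith [ht.2, hb.1], by linarith [ht.1, ha.2]⟩
  have hd : ∀ x, ∀ t ∈ Icc (-a) (-b),
      HasDerivAt (fun s => Y a (-s) x) (-V (-t) (Y a (-t) x)) t := by
    intro x t ht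
    have := (hY.deriv a ha x (-t) (hI t ht)).scomp t (hasDerivAt_neg t)
    rw [neg_one_smul] at this
    exact this
  have := dist_le_of_trajectories_ODE (v := fun s x => -V (-s) x) (f := fun s => Y a (-s) x)
    (g := fun s => Y a (-s) y) (K := K) (a := -a) (b := -b) (δ := dist x y)
    (fun t => (hL (-t)).neg)
    (fun t ht => (hd x t ht).continuousAt.continuousWithinAt)
    (fun t ht => (hd x t (Ico_subset_Icc_self ht)).hasDerivWithinAt)
    (fun t ht => (hd y t ht).continuousAt.continuousWithinAt)
    (fun t ht => (hd y t (Ico_subset_Icc_self ht)).hasDerivWithinAt)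
    (by simp only [neg_neg]; rw [hY.init a ha, hY.init a ha]) (-b) ⟨by linarith, le_rfl⟩
  simp only [neg_neg] at this
  rwa [show -b - -a = a - b by ring] at this

theorem dist_le (hY : IsODEFlow V Y) (hL : ∀ τ, LipschitzWith K (V τ))
    (ha : a ∈ Icc (0 : ℝ) 1) (hb : b ∈ Icc (0 : ℝ) 1) (x y : E) :
    dist (Y a b x) (Y a b y) ≤ Real.exp K * dist x y := by
  have hK := K.2
  have h : ∀ s : ℝ, s ≤ 1 → Real.exp (K * s) ≤ Real.exp K := fun s hs =>
    Real.exp_le_exp.2 (by nlinarith [NNReal.coe_nonneg K])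
  rw [mul_comm]
  rcases le_total a b with hab | hab
  · exact (hY.dist_le_of_le hL ha hb hab x y).trans
      (mul_le_mul_of_nonneg_left (h _ (by linarith [ha.1, hb.2])) dist_nonneg)
  · exact (hY.dist_le_of_ge hL ha hb hab x y).trans
      (mul_le_mul_of_nonneg_left (h _ (by linarith [hb.1, ha.2])) dist_nonneg)

theorem lipschitzWith (hY : IsODEFlow V Y) (hL : ∀ τ, LipschitzWith K (V τ))
    (ha : a ∈ Icc (0 : ℝ) 1) (hb : b ∈ Icc (0 : ℝ) 1) :
    LipschitzWith (Real.exp K).toNNReal (Y a b) :=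
  LipschitzWith.of_dist_le_mul fun x y => by
    rw [Real.coe_toNNReal _ (Real.exp_pos _).le]
    exact hY.dist_le hL ha hb x y

theorem norm_sub_le (hY : IsODEFlow V Y) {M : ℝ} (hM : ∀ τ x, ‖V τ x‖ ≤ M)
    (ha : a ∈ Icc (0 : ℝ) 1) (hb : b ∈ Icc (0 : ℝ) 1) (hc : c ∈ Icc (0 : ℝ) 1) (x : E) :
    ‖Y a b x - Y a c x‖ ≤ M * |b - c| :=
  Convex.norm_image_sub_le_of_norm_hasDerivWithin_le (f := fun b => Y a b x)
    (s := Icc (0 : ℝ) 1)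
    (fun t ht => (hY.deriv a ha x t (Icc_subset_Ioo_time ht)).hasDerivWithinAt)
    (fun _ _ => hM _ _) (convex_Icc _ _) hc hb

theorem norm_sub_self_le (hY : IsODEFlow V Y) {M : ℝ} (hM : ∀ τ x, ‖V τ x‖ ≤ M)
    (ha : a ∈ Icc (0 : ℝ) 1) (hb : b ∈ Icc (0 : ℝ) 1) (x : E) :
    ‖Y a b x - x‖ ≤ M * |b - a| := by
  have := hY.norm_sub_le hM ha hb ha x
  rwa [hY.init a ha] at this

/-- Continuity of the flow with respect to the initial time. -/
theorem dist_init_le (hY : IsODEFlow V Y) (hL : ∀ τ, LipschitzWith K (V τ)) {M : ℝ}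
    (hM : ∀ τ x, ‖V τ x‖ ≤ M) (ha : a ∈ Icc (0 : ℝ) 1) (hb : b ∈ Icc (0 : ℝ) 1)
    (hc : c ∈ Icc (0 : ℝ) 1) (x : E) :
    dist (Y a c x) (Y b c x) ≤ Real.exp K * (M * |b - a|) := by
  rw [← hY.comp hL ha hb hc x]
  refine (hY.dist_le hL hb hc _ _).trans ?_
  rw [dist_eq_norm]
  exact mul_le_mul_of_nonneg_left (hY.norm_sub_self_le hM ha hb x) (Real.exp_pos _).le

/-- A symmetry of the field maps trajectories to trajectories, and trajectories are unique. -/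
theorem equivariant (hY : IsODEFlow V Y) (hL : ∀ τ, LipschitzWith K (V τ)) (e : E →L[ℝ] E) (v : E)
    (he : ∀ τ x, V τ (e x + v) = e (V τ x)) (ha : a ∈ Icc (0 : ℝ) 1) (hb : b ∈ Icc (0 : ℝ) 1)
    (x : E) : Y a b (e x + v) = e (Y a b x) + v := by
  have := hY.eq_of_hasDerivAt hL ha (g := fun b => e (Y a b x) + v) (fun t ht => by
    rw [he]
    exact (e.hasFDerivAt.comp_hasDerivAt t (hY.deriv a ha x t ht)).add_const v) hb
  simp only [hY.init a ha] at this
  exact this.symm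

end IsODEFlow

end Flow

/-! ### The determinant near the identity -/

section Determinant

variable {E : Type*} [NormedAddCommGroup E] [NormedSpace ℝ E] [FiniteDimensional ℝ E]

theorem det_clm_eq_matrix_det (A : E →L[ℝ] E) :
    A.det = (LinearMap.toMatrix (Module.finBasis ℝ E) (Module.finBasis ℝ E)
      (A : E →ₗ[ℝ] E)).det :=
  (LinearMap.det_toMatrix (Module.finBasis ℝ E) (A : E →ₗ[ℝ] E)).symm

/-- In a basis, `det (1 + h A)` is a polynomial in `h` starting with `1 + h tr A`; the remainder is
`h²` times a polynomial. -/
theorem hasDerivAt_det_one_add_smul (A : E →L[ℝ] E) :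
    HasDerivAt (fun h : ℝ => (1 + h • A).det) (LinearMap.trace ℝ E (A : E →ₗ[ℝ] E)) 0 := by
  set M := LinearMap.toMatrix (Module.finBasis ℝ E) (Module.finBasis ℝ E) (A : E →ₗ[ℝ] E) with hM
  have h1 : ∀ h : ℝ, (1 + h • A).det = 1 + M.trace * h +
      ((1 + (Polynomial.X : Polynomial ℝ) • M.map Polynomial.C).det.divX.divX).eval h * h ^ 2 := by
    intro h
    rw [← Matrix.det_one_add_smul, det_clm_eq_matrix_det]
    congr 1
    simp [hM, LinearMap.toMatrix_one]
  simp_rw [h1]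
  rw [LinearMap.trace_eq_matrix_trace ℝ (Module.finBasis ℝ E), ← hM]
  set p := (1 + (Polynomial.X : Polynomial ℝ) • M.map Polynomial.C).det.divX.divX
  have h2 := (((hasDerivAt_id (0 : ℝ)).const_mul M.trace).const_add 1).add
    ((p.hasDerivAt 0).mul ((hasDerivAt_id (0 : ℝ)).pow 2))
  refine h2.congr_deriv ?_
  simp

theorem differentiable_det : Differentiable ℝ (fun A : E →L[ℝ] E => A.det) := by
  have h : (fun A : E →L[ℝ] E => A.det) = fun A => ∑ σ : Equiv.Perm (Fin (Module.finrank ℝ E)),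
      Equiv.Perm.sign σ • ∏ i, (Module.finBasis ℝ E).equivFunL
        (A (Module.finBasis ℝ E i)) (σ i) := by
    ext A
    rw [det_clm_eq_matrix_det, Matrix.det_apply]
    simp [LinearMap.toMatrix_apply]
  rw [h]
  refine Differentiable.fun_sum fun σ _ => Differentiable.const_smul ?_ _
  refine (contDiff_prod (n := 1) (𝕜 := ℝ) fun i _ => ?_).differentiable (by simp)
  fun_prop

theorem exists_det_one_add_bound :
    ∃ D > 0, ∃ δ > 0, ∀ A : E →L[ℝ] E, ‖A‖ ≤ δ → |(1 + A).det - 1| ≤ D * ‖A‖ := by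
  have h1 : HasFDerivAt (fun A : E →L[ℝ] E => (1 + A).det) _ 0 :=
    ((differentiable_det (E := E)).comp (g := fun A : E →L[ℝ] E => A.det)
      (f := fun A : E →L[ℝ] E => 1 + A) (by fun_prop) 0).hasFDerivAt
  obtain ⟨D, hD, hb⟩ := h1.isBigO_sub.exists_pos
  rw [Asymptotics.isBigOWith_iff] at hb
  obtain ⟨δ, hδ, hb⟩ := Metric.eventually_nhds_iff.1 hb
  refine ⟨D, hD, δ / 2, by positivity, fun A hA => ?_⟩
  have := hb (y := A) (by rw [dist_zero_right]; linarith)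
  have h3 : (1 : E →L[ℝ] E).det = 1 := by
    rw [ContinuousLinearMap.det]
    exact LinearMap.det_id
  rw [add_zero, sub_zero, h3] at this
  exact this

end Determinant

/-! ### Change of variables along one Euler step -/

section EulerMap

variable {E : Type*} [NormedAddCommGroup E] [NormedSpace ℝ E]

/-- A perturbation of the identity by a strict contraction: solving `x + h v(x) = y` is a fixed
point problem for `x ↦ y - h v(x)`. -/
theorem bijective_add_smul_lipschitz [CompleteSpace E] {v : E → E} {K : ℝ≥0}
    (hv : LipschitzWith K v) {h : ℝ} (h0 : 0 ≤ h) (hK : h * K < 1) :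
    Function.Bijective (fun x => x + h • v x) := by
  have hl : LipschitzWith (h.toNNReal * K) (fun x => h • v x) :=
    LipschitzWith.of_dist_le_mul fun x y => by
      rw [dist_smul₀, Real.norm_of_nonneg h0, NNReal.coe_mul, Real.coe_toNNReal _ h0, mul_assoc]
      exact mul_le_mul_of_nonneg_left (hv.dist_le_mul x y) h0
  have hlt : h.toNNReal * K < 1 := by
    rw [← NNReal.coe_lt_coe, NNReal.coe_mul, Real.coe_toNNReal _ h0]
    exact hK
  constructor
  · intro x y hxy
    have h1 : x - y = h • v y - h • v x := by
      simp only at hxy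
      rw [sub_eq_sub_iff_add_eq_add, hxy, add_comm]
    have h2 := hl.dist_le_mul y x
    rw [dist_eq_norm, dist_eq_norm, ← h1, norm_sub_rev y x] at h2
    by_contra hne
    have h3 : 0 < ‖x - y‖ := norm_pos_iff.2 (sub_ne_zero.2 hne)
    have h4 : ((h.toNNReal * K : ℝ≥0) : ℝ) < 1 := by exact_mod_cast hlt
    nlinarith
  · intro y
    have hc : ContractingWith (h.toNNReal * K) (fun x => y - h • v x) := by
      refine ⟨hlt, LipschitzWith.of_dist_le_mul fun a b => ?_⟩
      rw [dist_sub_left]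
      exact hl.dist_le_mul a b
    refine ⟨hc.fixedPoint _, ?_⟩
    have := hc.fixedPoint_isFixedPt
    rw [Function.IsFixedPt] at this
    exact (sub_eq_iff_eq_add.1 this).symm

variable [FiniteDimensional ℝ E] [MeasurableSpace E] [BorelSpace E] (μ : Measure E)
  [μ.IsAddHaarMeasure]

theorem integral_comp_add_smul {v : E → E} {v' : E → E →L[ℝ] E} {K : ℝ≥0}
    (hv : LipschitzWith K v) (hv' : ∀ x, HasFDerivAt v (v' x) x) {h : ℝ} (h0 : 0 ≤ h)
    (hK : h * K < 1) {g : E → ℝ} (hg : Integrable g μ) :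
    Integrable (fun x => |(1 + h • v' x).det| * g (x + h • v x)) μ ∧
      ∫ x, |(1 + h • v' x).det| * g (x + h • v x) ∂μ = ∫ y, g y ∂μ := by
  have hb := bijective_add_smul_lipschitz hv h0 hK
  have hd : ∀ x ∈ (univ : Set E),
      HasFDerivWithinAt (fun x => x + h • v x) (1 + h • v' x) univ x := fun x _ =>
    ((hasFDerivAt_id x).add ((hv' x).const_smul h)).hasFDerivWithinAt
  constructor
  · have := integrableOn_image_iff_integrableOn_abs_det_fderiv_smul μ MeasurableSet.univ hd
      hb.injective.injOn g
    rw [image_univ, hb.surjective.range_eq, integrableOn_univ, integrableOn_univ] at this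
    exact this.1 hg
  · have := integral_image_eq_integral_abs_det_fderiv_smul μ MeasurableSet.univ hd
      hb.injective.injOn g
    rw [image_univ, hb.surjective.range_eq, setIntegral_univ, setIntegral_univ] at this
    exact this.symm

end EulerMap

/-! ### The continuity equation along one Euler step -/

section Transport

variable {E : Type*} [NormedAddCommGroup E] [NormedSpace ℝ E]

/-- A bounded density `r` and a velocity field `V`, differentiable for times in `(0,1)`, which solve
the continuity equation `∂ r + div (r V) = 0`. -/
structure IsContinuitySolution (V : ℝ → E → E) (V' : ℝ → E → E →L[ℝ] E) (r : ℝ → E → ℝ)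
    (Dr : ℝ → E → E →L[ℝ] ℝ) (r' : ℝ → E → ℝ) (B : ℝ) : Prop where
  cont : ContinuousOn (fun p : ℝ × E => r p.1 p.2) (Icc 0 1 ×ˢ univ)
  bound : ∀ τ ∈ Icc (0 : ℝ) 1, ∀ x, |r τ x| ≤ B
  deriv_velocity : ∀ τ ∈ Ioo (0 : ℝ) 1, ∀ x, HasFDerivAt (V τ) (V' τ x) x
  deriv_space : ∀ τ ∈ Ioo (0 : ℝ) 1, ∀ x, HasFDerivAt (r τ) (Dr τ x) x
  bound_space : ∀ τ ∈ Ioo (0 : ℝ) 1, ∃ L, ∀ x, ‖Dr τ x‖ ≤ L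
  deriv_time : ∀ τ ∈ Ioo (0 : ℝ) 1, ∀ x, HasDerivAt (fun τ => r τ x) (r' τ x) τ
  cont_time : ContinuousOn (fun p : ℝ × E => r' p.1 p.2) (Ioo 0 1 ×ˢ univ)
  bound_time : ∀ τ ∈ Ioo (0 : ℝ) 1, ∃ A, ∀ᶠ σ in 𝓝 τ, ∀ x, |r' σ x| ≤ A
  eqn : ∀ τ ∈ Ioo (0 : ℝ) 1, ∀ x,
    r' τ x + Dr τ x (V τ x) + r τ x * LinearMap.trace ℝ E (V' τ x : E →ₗ[ℝ] E) = 0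

namespace IsContinuitySolution

variable {V : ℝ → E → E} {V' : ℝ → E → E →L[ℝ] E} {r : ℝ → E → ℝ}
    {Dr : ℝ → E → E →L[ℝ] ℝ} {r' : ℝ → E → ℝ} {B M : ℝ} {K : ℝ≥0} {τ : ℝ}

theorem continuous_apply (hr : IsContinuitySolution V V' r Dr r' B) (hτ : τ ∈ Icc (0 : ℝ) 1) :
    Continuous (r τ) :=
  hr.cont.comp_continuous (f := fun x => (τ, x)) (by fun_prop) fun _ => ⟨hτ, mem_univ _⟩

/-- The density transported by one step of the Euler scheme is correct to first order. -/
theorem tendsto_euler [FiniteDimensional ℝ E] (hr : IsContinuitySolution V V' r Dr r' B)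
    (hτ : τ ∈ Ioo (0 : ℝ) 1) (x : E) :
    Tendsto (fun h : ℝ => h⁻¹ * (|(1 + h • V' τ x).det| * r (τ + h) (x + h • V τ x) - r τ x))
      (𝓝[>] 0) (𝓝 0) := by
  have hdet := hasDerivAt_det_one_add_smul (V' τ x)
  have hdet_one : (1 : E →L[ℝ] E).det = 1 := by
    rw [ContinuousLinearMap.det]
    exact LinearMap.det_id
  have hdet1 : (1 + (0 : ℝ) • V' τ x).det = 1 := by
    rw [zero_smul, add_zero, hdet_one]
  have hdetlim : Tendsto (fun h : ℝ => (1 + h • V' τ x).det) (𝓝[>] 0) (𝓝 1) := by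
    have := hdet.continuousAt.tendsto
    rw [hdet1] at this
    exact this.mono_left nhdsWithin_le_nhds
  have hpath : HasDerivAt (fun h : ℝ => x + h • V τ x) (V τ x) 0 := by
    simpa using ((hasDerivAt_id (0 : ℝ)).smul_const (V τ x)).const_add x
  have hspace : HasDerivAt (fun h : ℝ => (1 + h • V' τ x).det * r τ (x + h • V τ x))
      (LinearMap.trace ℝ E (V' τ x : E →ₗ[ℝ] E) * r τ x + Dr τ x (V τ x)) 0 := by
    have h1 : HasFDerivAt (r τ) (Dr τ x) (x + (0 : ℝ) • V τ x) := by
      simpa using hr.deriv_space τ hτ x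
    have h2 := hdet.mul (h1.comp_hasDerivAt (0 : ℝ) hpath)
    rw [hdet1, one_mul] at h2
    simp only [Function.comp_apply, zero_smul, add_zero] at h2
    exact h2
  have hA : Tendsto (fun h : ℝ => h⁻¹ * ((1 + h • V' τ x).det * r τ (x + h • V τ x) - r τ x))
      (𝓝[>] 0) (𝓝 (LinearMap.trace ℝ E (V' τ x : E →ₗ[ℝ] E) * r τ x + Dr τ x (V τ x))) := by
    have := hspace.tendsto_slope_zero_right
    simpa [hdet_one] using this
  have hC : Tendsto (fun h : ℝ => h⁻¹ * (r (τ + h) (x + h • V τ x) - r τ (x + h • V τ x)))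
      (𝓝[>] 0) (𝓝 (r' τ x)) := by
    have hcont : ContinuousAt (fun p : ℝ × E => r' p.1 p.2) (τ, x) :=
      hr.cont_time.continuousAt ((isOpen_Ioo.prod isOpen_univ).mem_nhds ⟨hτ, mem_univ _⟩)
    rw [Metric.tendsto_nhds]
    intro η hη
    obtain ⟨δ, hδ, hball⟩ := Metric.eventually_nhds_iff.1
      (Metric.tendsto_nhds.1 hcont (η / 2) (by positivity))
    have e1 : ∀ᶠ h : ℝ in 𝓝[>] 0, h < min δ (1 - τ) :=
      (gt_mem_nhds (lt_min hδ (sub_pos.2 hτ.2))).filter_mono nhdsWithin_le_nhds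
    have e2 : ∀ᶠ h : ℝ in 𝓝[>] 0, dist (x + h • V τ x) x < δ := by
      have : Tendsto (fun h : ℝ => x + h • V τ x) (𝓝[>] 0) (𝓝 x) := by
        have := hpath.continuousAt.tendsto
        rw [zero_smul, add_zero] at this
        exact this.mono_left nhdsWithin_le_nhds
      exact Metric.tendsto_nhds.1 this δ hδ
    filter_upwards [e1, e2, self_mem_nhdsWithin] with h h1 h2 h0
    have h0' : (0 : ℝ) < h := h0
    set y := x + h • V τ x
    have hI : ∀ c ∈ Icc τ (τ + h), c ∈ Ioo (0 : ℝ) 1 := fun c hc =>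
      ⟨hτ.1.trans_le hc.1, hc.2.trans_lt (by linarith [h1.trans_le (min_le_right _ _)])⟩
    -- The base point `y` moves with `h`, so differentiability in time at `x` alone is not enough.
    -- Subtracting the linear term `c * r' τ x` leaves a function of `c` with small derivative, by
    -- joint continuity of `r'`.
    have hmvt := Convex.norm_image_sub_le_of_norm_hasDerivWithin_le
      (f := fun c => r c y - c * r' τ x) (s := Icc τ (τ + h)) (C := η / 2)
      (f' := fun c => r' c y - 1 * r' τ x)
      (fun c hc => ((hr.deriv_time c (hI c hc) y).sub
        ((hasDerivAt_id c).mul_const _)).hasDerivWithinAt)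
      (fun c hc => by
        have : dist (r' c y) (r' τ x) < η / 2 := hball (y := (c, y)) (by
          rw [Prod.dist_eq]
          refine max_lt ?_ h2
          rw [Real.dist_eq, abs_of_nonneg (by linarith [hc.1])]
          linarith [hc.2, h1.trans_le (min_le_left _ _)])
        rw [one_mul]
        exact this.le) (convex_Icc _ _) (left_mem_Icc.2 (by linarith))
      (right_mem_Icc.2 (by linarith))
    have h3 : h⁻¹ * (r (τ + h) y - r τ y) - r' τ x =
        h⁻¹ * (r (τ + h) y - (τ + h) * r' τ x - (r τ y - τ * r' τ x)) := by
      field_simp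
      ring
    rw [Real.dist_eq, h3, abs_mul, abs_of_pos (inv_pos.2 h0')]
    rw [add_sub_cancel_left, Real.norm_eq_abs, Real.norm_of_nonneg h0'.le] at hmvt
    calc _ ≤ h⁻¹ * (η / 2 * h) := by gcongr
      _ = η / 2 := by field_simp
      _ < η := by linarith
  have hsum := (hdetlim.mul hC).add hA
  have hz : 1 * r' τ x + (LinearMap.trace ℝ E (V' τ x : E →ₗ[ℝ] E) * r τ x + Dr τ x (V τ x)) =
      0 := by
    rw [← hr.eqn τ hτ x]; ring
  rw [hz] at hsum
  refine hsum.congr' ?_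
  filter_upwards [hdetlim.eventually (lt_mem_nhds zero_lt_one)] with h hh
  rw [abs_of_pos hh]
  ring

/-- The error of one step of the Euler scheme is uniformly bounded to first order. -/
theorem exists_euler_bound [FiniteDimensional ℝ E] (hr : IsContinuitySolution V V' r Dr r' B)
    (hL : ∀ τ, LipschitzWith K (V τ)) (hM : ∀ τ x, ‖V τ x‖ ≤ M) (hτ : τ ∈ Ioo (0 : ℝ) 1) :
    ∃ C, 0 ≤ C ∧ ∀ᶠ h : ℝ in 𝓝[>] 0, ∀ x,
      |(|(1 + h • V' τ x).det| * r (τ + h) (x + h • V τ x) - r τ x)| ≤ C * h := by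
  obtain ⟨D, hD, δ, hδ, hdet⟩ := exists_det_one_add_bound (E := E)
  obtain ⟨L, hLr⟩ := hr.bound_space τ hτ
  obtain ⟨A, hA⟩ := hr.bound_time τ hτ
  obtain ⟨δ', hδ', hA⟩ := Metric.eventually_nhds_iff.1 hA
  have hM0 : 0 ≤ M := (norm_nonneg _).trans (hM 0 0)
  have hL0 : 0 ≤ L := (norm_nonneg _).trans (hLr 0)
  have hB0 : 0 ≤ B := (abs_nonneg _).trans (hr.bound 0 ⟨le_rfl, zero_le_one⟩ 0)
  have hA0 : 0 ≤ A := (abs_nonneg _).trans (hA (y := τ) (by simpa) 0)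
  refine ⟨D * K * B + A + L * M, by positivity, ?_⟩
  have e1 : ∀ᶠ h : ℝ in 𝓝[>] 0, h < min δ' (1 - τ) :=
    (gt_mem_nhds (lt_min hδ' (sub_pos.2 hτ.2))).filter_mono nhdsWithin_le_nhds
  have e2 : ∀ᶠ h : ℝ in 𝓝[>] 0, h * K < δ := by
    have : Tendsto (fun h : ℝ => h * K) (𝓝 0) (𝓝 (0 * K)) := by
      exact (continuous_id.mul continuous_const).tendsto 0
    rw [zero_mul] at this
    exact (this.eventually (gt_mem_nhds hδ)).filter_mono nhdsWithin_le_nhds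
  filter_upwards [e1, e2, self_mem_nhdsWithin] with h h1 h2 h0 x
  have h0' : (0 : ℝ) < h := h0
  set y := x + h • V τ x with hy
  have hI : ∀ c ∈ Icc τ (τ + h), c ∈ Ioo (0 : ℝ) 1 := fun c hc =>
    ⟨hτ.1.trans_le hc.1, hc.2.trans_lt (by linarith [h1.trans_le (min_le_right _ _)])⟩
  have hV' : ‖h • V' τ x‖ ≤ h * K := by
    rw [norm_smul, Real.norm_of_nonneg h0'.le]
    exact mul_le_mul_of_nonneg_left
      ((hr.deriv_velocity τ hτ x).le_of_lipschitz (hL τ)) h0'.le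
  have d1 : |(|(1 + h • V' τ x).det| - 1)| ≤ D * (h * K) := by
    have := abs_abs_sub_abs_le (1 + h • V' τ x).det 1
    rw [abs_one] at this
    exact this.trans ((hdet _ (hV'.trans h2.le)).trans (by gcongr))
  have hσ : τ + h ∈ Ioo (0 : ℝ) 1 := hI _ (right_mem_Icc.2 (by linarith))
  have d2 : |r (τ + h) y - r τ y| ≤ A * h := by
    have hmvt := Convex.norm_image_sub_le_of_norm_hasDerivWithin_le
      (f := fun c => r c y) (s := Icc τ (τ + h)) (C := A)
      (fun c hc => (hr.deriv_time c (hI c hc) y).hasDerivWithinAt)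
      (fun c hc => hA (by
          rw [Real.dist_eq, abs_of_nonneg (by linarith [hc.1])]
          linarith [hc.2, h1.trans_le (min_le_left _ _)]) y) (convex_Icc _ _)
      (left_mem_Icc.2 (by linarith)) (right_mem_Icc.2 (by linarith))
    rwa [add_sub_cancel_left, Real.norm_of_nonneg h0'.le, Real.norm_eq_abs] at hmvt
  have d3 : |r τ y - r τ x| ≤ L * (h * M) := by
    have hmvt := Convex.norm_image_sub_le_of_norm_hasFDerivWithin_le
      (f := r τ) (s := univ) (C := L)
      (fun z _ => (hr.deriv_space τ hτ z).hasFDerivWithinAt) (fun z _ => hLr z)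
      convex_univ (mem_univ x) (mem_univ y)
    rw [hy, add_sub_cancel_left, norm_smul, Real.norm_of_nonneg h0'.le] at hmvt
    exact hmvt.trans (by gcongr; exact hM τ x)
  have d4 := hr.bound _ (Ioo_subset_Icc_self hσ) y
  have e : |(1 + h • V' τ x).det| * r (τ + h) y - r τ x =
      (|(1 + h • V' τ x).det| - 1) * r (τ + h) y + (r (τ + h) y - r τ y) + (r τ y - r τ x) := by
    ring
  rw [e]
  refine (abs_add_three _ _ _).trans ?_
  rw [abs_mul]
  calc _ ≤ D * (h * K) * B + A * h + L * (h * M) := by gcongr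
    _ = _ := by ring

end IsContinuitySolution

end Transport

/-! ### The flow transports the density -/

section PushForward

variable {E : Type*} [NormedAddCommGroup E] [NormedSpace ℝ E] [FiniteDimensional ℝ E]
  [MeasurableSpace E] [BorelSpace E] (μ : Measure E) [μ.IsAddHaarMeasure]
  {V : ℝ → E → E} {V' : ℝ → E → E →L[ℝ] E} {r : ℝ → E → ℝ} {Dr : ℝ → E → E →L[ℝ] ℝ}
  {r' : ℝ → E → ℝ} {B M R Φ : ℝ} {K Lφ : ℝ≥0} {Y : ℝ → ℝ → E → E} {φ : E → ℝ} {τ : ℝ}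

theorem integrable_indicator_closedBall (C R : ℝ) :
    Integrable ((Metric.closedBall (0 : E) R).indicator fun _ => C) μ :=
  (integrableOn_const (by
    exact (isCompact_closedBall (0 : E) R).measure_lt_top.ne) (by simp)).integrable_indicator
    measurableSet_closedBall

/-- Finite speed of propagation: over a time at most one, a trajectory moves by at most `M`. -/
theorem IsODEFlow.comp_eq_zero (hY : IsODEFlow V Y) (hM : ∀ τ x, ‖V τ x‖ ≤ M)
    (hφR : ∀ x, R < ‖x‖ → φ x = 0) (hτ : τ ∈ Icc (0 : ℝ) 1) {x : E} (hx : R + M < ‖x‖) :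
    φ (Y τ 1 x) = 0 := by
  have hM0 : 0 ≤ M := (norm_nonneg _).trans (hM 0 0)
  refine hφR _ ?_
  have h1 := hY.norm_sub_self_le hM hτ (right_mem_Icc.2 zero_le_one) x
  have h2 : M * |1 - τ| ≤ M := by
    rw [abs_of_nonneg (by linarith [hτ.2])]
    nlinarith [hτ.1]
  have h3 : ‖x‖ ≤ ‖Y τ 1 x‖ + ‖Y τ 1 x - x‖ := by
    rw [norm_sub_rev]
    have := norm_add_le (Y τ 1 x) (x - Y τ 1 x)
    rwa [add_sub_cancel] at this
  linarith

theorem integrable_transported (hr : IsContinuitySolution V V' r Dr r' B)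
    (hL : ∀ τ, LipschitzWith K (V τ)) (hM : ∀ τ x, ‖V τ x‖ ≤ M) (hY : IsODEFlow V Y)
    (hφ : Continuous φ) (hφR : ∀ x, R < ‖x‖ → φ x = 0) (hτ : τ ∈ Icc (0 : ℝ) 1) :
    Integrable (fun x => φ (Y τ 1 x) * r τ x) μ := by
  have hc : Continuous (Y τ 1) := (hY.lipschitzWith hL hτ (right_mem_Icc.2 zero_le_one)).continuous
  refine Continuous.integrable_of_hasCompactSupport
    ((hφ.comp hc).mul (hr.continuous_apply hτ)) (HasCompactSupport.intro
      (isCompact_closedBall (0 : E) (R + M)) fun x hx => ?_)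
  rw [Metric.mem_closedBall, dist_zero_right, not_le] at hx
  rw [hY.comp_eq_zero hM hφR hτ hx, zero_mul]

/-- The substitution `x ↦ x + h V(τ, x)` in the integral at time `τ + h` turns the difference
quotient into the integral of `Q h`. Two errors remain. The density after an Euler step is correct
to first order by `tendsto_euler`; the Euler point and the true trajectory differ by `o(h)`, a gap
which the later flow and `φ` only amplify by `Lφ exp K`. Dominated convergence concludes. Steps `h >
0` suffice, because a continuous function with zero right derivative is constant. -/
theorem hasDerivWithinAt_transported (hr : IsContinuitySolution V V' r Dr r' B)
    (hL : ∀ τ, LipschitzWith K (V τ)) (hM : ∀ τ x, ‖V τ x‖ ≤ M) (hY : IsODEFlow V Y)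
    (hφ : LipschitzWith Lφ φ) (hΦ : ∀ x, |φ x| ≤ Φ) (hφR : ∀ x, R < ‖x‖ → φ x = 0)
    (hτ : τ ∈ Ioo (0 : ℝ) 1) :
    HasDerivWithinAt (fun τ => ∫ x, φ (Y τ 1 x) * r τ x ∂μ) 0 (Ici τ) τ := by
  have hτ' := Ioo_subset_Icc_self hτ
  have h11 : (1 : ℝ) ∈ Icc (0 : ℝ) 1 := right_mem_Icc.2 zero_le_one
  have hM0 : 0 ≤ M := (norm_nonneg _).trans (hM 0 0)
  have hΦ0 : 0 ≤ Φ := (abs_nonneg _).trans (hΦ 0)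
  have hB0 : 0 ≤ B := (abs_nonneg _).trans (hr.bound 0 ⟨le_rfl, zero_le_one⟩ 0)
  obtain ⟨C, hC0, hC⟩ := hr.exists_euler_bound hL hM hτ
  set F : ℝ → ℝ := fun τ => ∫ x, φ (Y τ 1 x) * r τ x ∂μ with hF
  set Q : ℝ → E → ℝ := fun h x =>
    h⁻¹ * (|(1 + h • V' τ x).det| * (φ (Y (τ + h) 1 (x + h • V τ x)) * r (τ + h) (x + h • V τ x))
      - φ (Y τ 1 x) * r τ x) with hQ
  have hint : ∀ {σ}, σ ∈ Icc (0 : ℝ) 1 → Integrable (fun x => φ (Y σ 1 x) * r σ x) μ := fun hσ =>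
    integrable_transported μ hr hL hM hY hφ.continuous hφR hσ
  have e1 : ∀ᶠ h : ℝ in 𝓝[>] 0, h < 1 - τ :=
    (gt_mem_nhds (sub_pos.2 hτ.2)).filter_mono nhdsWithin_le_nhds
  have e2 : ∀ᶠ h : ℝ in 𝓝[>] 0, h * K < 1 := by
    have : Tendsto (fun h : ℝ => h * K) (𝓝 0) (𝓝 (0 * K)) :=
      (continuous_id.mul continuous_const).tendsto 0
    rw [zero_mul] at this
    exact (this.eventually (gt_mem_nhds one_pos)).filter_mono nhdsWithin_le_nhds
  have hmem : ∀ {h : ℝ}, 0 < h → h < 1 - τ → τ + h ∈ Icc (0 : ℝ) 1 := fun h0 h1 =>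
    ⟨by linarith [hτ.1], by linarith⟩
  have hQint : ∀ᶠ h : ℝ in 𝓝[>] 0, Integrable (Q h) μ ∧
      h⁻¹ * (F (τ + h) - F τ) = ∫ x, Q h x ∂μ := by
    filter_upwards [e1, e2, self_mem_nhdsWithin] with h h1 h2 h0
    have h0' : (0 : ℝ) < h := h0
    obtain ⟨i1, i2⟩ := integral_comp_add_smul μ (hL τ) (hr.deriv_velocity τ hτ) h0'.le h2
      (hint (hmem h0' h1))
    refine ⟨(i1.sub (hint hτ')).const_mul _, ?_⟩
    simp only [hQ, hF]
    rw [integral_const_mul, integral_sub i1 (hint hτ'), i2]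
  -- the pointwise estimate of the difference quotient
  have hest : ∀ᶠ h : ℝ in 𝓝[>] 0, ∀ x, |Q h x| ≤
      Φ * |h⁻¹ * (|(1 + h • V' τ x).det| * r (τ + h) (x + h • V τ x) - r τ x)| +
        Lφ * Real.exp K * ‖V τ x - h⁻¹ • (Y τ (τ + h) x - Y τ τ x)‖ * B := by
    filter_upwards [e1, self_mem_nhdsWithin] with h h1 h0 x
    have h0' : (0 : ℝ) < h := h0
    have hσ := hmem h0' h1
    set y := x + h • V τ x with hy
    set z := Y τ (τ + h) x
    have hYz : Y τ 1 x = Y (τ + h) 1 z := (hY.comp hL hτ' hσ h11 x).symm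
    -- By the flow property `φ (Y τ 1 x)` equals `φ` carried from time `τ + h` at the true position
    -- `z`. The first summand is the error in the density, the second the error in the position.
    have hsplit : Q h x = φ (Y (τ + h) 1 y) *
          (h⁻¹ * (|(1 + h • V' τ x).det| * r (τ + h) y - r τ x)) +
        h⁻¹ * (φ (Y (τ + h) 1 y) - φ (Y (τ + h) 1 z)) * r τ x := by
      simp only [hQ]
      rw [hYz]
      ring
    have hlip : h⁻¹ * |φ (Y (τ + h) 1 y) - φ (Y (τ + h) 1 z)| ≤
        Lφ * Real.exp K * ‖V τ x - h⁻¹ • (z - Y τ τ x)‖ := by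
      have a1 := hφ.dist_le_mul (Y (τ + h) 1 y) (Y (τ + h) 1 z)
      have a2 := hY.dist_le hL hσ h11 y z
      rw [Real.dist_eq] at a1
      have a3 : ‖V τ x - h⁻¹ • (z - Y τ τ x)‖ = h⁻¹ * dist y z := by
        rw [hY.init τ hτ', dist_eq_norm, ← Real.norm_of_nonneg (inv_nonneg.2 h0'.le), ← norm_smul,
          Real.norm_of_nonneg (inv_nonneg.2 h0'.le), hy]
        congr 1
        rw [smul_sub, smul_sub, smul_add, smul_smul, inv_mul_cancel₀ h0'.ne', one_smul]
        abel
      rw [a3]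
      calc h⁻¹ * |φ (Y (τ + h) 1 y) - φ (Y (τ + h) 1 z)|
          ≤ h⁻¹ * (Lφ * (Real.exp K * dist y z)) := by
            gcongr
            exact a1.trans (by gcongr)
        _ = _ := by ring
    rw [hsplit]
    refine (abs_add_le _ _).trans (add_le_add ?_ ?_)
    · rw [abs_mul]
      exact mul_le_mul_of_nonneg_right (hΦ _) (abs_nonneg _)
    · rw [abs_mul, abs_mul, abs_of_pos (inv_pos.2 h0')]
      exact mul_le_mul hlip (hr.bound τ hτ' x) (abs_nonneg _) (by positivity)
  have hlim : Tendsto (fun h => ∫ x, Q h x ∂μ) (𝓝[>] 0) (𝓝 (∫ _x, 0 ∂μ)) := by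
    -- The radius `R + 2M` allows one `M` for the flow and one for the Euler displacement, as `h <
    -- 1`.
    refine tendsto_integral_filter_of_dominated_convergence
      ((Metric.closedBall (0 : E) (R + 2 * M)).indicator fun _ =>
        Φ * C + Lφ * Real.exp K * (2 * M) * B) ?_ ?_ (integrable_indicator_closedBall μ _ _) ?_
    · exact hQint.mono fun h hh => hh.1.aestronglyMeasurable
    · filter_upwards [hest, hC, e1, self_mem_nhdsWithin] with h h1 h2 h3 h0
      have h0' : (0 : ℝ) < h := h0
      have hσ := hmem h0' h3
      refine Eventually.of_forall fun x => ?_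
      by_cases hx : x ∈ Metric.closedBall (0 : E) (R + 2 * M)
      · rw [indicator_of_mem hx]
        refine (h1 x).trans (add_le_add ?_ ?_)
        · refine mul_le_mul_of_nonneg_left ?_ hΦ0
          rw [abs_mul, abs_of_pos (inv_pos.2 h0')]
          calc _ ≤ h⁻¹ * (C * h) := by
                gcongr
                exact h2 x
            _ = C := by field_simp
        · gcongr
          refine (norm_sub_le _ _).trans ?_
          rw [norm_smul, norm_inv, Real.norm_of_nonneg h0'.le, two_mul]
          refine add_le_add (hM τ x) ?_
          have := hY.norm_sub_le hM hτ' hσ hτ' x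
          rw [add_sub_cancel_left, abs_of_pos h0'] at this
          calc _ ≤ h⁻¹ * (M * h) := by gcongr
            _ = M := by field_simp
      · rw [indicator_of_notMem hx]
        rw [Metric.mem_closedBall, dist_zero_right, not_le] at hx
        have hx1 : R + M < ‖x + h • V τ x‖ := by
          have a1 : ‖x‖ ≤ ‖x + h • V τ x‖ + ‖h • V τ x‖ := by
            have := norm_sub_le (x + h • V τ x) (h • V τ x)
            rwa [add_sub_cancel_right] at this
          rw [norm_smul, Real.norm_of_nonneg h0'.le] at a1
          have a2 : h * ‖V τ x‖ ≤ 1 * M :=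
            mul_le_mul (by linarith [hτ.1]) (hM τ x) (norm_nonneg _) zero_le_one
          linarith
        simp only [hQ]
        rw [hY.comp_eq_zero hM hφR hτ' (by linarith), hY.comp_eq_zero hM hφR hσ hx1]
        simp
    · refine Eventually.of_forall fun x => ?_
      have a1 := (hr.tendsto_euler hτ x).abs.const_mul Φ
      have a2 : Tendsto (fun h : ℝ => ‖V τ x - h⁻¹ • (Y τ (τ + h) x - Y τ τ x)‖) (𝓝[>] 0) (𝓝 0) := by
        have := (hY.deriv τ hτ' x τ (IsODEFlow.Icc_subset_Ioo_time hτ')).tendsto_slope_zero_right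
        rw [hY.init τ hτ'] at this
        have h2 := (this.const_sub (V τ x)).norm
        rw [sub_self, norm_zero] at h2
        simp only [hY.init τ hτ']
        exact h2
      have a3 := (a2.const_mul (Lφ * Real.exp K : ℝ)).mul_const B
      have a4 := a1.add a3
      rw [abs_zero, mul_zero, mul_zero, zero_mul, add_zero] at a4
      exact squeeze_zero_norm' (hest.mono fun h hh => hh x) a4
  rw [integral_zero] at hlim
  have hlim2 : Tendsto (fun h : ℝ => h⁻¹ * (F (τ + h) - F τ)) (𝓝[>] 0) (𝓝 0) :=
    hlim.congr' (hQint.mono fun h hh => hh.2.symm)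
  rw [← hasDerivWithinAt_Ioi_iff_Ici, hasDerivWithinAt_iff_tendsto_slope' (by simp)]
  have hmap : Tendsto (fun σ : ℝ => σ - τ) (𝓝[>] τ) (𝓝[>] 0) := by
    refine tendsto_nhdsWithin_iff.2 ⟨?_, ?_⟩
    · have : Tendsto (fun σ : ℝ => σ - τ) (𝓝 τ) (𝓝 (τ - τ)) :=
        (continuous_id.sub continuous_const).tendsto τ
      rw [sub_self] at this
      exact this.mono_left nhdsWithin_le_nhds
    · filter_upwards [self_mem_nhdsWithin] with σ hσ
      exact sub_pos.2 (show τ < σ from hσ)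
  refine (hlim2.comp hmap).congr fun σ => ?_
  simp [slope_def_field, div_eq_inv_mul]

theorem continuousOn_transported (hr : IsContinuitySolution V V' r Dr r' B)
    (hL : ∀ τ, LipschitzWith K (V τ)) (hM : ∀ τ x, ‖V τ x‖ ≤ M) (hY : IsODEFlow V Y)
    (hφ : Continuous φ) (hΦ : ∀ x, |φ x| ≤ Φ) (hφR : ∀ x, R < ‖x‖ → φ x = 0) :
    ContinuousOn (fun τ => ∫ x, φ (Y τ 1 x) * r τ x ∂μ) (Icc 0 1) := by
  have hM0 : 0 ≤ M := (norm_nonneg _).trans (hM 0 0)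
  have hΦ0 : 0 ≤ Φ := (abs_nonneg _).trans (hΦ 0)
  have h11 : (1 : ℝ) ∈ Icc (0 : ℝ) 1 := right_mem_Icc.2 zero_le_one
  refine continuousOn_of_dominated
    (bound := (Metric.closedBall (0 : E) (R + M)).indicator fun _ => Φ * B)
    (fun τ hτ => (integrable_transported μ hr hL hM hY hφ hφR hτ).aestronglyMeasurable)
    (fun τ hτ => Eventually.of_forall fun x => ?_) (integrable_indicator_closedBall μ _ _)
    (Eventually.of_forall fun x => ?_)
  · by_cases hx : x ∈ Metric.closedBall (0 : E) (R + M)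
    · rw [indicator_of_mem hx, norm_mul]
      exact mul_le_mul (hΦ _) (hr.bound τ hτ x) (norm_nonneg _) hΦ0
    · rw [indicator_of_notMem hx]
      rw [Metric.mem_closedBall, dist_zero_right, not_le] at hx
      rw [hY.comp_eq_zero hM hφR hτ hx, zero_mul, norm_zero]
  · refine ContinuousOn.mul (hφ.comp_continuousOn ?_)
      (hr.cont.comp (f := fun τ => (τ, x)) (by fun_prop) fun τ hτ => ⟨hτ, mem_univ _⟩)
    have hlip : LipschitzOnWith (Real.exp K * M).toNNReal (fun τ => Y τ 1 x) (Icc 0 1) := by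
      refine LipschitzOnWith.of_dist_le_mul fun a ha b hb => ?_
      rw [Real.coe_toNNReal _ (by positivity), mul_assoc, Real.dist_eq, abs_sub_comm]
      exact hY.dist_init_le hL hM ha hb h11 x
    exact hlip.continuousOn

/-- The flow transports the density, tested against Lipschitz functions with bounded support. -/
theorem integral_transported_eq (hr : IsContinuitySolution V V' r Dr r' B)
    (hL : ∀ τ, LipschitzWith K (V τ)) (hM : ∀ τ x, ‖V τ x‖ ≤ M) (hY : IsODEFlow V Y)
    (hφ : LipschitzWith Lφ φ) (hΦ : ∀ x, |φ x| ≤ Φ) (hφR : ∀ x, R < ‖x‖ → φ x = 0) :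
    ∫ x, φ (Y 0 1 x) * r 0 x ∂μ = ∫ x, φ x * r 1 x ∂μ := by
  have hcont := continuousOn_transported μ hr hL hM hY hφ.continuous hΦ hφR
  set F : ℝ → ℝ := fun τ => ∫ x, φ (Y τ 1 x) * r τ x ∂μ with hF
  -- The equation holds only at interior times, so constancy is obtained on `[a,1]` and extended to
  -- `a = 0` by continuity.
  have hconst : ∀ a ∈ Ioo (0 : ℝ) 1, F a = F 1 := by
    intro a ha
    refine (constant_of_has_deriv_right_zero (f := F) (a := a) (b := 1)
      (hcont.mono (Icc_subset_Icc_left ha.1.le)) (fun τ hτ => ?_) 1 ⟨ha.2.le, le_rfl⟩).symm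
    exact hasDerivWithinAt_transported μ hr hL hM hY hφ hΦ hφR ⟨ha.1.trans_le hτ.1, hτ.2⟩
  have h0 : Tendsto F (𝓝[>] 0) (𝓝 (F 0)) := by
    have := hcont 0 ⟨le_rfl, zero_le_one⟩
    refine this.mono_left ?_
    rw [← nhdsWithin_Ioo_eq_nhdsGT (zero_lt_one' ℝ)]
    exact nhdsWithin_mono _ Ioo_subset_Icc_self
  have h1 : Tendsto F (𝓝[>] 0) (𝓝 (F 1)) := by
    refine tendsto_const_nhds.congr' ?_
    filter_upwards [Ioo_mem_nhdsGT (zero_lt_one' ℝ)] with a ha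
    exact (hconst a ha).symm
  have := tendsto_nhds_unique h0 h1
  simp only [hF, hY.init 1 (right_mem_Icc.2 zero_le_one)] at this
  exact this

theorem setIntegral_preimage_transported_eq (hr : IsContinuitySolution V V' r Dr r' B)
    (hL : ∀ τ, LipschitzWith K (V τ)) (hM : ∀ τ x, ‖V τ x‖ ≤ M) (hY : IsODEFlow V Y)
    {U : Set E} (hU : IsOpen U) (hUR : ∀ x ∈ U, ‖x‖ ≤ R) (hne : Uᶜ.Nonempty) :
    ∫ x in Y 0 1 ⁻¹' U, r 0 x ∂μ = ∫ x in U, r 1 x ∂μ := by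
  have h01 : (0 : ℝ) ∈ Icc (0 : ℝ) 1 := left_mem_Icc.2 zero_le_one
  have h11 : (1 : ℝ) ∈ Icc (0 : ℝ) 1 := right_mem_Icc.2 zero_le_one
  -- Lipschitz functions converging to the indicator of `U`. The complement must be nonempty, since
  -- `infDist` to the empty set is zero by convention.
  set φ : ℕ → E → ℝ := fun n x => min 1 (n * Metric.infDist x Uᶜ) with hφdef
  have hφ0 : ∀ n x, 0 ≤ φ n x := fun n x =>
    le_min zero_le_one (mul_nonneg (Nat.cast_nonneg _) Metric.infDist_nonneg)
  have hφ1 : ∀ n x, φ n x ≤ 1 := fun n x => min_le_left _ _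
  have hφU : ∀ n, ∀ x ∉ U, φ n x = 0 := fun n x hx => by
    simp only [hφdef]
    rw [Metric.infDist_zero_of_mem (show x ∈ Uᶜ from hx), mul_zero]
    exact min_eq_right zero_le_one
  have hφlip : ∀ n : ℕ, LipschitzWith (n : ℝ≥0) (φ n) := fun n => by
    refine LipschitzWith.const_min (LipschitzWith.of_dist_le_mul fun x y => ?_) 1
    rw [Real.dist_eq, ← mul_sub, abs_mul, Nat.abs_cast, NNReal.coe_natCast]
    refine mul_le_mul_of_nonneg_left ?_ (Nat.cast_nonneg _)
    have := (Metric.lipschitz_infDist_pt Uᶜ).dist_le_mul x y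
    rwa [NNReal.coe_one, one_mul, Real.dist_eq] at this
  have hφabs : ∀ n x, |φ n x| ≤ 1 := fun n x => by
    rw [abs_of_nonneg (hφ0 n x)]; exact hφ1 n x
  have hφR : ∀ n x, R < ‖x‖ → φ n x = 0 := fun n x hx =>
    hφU n x fun hxU => absurd (hUR x hxU) (not_le.2 hx)
  have hφlim : ∀ x, Tendsto (fun n => φ n x) atTop (𝓝 (U.indicator (fun _ => (1 : ℝ)) x)) := by
    intro x
    by_cases hx : x ∈ U
    · rw [indicator_of_mem hx]
      have hpos : 0 < Metric.infDist x Uᶜ :=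
        (hU.isClosed_compl.notMem_iff_infDist_pos hne).1 (fun h => h hx)
      refine tendsto_const_nhds.congr' ?_
      filter_upwards [(tendsto_natCast_atTop_atTop.atTop_mul_const hpos).eventually_ge_atTop 1]
        with n hn
      exact (min_eq_left hn).symm
    · rw [indicator_of_notMem hx]
      exact tendsto_const_nhds.congr fun n => (hφU n x hx).symm
  have key : ∀ τ ∈ Icc (0 : ℝ) 1, Tendsto (fun n => ∫ x, φ n (Y τ 1 x) * r τ x ∂μ) atTop
      (𝓝 (∫ x in Y τ 1 ⁻¹' U, r τ x ∂μ)) := by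
    intro τ hτ
    have hc : Continuous (Y τ 1) := (hY.lipschitzWith hL hτ h11).continuous
    rw [← integral_indicator (hU.preimage hc).measurableSet]
    refine tendsto_integral_of_dominated_convergence
      ((Metric.closedBall (0 : E) (R + M)).indicator fun _ => 1 * B)
      (fun n => (integrable_transported μ hr hL hM hY (hφlip n).continuous (hφR n)
        hτ).aestronglyMeasurable) (integrable_indicator_closedBall μ _ _)
      (fun n => Eventually.of_forall fun x => ?_) (Eventually.of_forall fun x => ?_)
    · by_cases hx : x ∈ Metric.closedBall (0 : E) (R + M)
      · rw [indicator_of_mem hx, norm_mul]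
        exact mul_le_mul (hφabs _ _) (hr.bound τ hτ x) (norm_nonneg _) zero_le_one
      · rw [indicator_of_notMem hx]
        rw [Metric.mem_closedBall, dist_zero_right, not_le] at hx
        rw [hY.comp_eq_zero hM (hφR n) hτ hx, zero_mul, norm_zero]
    · have := (hφlim (Y τ 1 x)).mul_const (r τ x)
      have e : (Y τ 1 ⁻¹' U).indicator (r τ) x =
          U.indicator (fun _ => (1 : ℝ)) (Y τ 1 x) * r τ x := by
        by_cases hx : Y τ 1 x ∈ U
        · rw [indicator_of_mem hx, indicator_of_mem (show x ∈ Y τ 1 ⁻¹' U from hx), one_mul]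
        · rw [indicator_of_notMem hx, indicator_of_notMem (show x ∉ Y τ 1 ⁻¹' U from hx), zero_mul]
      rw [e]
      exact this
  have k0 := key 0 h01
  have k1 := key 1 h11
  have hid : Y 1 1 = id := funext fun x => hY.init 1 h11 x
  rw [hid, preimage_id] at k1
  refine tendsto_nhds_unique k0 (k1.congr fun n => ?_)
  rw [integral_transported_eq μ hr hL hM hY (hφlip n) (hφabs n) (hφR n)]
  rfl

end PushForward

/-! ### Change of time from the half-line to the unit interval -/

section Clock

/-- A change of time, mapping `(0,1)` onto `(0,∞)`. -/
noncomputable def clock (n : ℕ) (τ : ℝ) : ℝ := (τ / (1 - τ)) ^ n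

/-- The derivative of `clock`. -/
noncomputable def clockDeriv (n : ℕ) (τ : ℝ) : ℝ :=
  n * (τ / (1 - τ)) ^ (n - 1) * ((1 - τ)⁻¹) ^ 2

/-- The inverse of `clock`. -/
noncomputable def clockInv (n : ℕ) (t : ℝ) : ℝ := t ^ (n⁻¹ : ℝ) / (1 + t ^ (n⁻¹ : ℝ))

variable {n : ℕ} {τ t α : ℝ}

theorem hasDerivAt_clock (n : ℕ) (hτ : τ ≠ 1) : HasDerivAt (clock n) (clockDeriv n τ) τ := by
  have h1 : 1 - τ ≠ 0 := sub_ne_zero.2 hτ.symm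
  have h := ((hasDerivAt_id τ).div ((hasDerivAt_id τ).const_sub 1) h1).pow n
  refine h.congr_deriv ?_
  simp only [clockDeriv, id, Pi.div_apply]
  field_simp
  ring

theorem clock_pos (n : ℕ) (hτ : τ ∈ Ioo (0 : ℝ) 1) : 0 < clock n τ :=
  pow_pos (div_pos hτ.1 (sub_pos.2 hτ.2)) n

theorem clockDeriv_pos (hn : n ≠ 0) (hτ : τ ∈ Ioo (0 : ℝ) 1) : 0 < clockDeriv n τ := by
  have := div_pos hτ.1 (sub_pos.2 hτ.2)
  have h1 := sub_pos.2 hτ.2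
  have := Nat.pos_of_ne_zero hn
  unfold clockDeriv
  positivity

theorem clock_zero (hn : n ≠ 0) : clock n 0 = 0 := by simp [clock, hn]

theorem continuousAt_clock (n : ℕ) (hτ : τ ≠ 1) : ContinuousAt (clock n) τ :=
  (hasDerivAt_clock n hτ).continuousAt

theorem continuousAt_clockDeriv (n : ℕ) (hτ : τ ≠ 1) : ContinuousAt (clockDeriv n) τ := by
  have h1 : 1 - τ ≠ 0 := sub_ne_zero.2 hτ.symm
  unfold clockDeriv
  fun_prop (disch := assumption)

theorem clockInv_zero (hn : n ≠ 0) : clockInv n 0 = 0 := by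
  rw [clockInv, Real.zero_rpow (by positivity), zero_div]

theorem clockInv_mem_Ioo (n : ℕ) (ht : 0 < t) : clockInv n t ∈ Ioo (0 : ℝ) 1 := by
  have := Real.rpow_pos_of_pos ht (n⁻¹ : ℝ)
  refine ⟨by unfold clockInv; positivity, ?_⟩
  rw [clockInv, div_lt_one (by positivity)]
  linarith

theorem clockInv_mem_Icc (n : ℕ) (ht : 0 ≤ t) : clockInv n t ∈ Icc (0 : ℝ) 1 := by
  have := Real.rpow_nonneg ht (n⁻¹ : ℝ)
  refine ⟨by unfold clockInv; positivity, ?_⟩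
  rw [clockInv, div_le_one (by positivity)]
  linarith

theorem clock_clockInv (hn : n ≠ 0) (ht : 0 ≤ t) : clock n (clockInv n t) = t := by
  have h := Real.rpow_nonneg ht (n⁻¹ : ℝ)
  have h1 : 1 + t ^ (n⁻¹ : ℝ) ≠ 0 := by positivity
  have e : clockInv n t / (1 - clockInv n t) = t ^ (n⁻¹ : ℝ) := by
    rw [clockInv]
    generalize t ^ (n⁻¹ : ℝ) = y at *
    rw [one_sub_div h1]
    field_simp
    ring
  rw [clock, e, Real.rpow_inv_natCast_pow ht hn]

theorem continuousOn_clockInv (n : ℕ) : ContinuousOn (clockInv n) (Ici 0) := by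
  have h : ContinuousOn (fun t : ℝ => t ^ (n⁻¹ : ℝ)) (Ici 0) :=
    (Real.continuous_rpow_const (by positivity)).continuousOn
  exact h.div (continuousOn_const.add h) fun t ht => by
    have := Real.rpow_nonneg ht (n⁻¹ : ℝ)
    positivity

theorem hasDerivAt_clockInv (hn : n ≠ 0) (ht : 0 < t) :
    HasDerivAt (clockInv n) (clockDeriv n (clockInv n t))⁻¹ t := by
  have hσ := clockInv_mem_Ioo n ht
  refine HasDerivAt.of_local_left_inverse
    ((continuousOn_clockInv n).continuousAt (Ici_mem_nhds ht))
    (hasDerivAt_clock n hσ.2.ne) (clockDeriv_pos hn hσ).ne' ?_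
  filter_upwards [Ioi_mem_nhds ht] with s hs
  exact clock_clockInv hn (le_of_lt hs)

theorem tendsto_clockInv (hn : n ≠ 0) : Tendsto (clockInv n) atTop (𝓝 1) := by
  have h1 : Tendsto (fun t : ℝ => t ^ (n⁻¹ : ℝ)) atTop atTop :=
    tendsto_rpow_atTop (by positivity)
  have h2 : Tendsto (fun t : ℝ => 1 - (1 + t ^ (n⁻¹ : ℝ))⁻¹) atTop (𝓝 (1 - 0)) :=
    (tendsto_inv_atTop_zero.comp (tendsto_atTop_add_const_left _ 1 h1)).const_sub 1
  rw [sub_zero] at h2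
  refine h2.congr' ?_
  filter_upwards [eventually_ge_atTop 0] with t ht
  have := Real.rpow_nonneg ht (n⁻¹ : ℝ)
  rw [clockInv]
  field_simp
  ring

/-- Put `w = τ/(1-τ)`, so that `t = w^n` and `dt/dτ = n w^(n-1) (1+w)²`. For `w ≤ 1` the product is
at most `4 n w^(nα/2-1) ≤ 4 n w`, as `nα ≥ 4`. For `w > 1` it is at most `4 n w^(1-n/2) ≤ 4 n / w`,
as `n ≥ 4`. The weighted field thus vanishes at both ends of the interval, which makes its extension
by zero continuous. -/
theorem clockDeriv_mul_heatWeight_le (hn : 4 ≤ n) (hα : 4 ≤ α * n) (hτ : τ ∈ Ioo (0 : ℝ) 1) :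
    clockDeriv n τ * heatWeight α (clock n τ) ≤ 8 * n * min τ (1 - τ) := by
  have h1 : 0 < 1 - τ := sub_pos.2 hτ.2
  have h0 := hτ.1
  set w := τ / (1 - τ) with hw
  have hw0 : 0 < w := div_pos h0 h1
  have hinv : (1 - τ)⁻¹ = 1 + w := by rw [hw]; field_simp; ring
  obtain ⟨m, rfl⟩ : ∃ m, n = m + 1 := ⟨n - 1, by omega⟩
  set n := m + 1 with hn'
  have hn4 : (4 : ℝ) ≤ n := by exact_mod_cast hn
  rw [clockDeriv, clock, ← hw, hinv, show n - 1 = m from rfl]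
  by_cases hle : w ≤ 1
  · have hτ2 : τ ≤ 1 - τ := by rwa [hw, div_le_one h1] at hle
    rw [heatWeight, if_pos (pow_le_one₀ hw0.le hle), min_eq_left hτ2,
      Real.rpow_sub_one (pow_pos hw0 n).ne']
    have e : (w ^ n) ^ (α / 2) ≤ w ^ 2 := by
      rw [← Real.rpow_natCast w n, ← Real.rpow_mul hw0.le, ← Real.rpow_natCast w 2]
      refine Real.rpow_le_rpow_of_exponent_ge hw0 hle ?_
      push_cast
      linarith
    have hwτ : w ≤ 2 * τ := by
      rw [hw, div_le_iff₀ h1]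
      nlinarith
    calc _ ≤ n * w ^ m * (1 + 1) ^ 2 * (w ^ 2 / w ^ n) := by gcongr
      _ = 4 * n * w := by rw [hn', pow_succ]; field_simp; ring
      _ ≤ 4 * n * (2 * τ) := by gcongr
      _ = _ := by ring
  · rw [not_le] at hle
    have hτ2 : 1 - τ ≤ τ := by rw [hw, one_lt_div h1] at hle; exact hle.le
    rw [heatWeight, if_neg (not_le.2 (one_lt_pow₀ hle (by omega))), min_eq_right hτ2]
    have e : (w ^ n) ^ (-(3 / 2) : ℝ) ≤ (w ^ (n + 2))⁻¹ := by
      rw [← Real.rpow_natCast w n, ← Real.rpow_mul hw0.le, ← Real.rpow_natCast w (n + 2),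
        ← Real.rpow_neg hw0.le]
      refine Real.rpow_le_rpow_of_exponent_le hle.le ?_
      push_cast
      linarith
    have hwτ : w⁻¹ ≤ 2 * (1 - τ) := by
      rw [hw, inv_div, div_le_iff₀ h0]
      nlinarith
    calc _ ≤ n * w ^ m * (w + w) ^ 2 * (w ^ (n + 2))⁻¹ := by gcongr
      _ = 4 * n * w⁻¹ := by rw [hn', pow_add, pow_succ]; field_simp; ring
      _ ≤ 4 * n * (2 * (1 - τ)) := by gcongr
      _ = _ := by ring

end Clock

/-! ### The velocity field in the new time -/

section Field

variable {d n : ℕ} {f : EuclideanSpace ℝ (Fin d) → ℝ} {A B α τ : ℝ}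

/-- The velocity field `-∇ log (1 + P_t f)` after the change of time `clock n`. -/
noncomputable def clockVelocity (n : ℕ) (f : EuclideanSpace ℝ (Fin d) → ℝ) (τ : ℝ)
    (x : EuclideanSpace ℝ (Fin d)) : EuclideanSpace ℝ (Fin d) :=
  if τ ∈ Ioo (0 : ℝ) 1 then clockDeriv n τ • heatVelocity f (clock n τ) x else 0

theorem norm_clockVelocity_le_min (hA : 0 ≤ A) (hn : 4 ≤ n) (hα : 4 ≤ α * n)
    (hV : ∀ t, 0 < t → ∀ x, ‖heatVelocity f t x‖ ≤ A * heatWeight α t) (τ : ℝ)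
    (x : EuclideanSpace ℝ (Fin d)) :
    ‖clockVelocity n f τ x‖ ≤ 8 * n * A * max 0 (min τ (1 - τ)) := by
  rw [clockVelocity]
  split_ifs with hτ
  · rw [norm_smul, Real.norm_of_nonneg (clockDeriv_pos (by omega) hτ).le]
    have h1 := clockDeriv_mul_heatWeight_le hn hα hτ
    calc _ ≤ clockDeriv n τ * (A * heatWeight α (clock n τ)) :=
          mul_le_mul_of_nonneg_left (hV _ (clock_pos n hτ) x) (clockDeriv_pos (by omega) hτ).le
      _ = A * (clockDeriv n τ * heatWeight α (clock n τ)) := by ring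
      _ ≤ A * (8 * n * max 0 (min τ (1 - τ))) := by
        refine mul_le_mul_of_nonneg_left (h1.trans ?_) hA
        gcongr
        exact le_max_right _ _
      _ = _ := by ring
  · rw [norm_zero]
    positivity

theorem norm_clockVelocity_le (hA : 0 ≤ A) (hn : 4 ≤ n) (hα : 4 ≤ α * n)
    (hV : ∀ t, 0 < t → ∀ x, ‖heatVelocity f t x‖ ≤ A * heatWeight α t) (τ : ℝ)
    (x : EuclideanSpace ℝ (Fin d)) : ‖clockVelocity n f τ x‖ ≤ 8 * n * A := by
  refine (norm_clockVelocity_le_min hA hn hα hV τ x).trans ?_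
  refine mul_le_of_le_one_right (by positivity) (max_le zero_le_one ?_)
  rcases le_total τ 1 with h | h
  · exact (min_le_left _ _).trans h
  · exact (min_le_right _ _).trans (by linarith)

theorem lipschitzWith_clockVelocity {K : ℝ≥0} (hA : 0 ≤ A) (hn : 4 ≤ n) (hα : 4 ≤ α * n)
    (hV : ∀ t, 0 < t → ∀ x y,
      ‖heatVelocity f t x - heatVelocity f t y‖ ≤ A * heatWeight α t * ‖x - y‖)
    (hK : 8 * n * A ≤ K) (τ : ℝ) : LipschitzWith K (clockVelocity n f τ) := by
  refine LipschitzWith.of_dist_le_mul fun x y => ?_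
  rw [dist_eq_norm, dist_eq_norm, clockVelocity, clockVelocity]
  split_ifs with hτ
  · have hpos := (clockDeriv_pos (n := n) (by omega) hτ).le
    rw [← smul_sub, norm_smul, Real.norm_of_nonneg hpos]
    have h1 := clockDeriv_mul_heatWeight_le hn hα hτ
    have h2 : min τ (1 - τ) ≤ 1 := (min_le_left _ _).trans hτ.2.le
    calc _ ≤ clockDeriv n τ * (A * heatWeight α (clock n τ) * ‖x - y‖) :=
          mul_le_mul_of_nonneg_left (hV _ (clock_pos n hτ) x y) hpos
      _ = A * (clockDeriv n τ * heatWeight α (clock n τ)) * ‖x - y‖ := by ring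
      _ ≤ A * (8 * n * 1) * ‖x - y‖ :=
        mul_le_mul_of_nonneg_right
          (mul_le_mul_of_nonneg_left (h1.trans (by gcongr)) hA) (norm_nonneg _)
      _ = (8 * n * A) * ‖x - y‖ := by ring
      _ ≤ _ := by gcongr
  · rw [sub_zero, norm_zero]
    positivity

theorem continuousOn_heatVelocity_uncurry (h : BddCont f B) (hB : B ≤ 1 / 2) :
    ContinuousOn (fun p : ℝ × EuclideanSpace ℝ (Fin d) => heatVelocity f p.1 p.2)
      (Ioi 0 ×ˢ univ) := by
  have h1 : Continuous fun p : ℝ × EuclideanSpace ℝ (Fin d) => (1 + heat p.1 f p.2)⁻¹ :=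
    (continuous_const.add (continuous_heat_uncurry h)).inv₀ fun p => by
      linarith [half_le_one_add_heat h hB p.1 p.2] |> fun (h : 0 < 1 + heat p.1 f p.2) => h.ne'
  exact (h1.continuousOn.smul (continuousOn_heatGrad_uncurry h)).neg

/-- Inside `(0,1)` this is continuity of the heat velocity in time; elsewhere the bound of
`norm_clockVelocity_le_min` vanishes and squeezes the field to zero. -/
theorem continuous_clockVelocity (h : BddCont f B) (hB : B ≤ 1 / 2) (hA : 0 ≤ A) (hn : 4 ≤ n)
    (hα : 4 ≤ α * n) (hV : ∀ t, 0 < t → ∀ x, ‖heatVelocity f t x‖ ≤ A * heatWeight α t)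
    (x : EuclideanSpace ℝ (Fin d)) : Continuous fun τ => clockVelocity n f τ x := by
  rw [continuous_iff_continuousAt]
  intro τ
  by_cases hτ : τ ∈ Ioo (0 : ℝ) 1
  · have h1 : ContinuousAt (fun σ => clockDeriv n σ • heatVelocity f (clock n σ) x) τ := by
      refine (continuousAt_clockDeriv n hτ.2.ne).smul ?_
      have h2 : ContinuousAt (fun p : ℝ × EuclideanSpace ℝ (Fin d) => heatVelocity f p.1 p.2)
          (clock n τ, x) := (continuousOn_heatVelocity_uncurry h hB).continuousAt
        ((isOpen_Ioi.prod isOpen_univ).mem_nhds ⟨clock_pos n hτ, mem_univ _⟩)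
      exact ContinuousAt.comp (f := fun σ => (clock n σ, x)) h2
        ((continuousAt_clock n hτ.2.ne).prodMk continuousAt_const)
    refine h1.congr ?_
    filter_upwards [isOpen_Ioo.mem_nhds hτ] with σ hσ
    rw [clockVelocity, if_pos hσ]
  · have h0 : clockVelocity n f τ x = 0 := if_neg hτ
    have hm : max 0 (min τ (1 - τ)) = 0 := by
      refine max_eq_left ?_
      by_contra hcon
      rw [not_le, lt_min_iff] at hcon
      exact hτ ⟨hcon.1, by linarith⟩
    rw [ContinuousAt, h0]
    refine squeeze_zero_norm (norm_clockVelocity_le_min hA hn hα hV · x) ?_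
    have : Tendsto (fun τ : ℝ => 8 * n * A * max 0 (min τ (1 - τ))) (𝓝 τ)
        (𝓝 (8 * n * A * max 0 (min τ (1 - τ)))) :=
      Continuous.tendsto (by fun_prop) τ
    rwa [hm, mul_zero] at this

theorem heatGrad_isometry (h : BddCont f B) {t : ℝ} (ht : 0 < t)
    (e : EuclideanSpace ℝ (Fin d) ≃ₗᵢ[ℝ] EuclideanSpace ℝ (Fin d))
    (v : EuclideanSpace ℝ (Fin d)) (hf : ∀ x, f (e x + v) = f x)
    (x : EuclideanSpace ℝ (Fin d)) : heatGrad t f (e x + v) = e (heatGrad t f x) := by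
  have h1 : HasFDerivAt (fun x => heat t f (e x + v))
      ((innerSL ℝ (heatGrad t f (e x + v))).comp
        (e.toContinuousLinearEquiv : EuclideanSpace ℝ (Fin d) →L[ℝ] EuclideanSpace ℝ (Fin d))) x :=
    (hasFDerivAt_heat h ht (e x + v)).comp x
      ((e.toContinuousLinearEquiv.hasFDerivAt (x := x)).add_const v)
  simp_rw [heat_isometry, hf] at h1
  have h2 := h1.unique (hasFDerivAt_heat h ht x)
  refine ext_inner_right ℝ fun y => ?_
  have h3 := DFunLike.congr_fun h2 (e.symm y)
  simp only [ContinuousLinearMap.comp_apply, innerSL_apply_apply] at h3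
  have h4 : (e.toContinuousLinearEquiv :
    EuclideanSpace ℝ (Fin d) →L[ℝ] EuclideanSpace ℝ (Fin d)) (e.symm y) = y := e.apply_symm_apply y
  rw [h4] at h3
  rw [h3, ← e.inner_map_map, e.apply_symm_apply]

theorem clockVelocity_isometry (h : BddCont f B) (n : ℕ)
    (e : EuclideanSpace ℝ (Fin d) ≃ₗᵢ[ℝ] EuclideanSpace ℝ (Fin d))
    (v : EuclideanSpace ℝ (Fin d)) (hf : ∀ x, f (e x + v) = f x) (τ : ℝ)
    (x : EuclideanSpace ℝ (Fin d)) :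
    clockVelocity n f τ (e x + v) = e (clockVelocity n f τ x) := by
  rw [clockVelocity, clockVelocity]
  split_ifs with hτ
  · rw [heatVelocity, heatVelocity, heatGrad_isometry h (clock_pos n hτ) e v hf, heat_isometry]
    simp_rw [hf]
    simp
  · simp

end Field

/-! ### The density in the new time -/

section Density

variable {d n : ℕ} {f : EuclideanSpace ℝ (Fin d) → ℝ} {A B D α τ t : ℝ}

/-- The solution `1 + P_t f` of the heat equation after the change of time `clock n`, extended by
its limit. -/
noncomputable def clockDensity (n : ℕ) (f : EuclideanSpace ℝ (Fin d) → ℝ) (τ : ℝ)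
    (x : EuclideanSpace ℝ (Fin d)) : ℝ :=
  if τ < 1 then 1 + heat (clock n τ) f x else 1

theorem clockDensity_zero (hn : n ≠ 0) (f : EuclideanSpace ℝ (Fin d) → ℝ)
    (x : EuclideanSpace ℝ (Fin d)) : clockDensity n f 0 x = 1 + f x := by
  rw [clockDensity, if_pos one_pos, clock_zero hn, heat_of_nonpos le_rfl]

theorem clockDensity_one (n : ℕ) (f : EuclideanSpace ℝ (Fin d) → ℝ)
    (x : EuclideanSpace ℝ (Fin d)) : clockDensity n f 1 x = 1 := if_neg (lt_irrefl _)

/-- The derivative of `heatVelocity f t`. -/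
noncomputable def heatVelocityDeriv (f : EuclideanSpace ℝ (Fin d) → ℝ) (t : ℝ)
    (x : EuclideanSpace ℝ (Fin d)) : EuclideanSpace ℝ (Fin d) →L[ℝ] EuclideanSpace ℝ (Fin d) :=
  -((1 + heat t f x)⁻¹ • fderiv ℝ (heatGrad t f) x +
    (-((1 + heat t f x) ^ 2)⁻¹ • innerSL ℝ (heatGrad t f x)).smulRight (heatGrad t f x))

theorem hasFDerivAt_heatVelocity (h : BddCont f B) (hB : B ≤ 1 / 2) (ht : 0 < t)
    (x : EuclideanSpace ℝ (Fin d)) :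
    HasFDerivAt (heatVelocity f t) (heatVelocityDeriv f t x) x := by
  have hu : 1 + heat t f x ≠ 0 := by
    have := half_le_one_add_heat h hB t x
    positivity
  have h1 : HasFDerivAt (fun x => (1 + heat t f x)⁻¹)
      (-((1 + heat t f x) ^ 2)⁻¹ • innerSL ℝ (heatGrad t f x)) x :=
    (hasDerivAt_inv hu).comp_hasFDerivAt x ((hasFDerivAt_heat h ht x).const_add 1)
  have h2 := ((contDiff_heatGrad h ht).differentiable (by simp) x).hasFDerivAt
  exact (h1.smul h2).neg

theorem trace_heatVelocityDeriv (h : BddCont f B) (ht : 0 < t)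
    (b : OrthonormalBasis (Fin d) ℝ (EuclideanSpace ℝ (Fin d)))
    (x : EuclideanSpace ℝ (Fin d)) :
    LinearMap.trace ℝ (EuclideanSpace ℝ (Fin d)) (heatVelocityDeriv f t x) =
      -(1 + heat t f x)⁻¹ * heatLap b t f x +
        ((1 + heat t f x) ^ 2)⁻¹ * inner ℝ (heatGrad t f x) (heatGrad t f x) := by
  have h2 := (contDiff_heatGrad h ht).differentiable (by simp) x
  have h3 : ∀ i, inner ℝ (b i) (fderiv ℝ (heatGrad t f) x (b i)) =
      fderiv ℝ (fun y => inner ℝ (heatGrad t f y) (b i)) x (b i) := fun i => by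
    rw [fderiv_inner_apply ℝ h2 (by fun_prop), real_inner_comm]
    simp
  rw [LinearMap.trace_eq_sum_inner _ b, heatLap, ← b.sum_inner_mul_inner, Finset.mul_sum,
    Finset.mul_sum, ← Finset.sum_add_distrib]
  refine Finset.sum_congr rfl fun i _ => ?_
  rw [← h3]
  simp [heatVelocityDeriv, inner_add_right, inner_neg_right, inner_smul_right]
  ring

/-- Only `τ = 1` needs an argument. There `1/t = ((1-τ)/τ)^n` tends to zero, and the decay `hD`
gives convergence to the constant density, uniformly in `x`. -/
theorem continuousOn_clockDensity (h : BddCont f B) (hn : n ≠ 0)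
    (hD : ∀ t, 0 < t → ∀ x, |heat t f x| ≤ D * t⁻¹) :
    ContinuousOn (fun p : ℝ × EuclideanSpace ℝ (Fin d) => clockDensity n f p.1 p.2)
      (Icc 0 1 ×ˢ univ) := by
  rintro ⟨τ, x⟩ ⟨hτ, -⟩
  have hτ0 : 0 ≤ τ := hτ.1
  rcases (show τ ≤ 1 from hτ.2).lt_or_eq with hlt | rfl
  · refine ContinuousAt.continuousWithinAt ?_
    have h1 : ContinuousAt (fun p : ℝ × EuclideanSpace ℝ (Fin d) => 1 + heat (clock n p.1) f p.2)
        (τ, x) := by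
      refine continuousAt_const.add ?_
      refine ContinuousAt.comp (f := fun p : ℝ × EuclideanSpace ℝ (Fin d) => (clock n p.1, p.2))
        (continuous_heat_uncurry h).continuousAt ?_
      exact (ContinuousAt.comp (g := clock n) (f := Prod.fst) (x := (τ, x))
        (continuousAt_clock n hlt.ne) continuousAt_fst).prodMk continuousAt_snd
    refine h1.congr ?_
    filter_upwards [(isOpen_Iio.preimage continuous_fst).mem_nhds
      (show (τ, x) ∈ Prod.fst ⁻¹' Iio 1 from hlt)] with p hp
    exact (if_pos hp).symm
  · rw [ContinuousWithinAt, clockDensity_one, tendsto_iff_norm_sub_tendsto_zero]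
    have hlim : Tendsto (fun p : ℝ × EuclideanSpace ℝ (Fin d) => D * ((1 - p.1) / p.1) ^ n)
        (𝓝[Icc 0 1 ×ˢ univ] (1, x)) (𝓝 0) := by
      have : ContinuousAt (fun p : ℝ × EuclideanSpace ℝ (Fin d) => D * ((1 - p.1) / p.1) ^ n)
          (1, x) := by fun_prop (disch := simp)
      have := this.tendsto
      simp only [sub_self, zero_div, zero_pow hn, mul_zero] at this
      exact this.mono_left nhdsWithin_le_nhds
    refine squeeze_zero_norm' ?_ hlim
    filter_upwards [self_mem_nhdsWithin, nhdsWithin_le_nhds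
      ((isOpen_Ioi.preimage continuous_fst).mem_nhds
        (show ((1 : ℝ), x) ∈ Prod.fst ⁻¹' Ioi 0 from zero_lt_one' ℝ))] with p hp hp0
    have hp0' : 0 < p.1 := hp0
    rw [norm_norm, clockDensity]
    split_ifs with hp1
    · rw [add_sub_cancel_left, Real.norm_eq_abs]
      refine (hD _ (clock_pos n ⟨hp0', hp1⟩) _).trans_eq ?_
      rw [clock, ← inv_pow, inv_div]
    · have : p.1 = 1 := le_antisymm hp.1.2 (not_lt.1 hp1)
      rw [this]
      simp [hn]

/-- With `u = 1 + P_t f` and `b = -∇u / u` one has `u b = -∇u`, so `∂u = Δu` is the continuity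
equation. The change of time multiplies both `∂u` and `b` by `clockDeriv`, which preserves it. -/
theorem isContinuitySolution_clock (h : BddCont f B) (hB : B ≤ 1 / 2) (hn : n ≠ 0)
    (hD : ∀ t, 0 < t → ∀ x, |heat t f x| ≤ D * t⁻¹)
    (b : OrthonormalBasis (Fin d) ℝ (EuclideanSpace ℝ (Fin d))) :
    IsContinuitySolution (clockVelocity n f)
      (fun τ x => clockDeriv n τ • heatVelocityDeriv f (clock n τ) x) (clockDensity n f)
      (fun τ x => innerSL ℝ (heatGrad (clock n τ) f x))
      (fun τ x => clockDeriv n τ * heatLap b (clock n τ) f x) (3 / 2) where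
  cont := continuousOn_clockDensity h hn hD
  bound τ _ x := by
    rw [clockDensity]
    split_ifs
    · have := abs_le.1 ((heat_bddCont h (clock n τ)).bound x)
      exact abs_le.2 ⟨by linarith, by linarith⟩
    · norm_num
  deriv_velocity τ hτ x := by
    have := (hasFDerivAt_heatVelocity h hB (clock_pos n hτ) x).const_smul (clockDeriv n τ)
    refine this.congr_of_eventuallyEq (Eventually.of_forall fun y => ?_)
    rw [clockVelocity, if_pos hτ]
    rfl
  deriv_space τ hτ x := by
    refine ((hasFDerivAt_heat h (clock_pos n hτ) x).const_add 1).congr_of_eventuallyEq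
      (Eventually.of_forall fun y => ?_)
    rw [clockDensity, if_pos hτ.2]
  bound_space τ hτ := ⟨_, fun x => by
    rw [innerSL_apply_norm]
    exact norm_heatGrad_le h (clock_pos n hτ) x⟩
  deriv_time τ hτ x := by
    have h1 := ((hasDerivAt_heat b h (clock_pos n hτ) x).comp τ
      (hasDerivAt_clock n hτ.2.ne)).const_add 1
    rw [mul_comm] at h1
    refine h1.congr_of_eventuallyEq ?_
    filter_upwards [Iio_mem_nhds hτ.2] with σ hσ
    rw [clockDensity, if_pos (show σ < 1 from hσ)]
    rfl
  cont_time := by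
    refine ContinuousOn.mul (fun p hp => ?_) ?_
    · exact ((continuousAt_clockDeriv n hp.1.2.ne).comp continuousAt_fst).continuousWithinAt
    · refine (continuousOn_heatLap_uncurry b h).comp
        (f := fun p : ℝ × EuclideanSpace ℝ (Fin d) => (clock n p.1, p.2)) (fun p hp => ?_)
        fun p hp => ⟨clock_pos n hp.1, mem_univ _⟩
      exact (((continuousAt_clock n hp.1.2.ne).comp continuousAt_fst).prodMk
        continuousAt_snd).continuousWithinAt
  bound_time τ hτ := by
    have ht := clock_pos n hτ
    refine ⟨(clockDeriv n τ + 1) * (Fintype.card (Fin d) *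
      (gaussMoment (EuclideanSpace ℝ (Fin d)) / √(clock n τ / 2) *
        (gaussMoment (EuclideanSpace ℝ (Fin d)) / √(clock n τ / 2) * B))), ?_⟩
    filter_upwards [isOpen_Ioo.mem_nhds hτ,
      (continuousAt_clock n hτ.2.ne).eventually (lt_mem_nhds (half_lt_self ht)),
      (continuousAt_clockDeriv n hτ.2.ne).eventually (gt_mem_nhds (lt_add_one _))] with σ h1 h2 h3 x
    have hpos := clockDeriv_pos hn h1
    have hpos' := clockDeriv_pos hn hτ
    rw [abs_mul, abs_of_pos hpos]
    exact mul_le_mul h3.le (abs_heatLap_le b h (half_pos ht) h2.le x) (abs_nonneg _) (by positivity)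
  eqn τ hτ x := by
    have hu : 1 + heat (clock n τ) f x ≠ 0 := by
      have := half_le_one_add_heat h hB (clock n τ) x
      positivity
    have ht := trace_heatVelocityDeriv h (clock_pos n hτ) b x
    rw [clockDensity, if_pos hτ.2, clockVelocity, if_pos hτ, ContinuousLinearMap.toLinearMap_smul,
      map_smul (LinearMap.trace ℝ (EuclideanSpace ℝ (Fin d))), ht, heatVelocity]
    simp only [innerSL_apply_apply, inner_smul_right, inner_neg_right, smul_eq_mul]
    field_simp
    ring

end Density

/-! ### Hölder norms and symmetric extension -/

section Holder

theorem abs_le_of_cHolderNorm {E : Type*} [NormedAddCommGroup E] {Ω : Set E} {α : ℝ} {g : E → ℝ}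
    (hN : cHolderNorm Ω α g ≠ ⊤) {x : E} (hx : x ∈ Ω) : |g x| ≤ (cHolderNorm Ω α g).toReal := by
  have h1 : ‖g x‖ₑ ≤ cHolderNorm Ω α g :=
    (le_iSup₂ (f := fun x (_ : x ∈ Ω) => ‖g x‖ₑ) x hx).trans le_self_add
  have := ENNReal.toReal_mono hN h1
  rwa [toReal_enorm] at this

theorem abs_sub_le_of_cHolderNorm {E : Type*} [NormedAddCommGroup E] {Ω : Set E} {α : ℝ}
    {g : E → ℝ} (hN : cHolderNorm Ω α g ≠ ⊤) {x y : E} (hx : x ∈ Ω) (hy : y ∈ Ω) :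
    |g x - g y| ≤ (cHolderNorm Ω α g).toReal * ‖x - y‖ ^ α := by
  rcases eq_or_ne x y with rfl | hxy
  · rw [sub_self, abs_zero]
    positivity
  have h1 : edist (g y) (g x) / edist x y ^ α ≤ cHolderNorm Ω α g := by
    have h2 := le_iSup (fun _ : x ≠ y => edist (g y) (g x) / edist x y ^ α) hxy
    have h3 := le_iSup₂ (f := fun y (_ : y ∈ Ω) =>
      ⨆ _ : x ≠ y, edist (g y) (g x) / edist x y ^ α) y hy
    have h4 := le_iSup₂ (f := fun x (_ : x ∈ Ω) =>
      ⨆ y ∈ Ω, ⨆ _ : x ≠ y, edist (g y) (g x) / edist x y ^ α) x hx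
    exact ((h2.trans h3).trans h4).trans le_add_self
  have h2 := ENNReal.toReal_mono hN h1
  have hpos : 0 < ‖x - y‖ ^ α := Real.rpow_pos_of_pos (norm_pos_iff.2 (sub_ne_zero.2 hxy)) α
  rw [ENNReal.toReal_div, ← ENNReal.toReal_rpow, edist_comm, ← dist_edist, ← dist_edist,
    Real.dist_eq, dist_eq_norm, div_le_iff₀ hpos] at h2
  exact h2

theorem lipConst_le_of_lipschitzWith {E F : Type*} [MetricSpace E] [MetricSpace F] {K : ℝ≥0}
    {f : E → F} (hf : LipschitzWith K f) (Ω : Set E) : lipConst Ω f ≤ K := by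
  refine iSup₂_le fun x _ => iSup₂_le fun y _ => iSup_le fun hxy => ?_
  refine ENNReal.div_le_of_le_mul ?_
  rw [edist_comm x y]
  exact hf y x

/-- The Hölder extension of a function from a subset. -/
theorem exists_holder_extension {E : Type*} [NormedAddCommGroup E] {Ω : Set E}
    (hΩ : Ω.Nonempty) {α ε : ℝ} {g : E → ℝ} (hα0 : 0 < α) (hα1 : α ≤ 1) (hε : 0 ≤ ε)
    (hb : ∀ x ∈ Ω, |g x| ≤ ε) (hol : ∀ x ∈ Ω, ∀ y ∈ Ω, |g x - g y| ≤ ε * ‖x - y‖ ^ α) :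
    ∃ f : E → ℝ, (∀ x, |f x| ≤ ε) ∧ (∀ x y, |f x - f y| ≤ ε * ‖x - y‖ ^ α) ∧
      ∀ x ∈ Ω, f x = g x := by
  have : Nonempty Ω := hΩ.to_subtype
  -- McShane's formula. Since `α ≤ 1`, the power `r^α` is subadditive, so `F` keeps the Hölder
  -- constant; truncation to `[-ε, ε]` then restores the uniform bound at no cost.
  set F : E → ℝ := fun x => ⨅ y : Ω, (g y + ε * ‖x - y‖ ^ α) with hF
  have hbdd : ∀ x : E, BddBelow (range fun y : Ω => g y + ε * ‖x - y‖ ^ α) := fun x => by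
    refine ⟨-ε, ?_⟩
    rintro _ ⟨y, rfl⟩
    have := (abs_le.1 (hb y y.2)).1
    have : 0 ≤ ε * ‖x - y‖ ^ α := by positivity
    linarith
  have hle : ∀ x z : E, F x - F z ≤ ε * ‖x - z‖ ^ α := by
    intro x z
    rw [sub_le_comm]
    refine le_ciInf fun y => ?_
    have h1 : F x ≤ g y + ε * ‖x - y‖ ^ α := ciInf_le (hbdd x) y
    have h2 : ‖x - y‖ ^ α ≤ ‖x - z‖ ^ α + ‖z - y‖ ^ α := by
      have h3 : ‖x - y‖ ≤ ‖x - z‖ + ‖z - y‖ := norm_sub_le_norm_sub_add_norm_sub _ _ _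
      exact (Real.rpow_le_rpow (norm_nonneg _) h3 hα0.le).trans
        (Real.rpow_add_le_add_rpow (norm_nonneg _) (norm_nonneg _) hα0.le hα1)
    nlinarith [mul_le_mul_of_nonneg_left h2 hε]
  have hFg : ∀ x ∈ Ω, F x = g x := by
    intro x hx
    refine le_antisymm ?_ (le_ciInf fun y => ?_)
    · refine (ciInf_le (hbdd x) ⟨x, hx⟩).trans_eq ?_
      rw [sub_self, norm_zero, Real.zero_rpow hα0.ne', mul_zero, add_zero]
    · linarith [(abs_le.1 (hol x hx y y.2)).2]
  refine ⟨fun x => max (min (F x) ε) (-ε), fun x => abs_le.2 ⟨le_max_right _ _,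
    max_le (min_le_right _ _) (by linarith)⟩, fun x y => ?_, fun x hx => ?_⟩
  · refine (abs_max_sub_max_le_abs _ _ _).trans ((abs_min_sub_min_le_max _ _ _ _).trans ?_)
    rw [sub_self, abs_zero]
    refine max_le (abs_sub_le_iff.2 ⟨hle x y, ?_⟩) (by positivity)
    rw [norm_sub_rev]
    exact hle y x
  · have := abs_le.1 (hb x hx)
    simp only
    rw [hFg x hx, min_eq_left this.2, max_eq_left this.1]

theorem continuous_of_holder {E : Type*} [NormedAddCommGroup E] {α ε : ℝ} {f : E → ℝ}
    (hα0 : 0 < α) (hol : ∀ x y, |f x - f y| ≤ ε * ‖x - y‖ ^ α) : Continuous f := by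
  rw [continuous_iff_continuousAt]
  intro x
  rw [ContinuousAt, tendsto_iff_norm_sub_tendsto_zero]
  have h1 : Continuous fun y => ε * ‖y - x‖ ^ α :=
    continuous_const.mul ((Real.continuous_rpow_const hα0.le).comp (by fun_prop))
  have h2 := h1.tendsto x
  rw [sub_self, norm_zero, Real.zero_rpow hα0.ne', mul_zero] at h2
  exact squeeze_zero (fun _ => norm_nonneg _) (fun y => hol y x) h2

theorem unitCube_nonempty (d : ℕ) : (unitCube d).Nonempty :=
  ⟨WithLp.toLp 2 fun _ => 1 / 2, fun i => by norm_num⟩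

/-- The folding is 1-Lipschitz, idempotent and the identity on the closed cube, so composing a
Hölder extension with it adds the symmetry without worsening any constant. -/
theorem exists_foldInvariant_extension {d : ℕ} {α ε : ℝ} {g : EuclideanSpace ℝ (Fin d) → ℝ}
    (hα0 : 0 < α) (hα1 : α ≤ 1) (hε : 0 ≤ ε) (hb : ∀ x ∈ unitCube d, |g x| ≤ ε)
    (hol : ∀ x ∈ unitCube d, ∀ y ∈ unitCube d, |g x - g y| ≤ ε * ‖x - y‖ ^ α) :
    ∃ f : EuclideanSpace ℝ (Fin d) → ℝ, BddCont f ε ∧ FoldInvariant f ∧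
      (∀ x y, |f x - f y| ≤ ε * ‖x - y‖ ^ α) ∧ ∀ x ∈ unitCube d, f x = g x := by
  obtain ⟨F, h1, h2, h3⟩ := exists_holder_extension (unitCube_nonempty d) hα0 hα1 hε hb hol
  refine ⟨fun x => F (cubeFold x), ⟨(continuous_of_holder hα0 h2).comp continuous_cubeFold,
    fun x => h1 _⟩, fun x => ?_, fun x y => (h2 _ _).trans ?_, fun x hx => ?_⟩
  · simp only
    rw [cubeFold_of_mem_Icc (cubeFold_mem_Icc x)]
  · gcongr
    exact norm_cubeFold_sub_le x y
  · simp only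
    rw [cubeFold_of_mem_Icc (unitCube_mem_Icc hx), h3 x hx]

theorem exp_mul_le_one_add {c ε : ℝ} (hc : 0 ≤ c) (hε0 : 0 ≤ ε) (hε1 : ε ≤ 1) :
    Real.exp (c * ε) ≤ 1 + c * Real.exp c * ε := by
  have h1 : Real.exp (c * ε) - 1 ≤ c * ε * Real.exp (c * ε) := by
    have h2 := Real.add_one_le_exp (-(c * ε))
    have h3 : Real.exp (-(c * ε)) * Real.exp (c * ε) = 1 := by
      rw [← Real.exp_add, neg_add_cancel, Real.exp_zero]
    nlinarith [Real.exp_pos (c * ε)]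
  have h2 : c * ε * Real.exp (c * ε) ≤ c * ε * Real.exp c := by
    gcongr
    nlinarith
  linarith

end Holder

/-! ### The flow on the cube and its push-forward -/

section CubeFlow

variable {d : ℕ} {V : ℝ → EuclideanSpace ℝ (Fin d) → EuclideanSpace ℝ (Fin d)}
  {Y : ℝ → ℝ → EuclideanSpace ℝ (Fin d) → EuclideanSpace ℝ (Fin d)} {K : ℝ≥0} {a b : ℝ}

/-- `V` is equivariant under the reflections in the hyperplanes `x i = c`, `c ∈ ℤ`. -/
def ReflectionEquivariant
    (V : ℝ → EuclideanSpace ℝ (Fin d) → EuclideanSpace ℝ (Fin d)) : Prop :=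
  ∀ (i : Fin d) (c : ℤ) (τ : ℝ) (x : EuclideanSpace ℝ (Fin d)),
    V τ (signFlip (fun j => decide (j = i)) x +
      WithLp.toLp 2 fun j => (((if j = i then c else 0 : ℤ) : ℝ) * 2)) =
    signFlip (fun j => decide (j = i)) (V τ x)

namespace IsODEFlow

/-- A point of the hyperplane is fixed by the reflection, so by equivariance the whole trajectory
is, and its coordinate satisfies `y = -y + 2c`. -/
theorem apply_eq_of_apply_eq (hY : IsODEFlow V Y) (hL : ∀ τ, LipschitzWith K (V τ))
    (hV : ReflectionEquivariant V) (ha : a ∈ Icc (0 : ℝ) 1) (hb : b ∈ Icc (0 : ℝ) 1) {i : Fin d}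
    {c : ℤ} {x : EuclideanSpace ℝ (Fin d)} (hx : x i = c) : Y a b x i = c := by
  have h := hY.equivariant hL ((signFlip fun j => decide (j = i)).toContinuousLinearEquiv :
    EuclideanSpace ℝ (Fin d) →L[ℝ] EuclideanSpace ℝ (Fin d)) _ (hV i c) ha hb x
  have h2 := congrArg (fun z : EuclideanSpace ℝ (Fin d) => z i)
    ((congrArg (Y a b) (signFlip_single_apply_of_eq i c hx)).symm.trans h)
  have h3 : Y a b x i = signFlip (fun j => decide (j = i)) (Y a b x) i +
      (((if i = i then c else 0 : ℤ) : ℝ) * 2) := h2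
  rw [signFlip_apply] at h3
  simp only [decide_true, if_true] at h3
  linarith

theorem apply_eq_iff (hY : IsODEFlow V Y) (hL : ∀ τ, LipschitzWith K (V τ))
    (hV : ReflectionEquivariant V) (ha : a ∈ Icc (0 : ℝ) 1) (hb : b ∈ Icc (0 : ℝ) 1) {i : Fin d}
    {c : ℤ} {x : EuclideanSpace ℝ (Fin d)} : Y a b x i = c ↔ x i = c := by
  refine ⟨fun h => ?_, hY.apply_eq_of_apply_eq hL hV ha hb⟩
  have := hY.apply_eq_of_apply_eq hL hV hb ha h
  rwa [hY.comp hL ha hb ha, hY.init a ha] at this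

/-- To leave the cube a coordinate would have to cross `0` or `1`, by the intermediate value
theorem; but a trajectory that meets one of these hyperplanes has always been in it. -/
theorem mapsTo_unitCube (hY : IsODEFlow V Y) (hL : ∀ τ, LipschitzWith K (V τ))
    (hV : ReflectionEquivariant V) (ha : a ∈ Icc (0 : ℝ) 1) (hb : b ∈ Icc (0 : ℝ) 1) :
    MapsTo (Y a b) (unitCube d) (unitCube d) := by
  intro x hx i
  have hc : ContinuousOn (fun s => Y a s x i) (Icc 0 1) := by
    refine (EuclideanSpace.proj (𝕜 := ℝ) i).continuous.comp_continuousOn fun s hs => ?_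
    exact (hY.deriv a ha x s (Icc_subset_Ioo_time hs)).continuousAt.continuousWithinAt
  have hne : ∀ c : ℤ, x i ≠ c → (c : ℝ) ∉ (fun s => Y a s x i) '' Icc 0 1 := by
    rintro c hxc ⟨s, hs, h⟩
    exact hxc ((hY.apply_eq_iff hL hV ha hs).1 h)
  have h0 := hne 0 (by simpa using (hx i).1.ne')
  have h1 := hne 1 (by simpa using (hx i).2.ne)
  have hinit : Y a a x i = x i := by rw [hY.init a ha]
  push_cast at h0 h1
  refine ⟨not_le.1 fun hle => h0 ?_, not_le.1 fun hle => h1 ?_⟩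
  · exact isPreconnected_Icc.intermediate_value hb ha hc ⟨hle, hinit.symm ▸ (hx i).1.le⟩
  · exact isPreconnected_Icc.intermediate_value ha hb hc ⟨hinit.symm ▸ (hx i).2.le, hle⟩

/-- The flow map as a homeomorphism. -/
noncomputable def homeomorph (hY : IsODEFlow V Y) (hL : ∀ τ, LipschitzWith K (V τ))
    (ha : a ∈ Icc (0 : ℝ) 1) (hb : b ∈ Icc (0 : ℝ) 1) :
    EuclideanSpace ℝ (Fin d) ≃ₜ EuclideanSpace ℝ (Fin d) where
  toFun := Y a b
  invFun := Y b a
  left_inv x := by rw [hY.comp hL ha hb ha, hY.init a ha]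
  right_inv x := by rw [hY.comp hL hb ha hb, hY.init b hb]
  continuous_toFun := (hY.lipschitzWith hL ha hb).continuous
  continuous_invFun := (hY.lipschitzWith hL hb ha).continuous

theorem image_unitCube (hY : IsODEFlow V Y) (hL : ∀ τ, LipschitzWith K (V τ))
    (hV : ReflectionEquivariant V) (ha : a ∈ Icc (0 : ℝ) 1) (hb : b ∈ Icc (0 : ℝ) 1) :
    hY.homeomorph hL ha hb '' unitCube d = unitCube d := by
  refine Subset.antisymm (hY.mapsTo_unitCube hL hV ha hb).image_subset fun y hy => ?_
  exact ⟨Y b a y, hY.mapsTo_unitCube hL hV hb ha hy, (hY.homeomorph hL ha hb).right_inv y⟩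

theorem preimage_inter_unitCube (hY : IsODEFlow V Y) (hL : ∀ τ, LipschitzWith K (V τ))
    (hV : ReflectionEquivariant V) (ha : a ∈ Icc (0 : ℝ) 1) (hb : b ∈ Icc (0 : ℝ) 1)
    (O : Set (EuclideanSpace ℝ (Fin d))) :
    Y a b ⁻¹' (O ∩ unitCube d) = Y a b ⁻¹' O ∩ unitCube d := by
  have h := (hY.homeomorph hL ha hb).preimage_image (unitCube d)
  rw [hY.image_unitCube hL hV] at h
  rw [preimage_inter]
  exact congrArg _ h

end IsODEFlow

theorem reflectionEquivariant_clockVelocity {f : EuclideanSpace ℝ (Fin d) → ℝ} {B : ℝ}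
    (h : BddCont f B) (hf : FoldInvariant f) (n : ℕ) :
    ReflectionEquivariant (clockVelocity n f) := fun i c τ x =>
  clockVelocity_isometry h n _ _
    (fun x => hf.apply_signFlip_add _ (fun j => if j = i then c else 0) x) τ x

theorem neg_gradient_log {f : EuclideanSpace ℝ (Fin d) → ℝ} {B t : ℝ} (h : BddCont f B)
    (hB : B ≤ 1 / 2) (ht : 0 < t) (x : EuclideanSpace ℝ (Fin d)) :
    -gradient (fun y => Real.log (1 + heat t f y)) x = heatVelocity f t x := by
  have hu : 1 + heat t f x ≠ 0 := by
    have := half_le_one_add_heat h hB t x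
    positivity
  have h1 := ((hasFDerivAt_heat h ht x).const_add 1).log hu
  rw [gradient, h1.fderiv, heatVelocity, ← map_smul]
  congr 1
  exact (InnerProductSpace.toDual ℝ _).symm_apply_apply _

theorem intervalIntegrable_heatWeight {α : ℝ} (hα : 0 < α) (t : ℝ) :
    IntervalIntegrable (fun s => s ^ (α / 2 - 1) + 1) volume 0 t :=
  (intervalIntegral.intervalIntegrable_rpow' (by linarith)).add intervalIntegrable_const

theorem heatWeight_le (α : ℝ) {s : ℝ} (hs : 0 < s) : heatWeight α s ≤ s ^ (α / 2 - 1) + 1 := by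
  have h1 := (Real.rpow_pos_of_pos hs (α / 2 - 1)).le
  rw [heatWeight]
  split_ifs with h
  · linarith
  · have := Real.rpow_le_one_of_one_le_of_nonpos (not_le.1 h).le (show (-(3 / 2) : ℝ) ≤ 0 by norm_num)
    linarith

variable {n : ℕ} {f : EuclideanSpace ℝ (Fin d) → ℝ} {A B α : ℝ}

theorem hasDerivAt_flow_clockInv (hY : IsODEFlow (clockVelocity n f) Y) (hn : n ≠ 0) {t : ℝ}
    (ht : 0 < t) (x : EuclideanSpace ℝ (Fin d)) :
    HasDerivAt (fun t => Y 0 (clockInv n t) x) (heatVelocity f t (Y 0 (clockInv n t) x)) t := by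
  have hσ := clockInv_mem_Ioo n ht
  have h1 := (hY.deriv 0 (left_mem_Icc.2 zero_le_one) x _
    (IsODEFlow.Icc_subset_Ioo_time (Ioo_subset_Icc_self hσ))).scomp t (hasDerivAt_clockInv hn ht)
  rw [clockVelocity, if_pos hσ, smul_smul, inv_mul_cancel₀ (clockDeriv_pos hn hσ).ne', one_smul,
    clock_clockInv hn ht.le] at h1
  exact h1

theorem continuousOn_flow_clockInv (hY : IsODEFlow (clockVelocity n f) Y)
    (x : EuclideanSpace ℝ (Fin d)) :
    ContinuousOn (fun t => Y 0 (clockInv n t) x) (Ici 0) := by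
  refine ContinuousOn.comp (g := fun b => Y 0 b x) (t := Icc 0 1) (fun s hs => ?_)
    (continuousOn_clockInv n) fun t ht => clockInv_mem_Icc n ht
  exact (hY.deriv 0 (left_mem_Icc.2 zero_le_one) x s
    (IsODEFlow.Icc_subset_Ioo_time hs)).continuousAt.continuousWithinAt

theorem intervalIntegrable_flow_clockInv (h : BddCont f B) (hB : B ≤ 1 / 2) (hα : 0 < α)
    (hA : 0 ≤ A) (hV : ∀ t, 0 < t → ∀ x, ‖heatVelocity f t x‖ ≤ A * heatWeight α t)
    (hY : IsODEFlow (clockVelocity n f) Y) {t : ℝ} (ht : 0 ≤ t) (x : EuclideanSpace ℝ (Fin d)) :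
    IntervalIntegrable (fun s => heatVelocity f s (Y 0 (clockInv n s) x)) volume 0 t := by
  refine ((intervalIntegrable_heatWeight hα t).const_mul A).mono_fun' ?_ ?_
  · rw [uIoc_of_le ht]
    refine ContinuousOn.aestronglyMeasurable ?_ measurableSet_Ioc
    refine (continuousOn_heatVelocity_uncurry h hB).comp
      (f := fun s => (s, Y 0 (clockInv n s) x)) (continuousOn_id.prodMk
        ((continuousOn_flow_clockInv hY x).mono fun s hs => hs.1.le)) fun s hs => ⟨hs.1, mem_univ _⟩
  · rw [uIoc_of_le ht]
    filter_upwards [ae_restrict_mem measurableSet_Ioc] with s hs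
    exact (hV s hs.1 _).trans (mul_le_mul_of_nonneg_left (heatWeight_le α hs.1) hA)

/-- In the original time the velocity may blow up at `0`, so the integral equation is the
fundamental theorem of calculus for a path that is continuous on `[0,t]`, differentiable inside, and
has an integrable derivative. -/
theorem isFlowOn_clockInv {K : ℝ≥0} (h : BddCont f B) (hB : B ≤ 1 / 2) (hf : FoldInvariant f)
    (hα : 0 < α) (hA : 0 ≤ A) (hn : n ≠ 0)
    (hV : ∀ t, 0 < t → ∀ x, ‖heatVelocity f t x‖ ≤ A * heatWeight α t)
    (hY : IsODEFlow (clockVelocity n f) Y) (hL : ∀ τ, LipschitzWith K (clockVelocity n f τ)) :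
    IsFlowOn (unitCube d) (fun t x => -gradient (fun y => Real.log (1 + heat t f y)) x)
      (fun t x => Y 0 (clockInv n t) x) := by
  intro x hx t ht
  have h01 : (0 : ℝ) ∈ Icc (0 : ℝ) 1 := left_mem_Icc.2 zero_le_one
  have hcongr : EqOn (fun s => heatVelocity f s (Y 0 (clockInv n s) x))
      (fun s => -gradient (fun y => Real.log (1 + heat s f y)) (Y 0 (clockInv n s) x))
      (uIoc 0 t) := fun s hs => by
    rw [uIoc_of_le ht] at hs
    exact (neg_gradient_log h hB hs.1 _).symm
  have hint := intervalIntegrable_flow_clockInv h hB hα hA hV hY ht x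
  refine ⟨hY.mapsTo_unitCube hL (reflectionEquivariant_clockVelocity h hf n) h01
    (clockInv_mem_Icc n ht) hx, hint.congr hcongr, ?_⟩
  have hFTC := intervalIntegral.integral_eq_sub_of_hasDerivAt_of_le ht
    ((continuousOn_flow_clockInv hY x).mono fun s hs => hs.1)
    (fun s hs => hasDerivAt_flow_clockInv hY hn hs.1 x) hint
  rw [clockInv_zero hn, hY.init 0 h01] at hFTC
  rw [← intervalIntegral.integral_congr_ae (Eventually.of_forall hcongr), hFTC]
  abel

theorem tendsto_flow_clockInv (hY : IsODEFlow (clockVelocity n f) Y) (hn : n ≠ 0)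
    (x : EuclideanSpace ℝ (Fin d)) :
    Tendsto (fun t => Y 0 (clockInv n t) x) atTop (𝓝 (Y 0 1 x)) :=
  (hY.deriv 0 (left_mem_Icc.2 zero_le_one) x 1
    (by norm_num)).continuousAt.tendsto.comp (tendsto_clockInv hn)

theorem map_flow_densityMeasure {K : ℝ≥0} {D : ℝ} (hd : 1 ≤ d) (h : BddCont f B) (hB : B ≤ 1 / 2)
    (hf : FoldInvariant f) (hn : n ≠ 0) (hD : ∀ t, 0 < t → ∀ x, |heat t f x| ≤ D * t⁻¹)
    (hY : IsODEFlow (clockVelocity n f) Y) (hL : ∀ τ, LipschitzWith K (clockVelocity n f τ))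
    (hM : ∀ τ x, ‖clockVelocity n f τ x‖ ≤ A) {ρ : EuclideanSpace ℝ (Fin d) → ℝ}
    (hρ : ∀ x ∈ unitCube d, 1 + f x = ρ x) :
    Measure.map (Y 0 1) (densityMeasure (unitCube d) ρ) = volume.restrict (unitCube d) := by
  have h01 : (0 : ℝ) ∈ Icc (0 : ℝ) 1 := left_mem_Icc.2 zero_le_one
  have h11 : (1 : ℝ) ∈ Icc (0 : ℝ) 1 := right_mem_Icc.2 zero_le_one
  have hc : Continuous (Y 0 1) := (hY.lipschitzWith hL h01 h11).continuous
  have hsol := isContinuitySolution_clock h hB hn hD (EuclideanSpace.basisFun (Fin d) ℝ)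
  have hopen : ∀ O : Set (EuclideanSpace ℝ (Fin d)), IsOpen O →
      volume.restrict (unitCube d) O =
        Measure.map (Y 0 1) (densityMeasure (unitCube d) ρ) O := by
    intro O hO
    have hU := hO.inter (isOpen_unitCube d)
    have hpre := hY.preimage_inter_unitCube hL (reflectionEquivariant_clockVelocity h hf n) h01 h11 O
    -- The open set is intersected with the cube, which makes it bounded; its complement contains
    -- the origin, because `1 ≤ d` provides a coordinate.
    have key := setIntegral_preimage_transported_eq (R := √d) volume hsol hL hM hY hU
      (fun x hx => by
        have := norm_sub_le_of_mem_Icc (y := 0) (unitCube_mem_Icc hx.2) (fun i => by simp)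
        rwa [sub_zero] at this) ⟨0, fun h0 => lt_irrefl _ (h0.2 ⟨0, hd⟩).1⟩
    have hmeas : MeasurableSet (Y 0 1 ⁻¹' O ∩ unitCube d) :=
      ((hO.preimage hc).inter (isOpen_unitCube d)).measurableSet
    simp only [clockDensity_one, clockDensity_zero hn, hpre] at key
    rw [setIntegral_const, smul_eq_mul, mul_one] at key
    have hfin : volume (O ∩ unitCube d) ≠ ⊤ :=
      ((measure_mono inter_subset_right).trans_lt (by rw [volume_unitCube]; simp)).ne
    have hfin' : volume (Y 0 1 ⁻¹' O ∩ unitCube d) ≠ ⊤ :=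
      ((measure_mono inter_subset_right).trans_lt (by rw [volume_unitCube]; simp)).ne
    have hint : IntegrableOn (fun x => 1 + f x) (Y 0 1 ⁻¹' O ∩ unitCube d) :=
      Measure.integrableOn_of_bounded (M := 3 / 2) hfin'
        (continuous_const.add h.cont).aestronglyMeasurable (Eventually.of_forall fun x => by
          have := abs_le.1 (h.bound x)
          exact abs_le.2 ⟨by linarith, by linarith⟩)
    rw [Measure.map_apply hc.measurable hO.measurableSet, densityMeasure,
      withDensity_apply _ (hO.preimage hc).measurableSet, Measure.restrict_restrict
        (hO.preimage hc).measurableSet, Measure.restrict_apply hO.measurableSet,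
      ← setLIntegral_congr_fun hmeas (f := fun x => ENNReal.ofReal (1 + f x))
        fun x hx => by simp only [hρ x hx.2],
      ← ofReal_integral_eq_lintegral_ofReal hint (Eventually.of_forall fun x => by
        have := abs_le.1 (h.bound x)
        show (0 : ℝ) ≤ 1 + f x
        linarith), key, Measure.real, ENNReal.ofReal_toReal hfin]
  exact (ext_of_generate_finite {O | IsOpen O} BorelSpace.measurable_eq
    isPiSystem_isOpen (fun O hO => hopen O hO) (hopen univ isOpen_univ)).symm

end CubeFlow

/-! ### Assembly of the transport map -/

theorem mainTheorem8 (d : ℕ) (hd : 1 ≤ d) (α : ℝ) (hα0 : 0 < α) (hα1 : α ≤ 1) :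
    ∃ C : ℝ≥0, ∀ ρ : EuclideanSpace ℝ (Fin d) → ℝ,
      (∀ x ∈ unitCube d, 0 < ρ x) →
      ∫ x in unitCube d, ρ x = 1 →
      cHolderNorm (unitCube d) α (fun x => ρ x - 1) ≤ 1 / 2 →
      ∃ (u : ℝ → EuclideanSpace ℝ (Fin d) → ℝ)
        (X : ℝ → EuclideanSpace ℝ (Fin d) → EuclideanSpace ℝ (Fin d))
        (T S : EuclideanSpace ℝ (Fin d) → EuclideanSpace ℝ (Fin d)),
        -- `u t = P_t ρ`, in its positive continuously differentiable version
        IsNeumannHeatFlow (unitCube d) ρ u ∧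
        (∀ t : ℝ, 0 < t →
          ContDiffOn ℝ 1 (u t) (unitCube d) ∧ ∀ x ∈ unitCube d, 0 < u t x) ∧
        -- `X` is the flow of `-∇ log P_t ρ`, and `T` is its limit as `t → ∞`
        IsFlowOn (unitCube d) (fun t x => - gradient (fun y => Real.log (u t y)) x) X ∧
        (∀ x ∈ unitCube d, Tendsto (fun t : ℝ => X t x) atTop (𝓝 (T x))) ∧
        -- `T` maps the cube onto itself, with inverse `S`, also up to the boundary
        BijOn T (unitCube d) (unitCube d) ∧
        BijOn T (closure (unitCube d)) (closure (unitCube d)) ∧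
        InvOn S T (closure (unitCube d)) (closure (unitCube d)) ∧
        -- `T` pushes `ρ` to the uniform density
        Measure.map T (densityMeasure (unitCube d) ρ) = volume.restrict (unitCube d) ∧
        lipConst (closure (unitCube d)) T ≤
          1 + C * cHolderNorm (unitCube d) α (fun x => ρ x - 1) ∧
        lipConst (closure (unitCube d)) S ≤
          1 + C * cHolderNorm (unitCube d) α (fun x => ρ x - 1) ∧
        T '' frontier (unitCube d) = frontier (unitCube d) := by
  obtain ⟨C₀, hC₀, hvel⟩ := exists_heatVelocity_bounds d hα0 hα1
  obtain ⟨n, hn4, hnα⟩ : ∃ n : ℕ, 4 ≤ n ∧ 4 ≤ α * n := by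
    refine ⟨max 4 ⌈4 / α⌉₊, le_max_left _ _, ?_⟩
    have h1 : 4 / α ≤ (max 4 ⌈4 / α⌉₊ : ℕ) :=
      (Nat.le_ceil _).trans (Nat.cast_le.2 (le_max_right _ _))
    rwa [div_le_iff₀' hα0] at h1
  have hn : n ≠ 0 := by omega
  set c : ℝ := 8 * n * C₀ with hc
  have hc0 : 0 ≤ c := by positivity
  -- The flow has Lipschitz constant `exp (c ε)`, and `exp (c ε) ≤ 1 + c exp(c) ε` for `ε ≤ 1`.
  refine ⟨(c * Real.exp c).toNNReal, fun ρ _ hρ1 hN => ?_⟩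
  have hNtop : cHolderNorm (unitCube d) α (fun x => ρ x - 1) ≠ ⊤ :=
    ne_top_of_le_ne_top (by simp) hN
  set ε := (cHolderNorm (unitCube d) α (fun x => ρ x - 1)).toReal with hε
  have hε0 : 0 ≤ ε := ENNReal.toReal_nonneg
  have hε2 : ε ≤ 1 / 2 := by
    have := ENNReal.toReal_mono (by simp) hN
    simpa using this
  obtain ⟨f, hfb, hfold, hhol, hfρ⟩ := exists_foldInvariant_extension (α := α) hα0 hα1 hε0
    (fun x hx => abs_le_of_cHolderNorm hNtop hx)
    (fun x hx y hy => abs_sub_le_of_cHolderNorm hNtop hx hy)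
  have hfρ' : ∀ x ∈ unitCube d, 1 + f x = ρ x := fun x hx => by rw [hfρ x hx]; ring
  have hint0 : ∫ x in unitCube d, f x = 0 := by
    -- Otherwise the integral would be zero by convention, not one.
    have hρint : IntegrableOn ρ (unitCube d) := by
      by_contra hcon
      rw [integral_undef hcon] at hρ1
      exact zero_ne_one hρ1
    rw [setIntegral_congr_fun (measurableSet_unitCube d) hfρ, integral_sub hρint (integrable_const 1),
      hρ1]
    simp
  set A := C₀ * ε with hA
  have hA0 : 0 ≤ A := by positivity
  have hV1 : ∀ t, 0 < t → ∀ x, ‖heatVelocity f t x‖ ≤ A * heatWeight α t := fun t ht x =>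
    (hvel f ε hfb hε2 hfold hhol hint0 t ht x x).1
  have hV2 : ∀ t, 0 < t → ∀ x y,
      ‖heatVelocity f t x - heatVelocity f t y‖ ≤ A * heatWeight α t * ‖x - y‖ := fun t ht x y =>
    (hvel f ε hfb hε2 hfold hhol hint0 t ht x y).2
  have hD : ∀ t, 0 < t → ∀ x, |heat t f x| ≤
      16 * (gaussMoment (EuclideanSpace ℝ (Fin d)) * √d) ^ 2 * ε * t⁻¹ := fun t ht x => by
    have := abs_heat_decay hfb hfold hα0 hα1 hε0 hhol hint0 ht x
    rwa [Real.rpow_neg_one] at this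
  have hcA : 8 * n * A = c * ε := by rw [hA, hc]; ring
  have hcε : 0 ≤ c * ε := by positivity
  have hK : ((c * ε).toNNReal : ℝ) = c * ε := Real.coe_toNNReal _ hcε
  have hL : ∀ τ, LipschitzWith (c * ε).toNNReal (clockVelocity n f τ) :=
    lipschitzWith_clockVelocity hA0 hn4 hnα hV2 (by rw [hK, hcA])
  have hM : ∀ τ x, ‖clockVelocity n f τ x‖ ≤ (c * ε).toNNReal := fun τ x => by
    rw [hK, ← hcA]
    exact norm_clockVelocity_le hA0 hn4 hnα hV1 τ x
  obtain ⟨Y, hY⟩ := exists_isODEFlow hL (continuous_clockVelocity hfb hε2 hA0 hn4 hnα hV1) hM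
  have h01 : (0 : ℝ) ∈ Icc (0 : ℝ) 1 := left_mem_Icc.2 zero_le_one
  have h11 : (1 : ℝ) ∈ Icc (0 : ℝ) 1 := right_mem_Icc.2 zero_le_one
  have hrefl := reflectionEquivariant_clockVelocity hfb hfold n
  have himg := hY.image_unitCube hL hrefl h01 h11
  set Φ := hY.homeomorph hL h01 h11
  have hlip : ∀ a ∈ Icc (0 : ℝ) 1, ∀ b ∈ Icc (0 : ℝ) 1,
      lipConst (closure (unitCube d)) (Y a b) ≤ 1 + (c * Real.exp c).toNNReal *
        cHolderNorm (unitCube d) α (fun x => ρ x - 1) := fun a ha b hb => by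
    refine (lipConst_le_of_lipschitzWith (hY.lipschitzWith hL ha hb) _).trans ?_
    rw [hK, ← ENNReal.ofReal_toReal hNtop, ← hε]
    refine (ENNReal.ofReal_le_ofReal (exp_mul_le_one_add hc0 hε0 (by linarith))).trans_eq ?_
    rw [ENNReal.ofReal_add zero_le_one (by positivity), ENNReal.ofReal_one,
      ENNReal.ofReal_mul (by positivity)]
    rfl
  have hbij : ∀ s, Φ '' s = s → BijOn (Y 0 1) s s := fun s hs => by
    have := Φ.injective.injOn.bijOn_image (s := s)
    rwa [hs] at this
  -- The Neumann flow starts from `1 + f`, which extends `ρ`, while the estimates concern `f`, which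
  -- has zero mean; the two evolutions differ by the constant `1`.
  have hFb : BddCont (fun x => 1 + f x) (3 / 2) := ⟨continuous_const.add hfb.cont, fun x => by
    have := abs_le.1 (hfb.bound x)
    exact abs_le.2 ⟨by linarith, by linarith⟩⟩
  have hheat : (fun t => heat t fun x => 1 + f x) = fun t x => 1 + heat t f x := by
    ext t x
    exact heat_const_add hfb 1 t x
  refine ⟨fun t x => 1 + heat t f x, fun t x => Y 0 (clockInv n t) x, Y 0 1, Y 1 0, ?_,
    fun t ht => ⟨?_, fun x _ => ?_⟩, isFlowOn_clockInv hfb hε2 hfold hα0 hA0 hn hV1 hY hL,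
    fun x _ => tendsto_flow_clockInv hY hn x, hbij _ himg, hbij _ ?_,
    ⟨fun x _ => Φ.left_inv x, fun x _ => Φ.right_inv x⟩,
    map_flow_densityMeasure hd hfb hε2 hfold hn hD hY hL hM hfρ', hlip 0 h01 1 h11,
    hlip 1 h11 0 h01, ?_⟩
  · rw [← hheat]
    exact isNeumannHeatFlow_heat hFb (fun x => by simp only [hfold x]) hα0 hα1 hε0
      (fun x y => by simpa using hhol x y) hfρ'
  · exact (contDiff_const.add ((contDiff_heat hfb ht).of_le (by simp))).contDiffOn
  · linarith [half_le_one_add_heat hfb hε2 t x]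
  · rw [Φ.image_closure, himg]
  · have := Φ.image_frontier (unitCube d)
    rwa [himg] at this
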